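/- For $0<\beta\le\pi/2$ let $S_\beta=\{(x,y)\in\mathbb R^2: x^2+y^2\le 1,\ y\ge-\cos\beta\}$ be the convex region bounded by an arc of angle $2\pi-2\beta$ of the unit circle and its chord (the "circular sector" of angle $2\pi-2\beta$). Let $F_\beta$ be the outer billiard map around $S_\beta$: for $z\notin S_\beta$, $F_\beta(z)=w$ if the line directed from $z$ to $w$ is a supporting line of $S_\beta$ that has $S_\beta$ on its right, touches it in exactly one point, and this contact point is the midpoint of $z$ and $w$. Let $E_\beta$ be the set of points $z$ such that $F_\beta^n(z)$ is defined for all $n\ge 0$ and $F_\beta^n(z)\to\infty$ as $n\to\infty$. Put $$C_\beta=(2\sin\beta+\sin 2\beta)\Bigl(\tfrac{\pi-2\beta}{4}+\tfrac13\tan^3\tfrac\beta2+\tan\tfrac\beta2\Bigr),$$ and let $\alpha_\beta=\arccos(1-C_\beta/2)$ be the asymptotic rotation number, that is, the angle of the rotation to which the linear part $\begin{pmatrix}1-C_\beta&C_\beta\\-1&1\end{pmatrix}$ of the map $(R,\phi)\mapsto(R+C_\beta(\{\phi-R\}-\tfrac12),\{\phi-R\})$ is linearly conjugate; here $\{t\}$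 denotes the fractional part of $t$, and the square of this map approximates the first return map of the outer billiard near infinity. Theorem. There is a strictly decreasing sequence $(\beta_m)_{m\ge3}$ in $(0,\pi/2)$ with $\lim_{m\to\infty}\beta_m=0$ such that, for every $m\ge 3$, $\alpha_{\beta_m}=\pi/m$ and the set $E_{\beta_m}$ of escaping orbits has Lebesgue measure zero. -/

import Mathlib

open Filter Topology MeasureTheory

noncomputable section

/-- The convex region bounded by a circular arc of angle `2π - 2β` of the unit circle and its chord:
the unit disc cut by the horizontal line `y = -cos β` (for `β = π / 2` it is the semi-disc). -/
def circularSector (β : ℝ) : Set (ℝ × ℝ) :=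
  {p | p.1 ^ 2 + p.2 ^ 2 ≤ 1 ∧ -Real.cos β ≤ p.2}

/-- The planar cross product; `cross u v ≤ 0` says that `v` points to the right of `u`. -/
def cross (u v : ℝ × ℝ) : ℝ := u.1 * v.2 - u.2 * v.1

/-- The graph of the outer billiard map around a convex set `K`: the point `z` lies outside `K`,
`K` lies on the right of the line directed from `z` to `w`, this line meets `K` in exactly one
point, and that contact point is the midpoint of `z` and `w`.
(A point `z` whose supporting line touches `K` along a whole segment has no image.) -/
def OuterBilliardStep (K : Set (ℝ × ℝ)) (z w : ℝ × ℝ) : Prop :=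
  z ∉ K ∧ (∀ q ∈ K, cross (w - z) (q - z) ≤ 0) ∧
    {q ∈ K | cross (w - z) (q - z) = 0} = {midpoint ℝ z w}

/-- The outer billiard relation is the graph of a (partially defined) map. -/
theorem OuterBilliardStep.unique {K : Set (ℝ × ℝ)} {z w w' : ℝ × ℝ}
    (h : OuterBilliardStep K z w) (h' : OuterBilliardStep K z w') : w = w' := by
  obtain ⟨-, hr, hc⟩ := h
  obtain ⟨-, hr', hc'⟩ := h'
  have m1 : midpoint ℝ z w ∈ {q ∈ K | cross (w - z) (q - z) = 0} := by rw [hc]; rfl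
  have m2 : midpoint ℝ z w' ∈ {q ∈ K | cross (w' - z) (q - z) = 0} := by rw [hc']; rfl
  have e : ∀ v : ℝ × ℝ, midpoint ℝ z v = ((z.1 + v.1) / 2, (z.2 + v.2) / 2) := by
    intro v
    rw [midpoint_eq_smul_add]
    ext <;> simp <;> ring
  have a1 := hr _ m2.1
  have a2 := hr' _ m1.1
  have key : midpoint ℝ z w' ∈ {q ∈ K | cross (w - z) (q - z) = 0} := by
    refine ⟨m2.1, ?_⟩
    rw [e] at a1 a2 ⊢
    simp only [cross, Prod.fst_sub, Prod.snd_sub] at a1 a2 ⊢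
    linarith
  rw [hc, Set.mem_singleton_iff, e, e, Prod.mk.injEq] at key
  ext <;> linarith [key.1, key.2]

/-- The set of points whose forward orbit under the outer billiard map around `K` is defined for
all times and tends to infinity. -/
def escapingSet (K : Set (ℝ × ℝ)) : Set (ℝ × ℝ) :=
  {z | ∃ u : ℕ → ℝ × ℝ, u 0 = z ∧ (∀ n, OuterBilliardStep K (u n) (u (n + 1))) ∧
    Tendsto u atTop (cocompact (ℝ × ℝ))}

/-- The shear constant of the piecewise linear map
`(R, φ) ↦ (R + C ({φ - R} - 1 / 2), {φ - R})` of the cylinder, whose square describes the first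
return map of the outer billiard around `circularSector β` near infinity. -/
def shearConstant (β : ℝ) : ℝ :=
  (2 * Real.sin β + Real.sin (2 * β)) *
    ((Real.pi - 2 * β) / 4 + Real.tan (β / 2) ^ 3 / 3 + Real.tan (β / 2))

/-- The linear part, in the coordinates `(R, φ)`, of this piecewise linear map; it has
determinant one. -/
def linearPart (β : ℝ) : Matrix (Fin 2) (Fin 2) ℝ :=
  !![1 - shearConstant β, shearConstant β; -1, 1]

/-- The asymptotic rotation number: the angle `α` of the rotation to which the elliptic matrix
`linearPart β` is linearly conjugate, i.e. `2 cos α = tr (linearPart β)` with `0 ≤ α ≤ π`. -/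
def asymptoticRotationNumber (β : ℝ) : ℝ :=
  Real.arccos ((linearPart β).trace / 2)

end

/-! The map preserves area and is injective, so the set of escaping points is null as soon as every
escaping orbit must pass through sets of arbitrarily small area. Indeed, the points leaving a fixed
ball forever can be sorted by the step at which they meet such a set; the corresponding images
inside it are disjoint, so the area of all these points is at most the area of the set
(`measure_eq_zero_of_flux`, `volume_escapingSet_eq_zero`).

To find such sets the dynamics near infinity is computed with errors O(1/r). In the upper half plane
two successive steps either rotate about the origin (both contacts on the arc) or, in a wedge on
each side, combine a reflection in an end point of the chord with an arc step. In the right wedge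
this is the implicit midpoint rule for a Hamiltonian flow whose orbits are parabolas with focus at
the end point of the chord. In each regime there is an almost invariant I and a time function T that
drops by almost one per double step, and the pieces match where the regimes meet (`stepEstimate`).
Over one passage through the upper half plane, which takes O(r) double steps, the total error is
still O(1/r) (`pass_drift`, `exists_pass`). Counting double steps then shows that, in suitable
action and phase coordinates (R, ψ) on a strip along the positive axis, the passage is the map ψ' =
ψ - R modulo 1, R' = R + C ψ', with ψ' in (-1/2, 1/2], up to O(1/R) (`exists_return`). Here ψ is the
phase of the informal statement minus 1/2.

If C = 2 - 2 cos(π/m), the linear part has order 2m and its m-th power is minus the identity. The m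
- 1 linear forms that give the phase after 1, ..., m - 1 linear steps then bound, at every integer
height N, a region below a polygonal chain that the piecewise linear map does not leave. A
perturbation of size O(1/N) can cross the chain only within O(1/N) of its boundary (`near_boundary`,
`exists_near_boundary`). These neighbourhoods have area O(1/N), and every escaping orbit meets all
of them from some N on.

The angles come from the intermediate value theorem: C is continuous with C = 0 at β = 0 and C = 8/3
at β = π/2, and β is taken to be the smallest angle with C = 2 - 2 cos(π/m). No monotonicity of C is
needed. -/

/-! ### Flux argument for injective measure preserving maps. -/

section Flux

/-- Points whose first `n` iterates stay in `D`. -/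
def iterateDomain {α : Type*} (f : α → α) (D : Set α) (n : ℕ) : Set α := {x | ∀ j < n, f^[j] x ∈ D}

theorem injOn_iterateDomain {α : Type*} {f : α → α} {D : Set α} (hinj : Set.InjOn f D) (n : ℕ) :
    Set.InjOn f^[n] (iterateDomain f D n) := by
  induction n with
  | zero => intro x _ y _ h; simpa using h
  | succ n ih =>
    intro x hx y hy h
    rw [Function.iterate_succ_apply', Function.iterate_succ_apply'] at h
    refine ih (fun j hj => hx j (by omega)) (fun j hj => hy j (by omega)) ?_
    exact hinj (hx n (by omega)) (hy n (by omega)) h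

variable {α : Type*} [MeasurableSpace α] {μ : Measure α} {f : α → α} {D : Set α}

theorem measurableSet_iterateDomain (hf : Measurable f) (hD : MeasurableSet D) (n : ℕ) :
    MeasurableSet (iterateDomain f D n) := by
  have : iterateDomain f D n = ⋂ j, ⋂ (_ : j < n), f^[j] ⁻¹' D := by
    ext x; simp [iterateDomain]
  rw [this]
  exact MeasurableSet.iInter fun j => MeasurableSet.iInter fun _ => (hf.iterate j) hD

theorem measure_image_iterate
    (himg : ∀ A ⊆ D, MeasurableSet A → MeasurableSet (f '' A) ∧ μ (f '' A) = μ A) (n : ℕ)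
    {A : Set α} (hA : A ⊆ iterateDomain f D n) (hAm : MeasurableSet A) :
    MeasurableSet (f^[n] '' A) ∧ μ (f^[n] '' A) = μ A := by
  induction n with
  | zero => simpa using hAm
  | succ n ih =>
    have h1 := ih (fun x hx j hj => hA hx j (by omega))
    have h2 : f^[n] '' A ⊆ D := by
      rintro _ ⟨x, hx, rfl⟩
      exact hA hx n (by omega)
    have h3 := himg _ h2 h1.1
    rw [Function.iterate_succ', Set.image_comp]
    exact ⟨h3.1, h3.2.trans h1.2⟩

theorem measure_iterate_preimage_null (hf : Measurable f) (hD : MeasurableSet D)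
    (himg : ∀ A ⊆ D, MeasurableSet A → MeasurableSet (f '' A) ∧ μ (f '' A) = μ A) (n : ℕ)
    {Z : Set α} (hZ : μ Z = 0) : μ {x ∈ iterateDomain f D n | f^[n] x ∈ Z} = 0 := by
  set A := iterateDomain f D n ∩ f^[n] ⁻¹' (toMeasurable μ Z)
  have hAm : MeasurableSet A :=
    (measurableSet_iterateDomain hf hD n).inter ((hf.iterate n) (measurableSet_toMeasurable μ Z))
  have h1 := measure_image_iterate himg n (Set.inter_subset_left : A ⊆ _) hAm
  have h2 : μ A = 0 := by
    rw [← h1.2]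
    refine measure_mono_null ?_ ((measure_toMeasurable Z).trans hZ)
    rintro _ ⟨x, hx, rfl⟩
    exact hx.2
  exact measure_mono_null (t := A) (fun x hx => ⟨hx.1, subset_toMeasurable μ Z hx.2⟩) h2

/-- The points of `B` that reach `X` for the first time after `n` steps, without returning
to `B`. -/
def firstPassage {α : Type*} (f : α → α) (D B X : Set α) (n : ℕ) : Set α :=
  (iterateDomain f D n ∩ B) ∩ (f^[n] ⁻¹' X) ∩ ⋂ j ∈ Set.Icc 1 n, f^[j] ⁻¹' Bᶜ

theorem measurableSet_firstPassage (hf : Measurable f) (hD : MeasurableSet D) {B X : Set α}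
    (hB : MeasurableSet B) (hX : MeasurableSet X) (n : ℕ) :
    MeasurableSet (firstPassage f D B X n) := by
  refine (((measurableSet_iterateDomain hf hD n).inter hB).inter (hf.iterate n hX)).inter ?_
  exact MeasurableSet.biInter (Set.to_countable _) fun j _ => hf.iterate j hB.compl

/-- The time `n` images of the passage sets are disjoint subsets of `X`: if points with passage
times n < n' had the same image, injectivity would put the second orbit at the first point, hence
back in `B`, at time n' - n. -/
theorem tsum_measure_firstPassage_le (hf : Measurable f) (hD : MeasurableSet D)
    (hinj : Set.InjOn f D)
    (himg : ∀ A ⊆ D, MeasurableSet A → MeasurableSet (f '' A) ∧ μ (f '' A) = μ A)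
    {B X : Set α} (hB : MeasurableSet B) (hX : MeasurableSet X) :
    ∑' n, μ (firstPassage f D B X n) ≤ μ X := by
  have hsub : ∀ n, firstPassage f D B X n ⊆ iterateDomain f D n := fun n x hx => hx.1.1.1
  have him := fun n => measure_image_iterate himg n (hsub n)
    (measurableSet_firstPassage hf hD hB hX n)
  have hdis : Pairwise (Function.onFun Disjoint fun n => f^[n] '' firstPassage f D B X n) := by
    refine (pairwise_disjoint_on _).2 fun n k hnk => ?_
    rw [Set.disjoint_left]
    rintro _ ⟨x, hx, rfl⟩ ⟨x', hx', he⟩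
    obtain ⟨d, rfl⟩ := Nat.exists_eq_add_of_lt hnk
    rw [show n + d + 1 = n + (d + 1) by ring, Function.iterate_add_apply] at he
    have h1 : f^[d + 1] x' ∈ iterateDomain f D n := fun j hj => by
      rw [← Function.iterate_add_apply]
      exact hx'.1.1.1 _ (by omega)
    have h2 := injOn_iterateDomain hinj n h1 (hsub n hx) he
    have h3 := Set.mem_iInter₂.1 hx'.2 (d + 1) ⟨by omega, by omega⟩
    rw [Set.mem_preimage, h2] at h3
    exact h3 hx.1.1.2
  calc ∑' n, μ (firstPassage f D B X n) = ∑' n, μ (f^[n] '' firstPassage f D B X n) := by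
        simp_rw [(him _).2]
    _ = μ (⋃ n, f^[n] '' firstPassage f D B X n) := (measure_iUnion hdis fun n => (him n).1).symm
    _ ≤ μ X := measure_mono (Set.iUnion_subset fun n => by
        rintro _ ⟨x, hx, rfl⟩
        exact hx.1.2)

/-- If the orbits in `E` leave every set of a countable cover and must pass through sets `X N`
whose measure tends to zero, then `E` is a null set. -/
theorem measure_eq_zero_of_flux (hf : Measurable f) (hD : MeasurableSet D)
    (hinj : Set.InjOn f D)
    (himg : ∀ A ⊆ D, MeasurableSet A → MeasurableSet (f '' A) ∧ μ (f '' A) = μ A)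
    {B X : ℕ → Set α} (hB : ∀ M, MeasurableSet (B M)) (hBc : ⋃ M, B M = Set.univ)
    (hX : ∀ N, MeasurableSet (X N)) (hX0 : Tendsto (fun N => μ (X N)) atTop (𝓝 0))
    {E : Set α} (hED : E ⊆ D) (hEf : ∀ z ∈ E, f z ∈ E)
    (hEB : ∀ z ∈ E, ∀ M, ∀ᶠ n in atTop, f^[n] z ∉ B M)
    (hEX : ∀ z ∈ E, ∀ᶠ N in atTop, ∃ n, f^[n] z ∈ X N) : μ E = 0 := by
  have hEn : ∀ n, ∀ z ∈ E, f^[n] z ∈ E := by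
    intro n
    induction n with
    | zero => intro z hz; simpa using hz
    | succ n ih => intro z hz; rw [Function.iterate_succ_apply']; exact hEf _ (ih z hz)
  have hEdom : ∀ n, E ⊆ iterateDomain f D n := fun n z hz j _ => hED (hEn j z hz)
  set L : ℕ → Set α := fun M => {x ∈ E | x ∈ B M ∧ ∀ j ≥ 1, f^[j] x ∉ B M}
  have hL : ∀ M, μ (L M) = 0 := by
    intro M
    -- The threshold beyond which all `X N` are visited depends on the point; a countable union
    -- makes it uniform.
    have hcov : L M ⊆ ⋃ K, {x ∈ L M | ∀ N ≥ K, ∃ n, f^[n] x ∈ X N} := by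
      intro x hx
      obtain ⟨K, hK⟩ := eventually_atTop.1 (hEX x hx.1)
      exact Set.mem_iUnion.2 ⟨K, hx, hK⟩
    refine measure_mono_null hcov (measure_iUnion_null fun K => ?_)
    refine le_antisymm (ge_of_tendsto hX0 ?_) zero_le
    filter_upwards [eventually_ge_atTop K] with N hN
    refine le_trans ?_ (tsum_measure_firstPassage_le (μ := μ) hf hD hinj himg (hB M) (hX N))
    refine le_trans (measure_mono ?_) (measure_iUnion_le _)
    rintro x ⟨hx, hxK⟩
    obtain ⟨n, hn⟩ := hxK N hN
    refine Set.mem_iUnion.2 ⟨n, ⟨⟨hEdom n hx.1, hx.2.1⟩, hn⟩, ?_⟩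
    exact Set.mem_iInter₂.2 fun j hj => hx.2.2 j hj.1
  have hE : E ⊆ ⋃ M, ⋃ n, {x ∈ iterateDomain f D n | f^[n] x ∈ L M} := by
    intro z hz
    obtain ⟨M, hM⟩ := Set.mem_iUnion.1 (hBc.symm ▸ Set.mem_univ z : z ∈ ⋃ M, B M)
    obtain ⟨K, hK⟩ := eventually_atTop.1 (hEB z hz M)
    -- The orbit has a last visit to `B M`, since it eventually avoids that set.
    have hex : ∃ n, f^[n] z ∈ B M ∧ ∀ j ≥ 1, f^[n + j] z ∉ B M := by
      classical
      set s := (Finset.range K).filter fun n => f^[n] z ∈ B M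
      have hK0 : 0 < K := by
        by_contra h
        exact hK 0 (by omega) (by simpa using hM)
      have hs : s.Nonempty := ⟨0, by simp [s, hK0, hM]⟩
      refine ⟨s.max' hs, (Finset.mem_filter.1 (s.max'_mem hs)).2, fun j hj hin => ?_⟩
      rcases lt_or_ge (s.max' hs + j) K with h | h
      · have := s.le_max' _ (Finset.mem_filter.2 ⟨Finset.mem_range.2 h, hin⟩)
        omega
      · exact hK _ h hin
    obtain ⟨n, hn, hj⟩ := hex
    refine Set.mem_iUnion₂.2 ⟨M, n, hEdom n hz, hEn n z hz, hn, fun j hj1 => ?_⟩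
    rw [← Function.iterate_add_apply, add_comm]
    exact hj j hj1
  refine measure_mono_null hE (measure_iUnion_null fun M => measure_iUnion_null fun n => ?_)
  exact measure_iterate_preimage_null hf hD himg n (hL M)

end Flux

/-! ### Contact points, measurability and time reversal. -/

section Contact

/-- `c` is the contact point of the unique oriented supporting line of `K` through the exterior
point `z`. -/
def Contact (K : Set (ℝ × ℝ)) (z c : ℝ × ℝ) : Prop :=
  z ∉ K ∧ c ∈ K ∧ ∀ q ∈ K, q ≠ c → (c.1 - z.1) * (q.2 - c.2) - (c.2 - z.2) * (q.1 - c.1) < 0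

theorem midpoint_prod (z w : ℝ × ℝ) :
    midpoint ℝ z w = ((z.1 + w.1) / 2, (z.2 + w.2) / 2) := by
  rw [midpoint_eq_smul_add]
  ext <;> simp <;> ring

theorem outerBilliardStep_iff_contact {K : Set (ℝ × ℝ)} {z w : ℝ × ℝ} :
    OuterBilliardStep K z w ↔ Contact K z ((z.1 + w.1) / 2, (z.2 + w.2) / 2) := by
  unfold OuterBilliardStep Contact
  rw [midpoint_prod]
  have key : ∀ q : ℝ × ℝ, cross (w - z) (q - z) = 2 *
      (((z.1 + w.1) / 2 - z.1) * (q.2 - (z.2 + w.2) / 2) -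
        ((z.2 + w.2) / 2 - z.2) * (q.1 - (z.1 + w.1) / 2)) := by
    intro q
    simp only [cross, Prod.fst_sub, Prod.snd_sub]
    ring
  simp only [key]
  constructor
  · rintro ⟨h1, h2, h3⟩
    have hm : ((z.1 + w.1) / 2, (z.2 + w.2) / 2) ∈ K :=
      (h3.symm ▸ Set.mem_singleton _ : _ ∈ {q ∈ K | _}).1
    refine ⟨h1, hm, fun q hq hne => ?_⟩
    refine lt_of_le_of_ne (by linarith [h2 q hq]) fun h0 => hne ?_
    have : q ∈ ({((z.1 + w.1) / 2, (z.2 + w.2) / 2)} : Set (ℝ × ℝ)) := by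
      rw [← h3]
      exact ⟨hq, by linarith⟩
    simpa using this
  · rintro ⟨h1, h2, h3⟩
    refine ⟨h1, fun q hq => ?_, ?_⟩
    · by_cases h : q = ((z.1 + w.1) / 2, (z.2 + w.2) / 2)
      · rw [h]; simp
      · linarith [h3 q hq h]
    · ext q
      simp only [Set.mem_singleton_iff]
      constructor
      · rintro ⟨hq, h0⟩
        by_contra h
        linarith [h3 q hq h]
      · rintro rfl
        exact ⟨h2, by simp⟩

theorem Contact.step {K : Set (ℝ × ℝ)} {z c : ℝ × ℝ} (h : Contact K z c) :
    OuterBilliardStep K z (2 * c.1 - z.1, 2 * c.2 - z.2) := by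
  rw [outerBilliardStep_iff_contact]
  convert h using 1
  ext <;> simp

/-- The condition quantifies over uncountably many q. Its failure at distance at least 1/(j+1) from
c is the projection, along the compact set `K`, of a closed set, hence closed; countably many j
suffice. -/
theorem measurableSet_contact {K : Set (ℝ × ℝ)} (hK : IsCompact K) :
    MeasurableSet {p : (ℝ × ℝ) × (ℝ × ℝ) | Contact K p.1 p.2} := by
  have : CompactSpace K := isCompact_iff_compactSpace.1 hK
  set C : ℕ → Set (((ℝ × ℝ) × (ℝ × ℝ)) × K) := fun j =>
    {p | 1 / ((j : ℝ) + 1) ≤ dist (p.2 : ℝ × ℝ) p.1.2 ∧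
      0 ≤ (p.1.2.1 - p.1.1.1) * ((p.2 : ℝ × ℝ).2 - p.1.2.2) -
        (p.1.2.2 - p.1.1.2) * ((p.2 : ℝ × ℝ).1 - p.1.2.1)}
  have hC : ∀ j, IsClosed (C j) := fun j => by
    simp only [C, Set.ofPred_and]
    apply IsClosed.inter <;> apply isClosed_le <;> fun_prop
  have hC' : ∀ j, IsClosed (Prod.fst '' C j) := fun j =>
    isClosedMap_fst_of_compactSpace _ (hC j)
  have heq : {p : (ℝ × ℝ) × (ℝ × ℝ) | Contact K p.1 p.2} =
      (Prod.fst ⁻¹' Kᶜ ∩ Prod.snd ⁻¹' K) ∩ ⋂ j, (Prod.fst '' C j)ᶜ := by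
    ext ⟨z, c⟩
    constructor
    · rintro ⟨h1, h2, h3⟩
      refine ⟨⟨h1, h2⟩, Set.mem_iInter.2 fun j => ?_⟩
      rintro ⟨⟨p, q, hq⟩, ⟨hq1, hq2⟩, rfl⟩
      have hne : q ≠ c := by
        rintro rfl
        simp only [dist_self] at hq1
        have : (0 : ℝ) < 1 / ((j : ℝ) + 1) := by positivity
        linarith
      have := h3 q hq hne
      simp only at hq2
      linarith
    · rintro ⟨⟨h1, h2⟩, h3⟩
      refine ⟨h1, h2, fun q hq hne => ?_⟩
      by_contra hlt
      obtain ⟨j, hj⟩ := exists_nat_one_div_lt (dist_pos.2 hne)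
      exact Set.mem_iInter.1 h3 j ⟨⟨(z, c), ⟨q, hq⟩⟩, ⟨hj.le, not_lt.1 hlt⟩, rfl⟩
  rw [heq]
  refine ((measurable_fst hK.measurableSet.compl).inter (measurable_snd hK.measurableSet)).inter ?_
  exact MeasurableSet.iInter fun j => (hC' j).measurableSet.compl

/-- Reflection in the vertical axis. -/
def mirror (z : ℝ × ℝ) : ℝ × ℝ := (-z.1, z.2)

@[simp] theorem mirror_fst (z : ℝ × ℝ) : (mirror z).1 = -z.1 := rfl
@[simp] theorem mirror_snd (z : ℝ × ℝ) : (mirror z).2 = z.2 := rfl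
@[simp] theorem mirror_mirror (z : ℝ × ℝ) : mirror (mirror z) = z := by ext <;> simp

/-- A reflection reverses orientation, so it conjugates the map to its inverse. This yields
injectivity and transfers right wedge estimates to the left wedge. -/
theorem OuterBilliardStep.mirror_symm {K : Set (ℝ × ℝ)} (hK : ∀ q ∈ K, mirror q ∈ K)
    {z w : ℝ × ℝ} (h : OuterBilliardStep K z w) :
    OuterBilliardStep K (mirror w) (mirror z) := by
  rw [outerBilliardStep_iff_contact] at h ⊢
  obtain ⟨h1, h2, h3⟩ := h
  refine ⟨fun hw => ?_, ?_, fun q hq hne => ?_⟩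
  · have hw' : w ∈ K := by simpa using hK _ hw
    have := h3 w hw' fun hc => h1 ?_
    · simp only at this
      linarith
    · have e1 := congrArg Prod.fst hc
      have e2 := congrArg Prod.snd hc
      simp only at e1 e2
      have : z = w := by ext <;> linarith
      rwa [this]
  · have := hK _ h2
    convert this using 1
    ext <;> simp <;> ring
  · have := h3 _ (hK q hq) fun hc => hne ?_
    · simp only [mirror_fst, mirror_snd] at this ⊢
      linarith
    · rw [← mirror_mirror q, hc]
      ext <;> simp <;> ring

end Contact

/-! ### Contact points of the circular sector. -/

section Sector

variable {β : ℝ}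

theorem isCompact_circularSector (β : ℝ) : IsCompact (circularSector β) := by
  refine (isCompact_Icc (a := ((-1 : ℝ), (-1 : ℝ))) (b := (1, 1))).of_isClosed_subset ?_ ?_
  · simp only [circularSector, Set.ofPred_and]
    apply IsClosed.inter <;> apply isClosed_le <;> fun_prop
  · rintro ⟨x, y⟩ ⟨h, -⟩
    simp only at h
    exact ⟨⟨by simp only; nlinarith [sq_nonneg y, sq_nonneg (x+1)], by simp only; nlinarith [sq_nonneg x]⟩,
      ⟨by simp only; nlinarith [sq_nonneg y], by simp only; nlinarith [sq_nonneg x]⟩⟩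

theorem mirror_mem_circularSector : ∀ q ∈ circularSector β, mirror q ∈ circularSector β := by
  rintro q ⟨h1, h2⟩
  exact ⟨by simpa using h1, h2⟩

/-- The tangency point on the unit circle of the oriented tangent line through `z`. -/
noncomputable def tangencyPoint (z : ℝ × ℝ) : ℝ × ℝ :=
  ((z.1 + Real.sqrt (z.1 ^ 2 + z.2 ^ 2 - 1) * z.2) / (z.1 ^ 2 + z.2 ^ 2),
    (z.2 - Real.sqrt (z.1 ^ 2 + z.2 ^ 2 - 1) * z.1) / (z.1 ^ 2 + z.2 ^ 2))

theorem tangencyPoint_spec {z : ℝ × ℝ} (hz : 1 < z.1 ^ 2 + z.2 ^ 2) :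
    (tangencyPoint z).1 ^ 2 + (tangencyPoint z).2 ^ 2 = 1 ∧
    z.1 = (tangencyPoint z).1 - Real.sqrt (z.1 ^ 2 + z.2 ^ 2 - 1) * (tangencyPoint z).2 ∧
    z.2 = (tangencyPoint z).2 + Real.sqrt (z.1 ^ 2 + z.2 ^ 2 - 1) * (tangencyPoint z).1 := by
  have h := Real.sq_sqrt (show 0 ≤ z.1 ^ 2 + z.2 ^ 2 - 1 by linarith)
  set l := Real.sqrt (z.1 ^ 2 + z.2 ^ 2 - 1)
  have hs : z.1 ^ 2 + z.2 ^ 2 = l ^ 2 + 1 := by linarith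
  have hne : l ^ 2 + 1 ≠ 0 := by positivity
  simp only [tangencyPoint]
  rw [show Real.sqrt (z.1 ^ 2 + z.2 ^ 2 - 1) = l from rfl, hs]
  refine ⟨?_, ?_, ?_⟩
  · field_simp
    linear_combination (l ^ 2 + 1) * hs
  · field_simp
    ring
  · field_simp
    ring

/-- A tangent line supports the whole disc and meets it only at the tangency point, so it is enough
that this point lies in the sector. -/
theorem contact_tangencyPoint {z : ℝ × ℝ} (hz : 1 < z.1 ^ 2 + z.2 ^ 2)
    (hc : -Real.cos β ≤ (tangencyPoint z).2) :
    Contact (circularSector β) z (tangencyPoint z) := by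
  obtain ⟨h1, h2, h3⟩ := tangencyPoint_spec hz
  have hl : 0 < Real.sqrt (z.1 ^ 2 + z.2 ^ 2 - 1) := Real.sqrt_pos.2 (by linarith)
  set l := Real.sqrt (z.1 ^ 2 + z.2 ^ 2 - 1)
  set p := tangencyPoint z
  refine ⟨fun h => by linarith [h.1], ⟨h1.le, hc⟩, fun q hq hne => ?_⟩
  have hpq : p.1 * q.1 + p.2 * q.2 < 1 := by
    by_contra hge
    have : (q.1 - p.1) ^ 2 + (q.2 - p.2) ^ 2 ≤ 0 := by nlinarith [hq.1]
    have e1 : q.1 - p.1 = 0 := by nlinarith [sq_nonneg (q.1 - p.1), sq_nonneg (q.2 - p.2)]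
    have e2 : q.2 - p.2 = 0 := by nlinarith [sq_nonneg (q.1 - p.1), sq_nonneg (q.2 - p.2)]
    exact hne (by ext <;> linarith)
  rw [h2, h3]
  have : (p.1 - (p.1 - l * p.2)) * (q.2 - p.2) - (p.2 - (p.2 + l * p.1)) * (q.1 - p.1) =
      l * ((p.1 * q.1 + p.2 * q.2) - (p.1 ^ 2 + p.2 ^ 2)) := by ring
  rw [this, h1]
  exact mul_neg_of_pos_of_neg hl (by linarith)

/-- A contact point is an end point of the chord or a point of tangency with the circle. -/
theorem Contact.classify {z c : ℝ × ℝ} (h : Contact (circularSector β) z c) :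
    c.1 ^ 2 + c.2 ^ 2 = 1 ∧
      (c.2 = -Real.cos β ∨ (1 < z.1 ^ 2 + z.2 ^ 2 ∧ c = tangencyPoint z)) := by
  obtain ⟨hz, ⟨hc1, hc2⟩, hq⟩ := id h
  -- Inside the open disc one may move horizontally in both directions without leaving the sector;
  -- the contact inequality then holds for a displacement and for its opposite, which is absurd.
  have hcirc : c.1 ^ 2 + c.2 ^ 2 = 1 := by
    by_contra hne
    have hlt : c.1 ^ 2 + c.2 ^ 2 < 1 := lt_of_le_of_ne hc1 hne
    set e := (1 - (c.1 ^ 2 + c.2 ^ 2)) / 4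
    have he : 0 < e := by simp only [e]; linarith
    have he' : 4 * e = 1 - (c.1 ^ 2 + c.2 ^ 2) := by simp only [e]; ring
    have he1 : e ≤ 1 := by nlinarith [sq_nonneg c.1, sq_nonneg c.2]
    have hc1' : c.1 ^ 2 ≤ 1 := by nlinarith [sq_nonneg c.2]
    have hcu : c.1 ≤ 1 := by nlinarith
    have hcl : -1 ≤ c.1 := by nlinarith
    have h1 := hq (c.1 + e, c.2) ⟨by simp only; nlinarith, hc2⟩ (fun hh => by
      have := congrArg Prod.fst hh; simp only at this; linarith)
    have h2 := hq (c.1 - e, c.2) ⟨by simp only; nlinarith, hc2⟩ (fun hh => by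
      have := congrArg Prod.fst hh; simp only at this; linarith)
    simp only at h1 h2
    linarith
  refine ⟨hcirc, ?_⟩
  rcases hc2.eq_or_lt with h0 | hlt
  · exact Or.inl h0.symm
  right
  -- Strictly above the chord, a short move in any direction pointing into the disc stays in the
  -- sector.
  have key : ∀ d1 d2 : ℝ, c.1 * d1 + c.2 * d2 < 0 →
      (c.1 - z.1) * d2 - (c.2 - z.2) * d1 < 0 := by
    intro d1 d2 hd
    set P := -(c.1 * d1 + c.2 * d2)
    have hP : 0 < P := by simp only [P]; linarith
    set Q := d1 ^ 2 + d2 ^ 2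
    have hQ : 0 ≤ Q := by positivity
    set g := c.2 + Real.cos β
    have hg : 0 < g := by simp only [g]; linarith
    obtain ⟨s, hs, hs1, hs2⟩ : ∃ s > 0, s * Q ≤ P ∧ s * (|d2| + 1) ≤ g := by
      refine ⟨min (P / (Q + 1)) (g / (|d2| + 1)), by positivity, ?_, ?_⟩
      · calc _ ≤ P / (Q + 1) * Q := by gcongr; exact min_le_left _ _
          _ ≤ P := by rw [div_mul_eq_mul_div, div_le_iff₀ (by positivity)]; nlinarith
      · calc _ ≤ g / (|d2| + 1) * (|d2| + 1) := by gcongr; exact min_le_right _ _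
          _ = g := by field_simp
    have hin : (c.1 + s * d1, c.2 + s * d2) ∈ circularSector β := by
      refine ⟨?_, ?_⟩
      · simp only
        have : (c.1 + s * d1) ^ 2 + (c.2 + s * d2) ^ 2 = 1 - 2 * s * P + s * (s * Q) := by
          simp only [P, Q]; linear_combination hcirc
        rw [this]
        nlinarith [mul_pos hs hP, mul_le_mul_of_nonneg_left hs1 hs.le]
      · simp only
        have := neg_abs_le d2
        simp only [g] at hs2
        nlinarith
    have hh := hq _ hin fun hh => by
      have e1 := congrArg Prod.fst hh
      have e2 := congrArg Prod.snd hh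
      simp only [add_eq_left, mul_eq_zero, hs.ne', false_or] at e1 e2
      rw [e1, e2] at hd
      linarith
    simp only [add_sub_cancel_left] at hh
    by_contra hge
    nlinarith [mul_nonneg hs.le (not_lt.1 hge)]
  set n := (c.1 - z.1) * c.1 + (c.2 - z.2) * c.2
  set k := (c.1 - z.1) * c.2 - (c.2 - z.2) * c.1
  -- The directions -e c ± c^⊥ become tangent as e → 0; this forces c - z to be orthogonal to c.
  have hk : ∀ e > 0, n - e * k < 0 ∧ -n - e * k < 0 := by
    intro e he
    have h1 := key (-e * c.1 - c.2) (-e * c.2 + c.1) (by nlinarith)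
    have h2 := key (-e * c.1 + c.2) (-e * c.2 - c.1) (by nlinarith)
    simp only [n, k]
    constructor <;> nlinarith
  have hn : n = 0 := by
    by_contra hne
    have hpos : 0 < |n| := abs_pos.2 hne
    have hh := hk (|n| / (2 * (|k| + 1))) (by positivity)
    have hb : |n| / (2 * (|k| + 1)) * |k| ≤ |n| / 2 := by
      rw [div_mul_eq_mul_div, div_le_iff₀ (by positivity)]
      nlinarith [abs_nonneg k]
    have hb' : |n| / (2 * (|k| + 1)) * k ≤ |n| / (2 * (|k| + 1)) * |k| := by
      gcongr; exact le_abs_self k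
    rcases abs_cases n with h | h <;> linarith [hh.1, hh.2]
  have hk0 : 0 < k := by
    have := hk 1 one_pos
    rw [hn] at this
    linarith [this.1]
  have hz1 : z.1 = c.1 - k * c.2 := by
    simp only [k]; simp only [n] at hn; linear_combination -c.1 * hn + (c.1 - z.1) * hcirc
  have hz2 : z.2 = c.2 + k * c.1 := by
    simp only [k]; simp only [n] at hn; linear_combination -c.2 * hn + (c.2 - z.2) * hcirc
  have hs : z.1 ^ 2 + z.2 ^ 2 = k ^ 2 + 1 := by
    rw [hz1, hz2]; linear_combination (k ^ 2 + 1) * hcirc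
  have hsq : Real.sqrt (z.1 ^ 2 + z.2 ^ 2 - 1) = k := by
    rw [hs, add_sub_cancel_right, Real.sqrt_sq hk0.le]
  have hkne : k ^ 2 + 1 ≠ 0 := by positivity
  refine ⟨by rw [hs]; nlinarith, ?_⟩
  clear_value n k
  unfold tangencyPoint
  rw [hsq, hs, hz1, hz2]
  ext <;> simp only <;> field_simp <;> ring

end Sector

/-! ### The outer billiard map of the disc preserves area. -/

section ArcMap

/-- The outer billiard map around the unit disc. -/
noncomputable def arcMap (z : ℝ × ℝ) : ℝ × ℝ :=
  (2 * (tangencyPoint z).1 - z.1, 2 * (tangencyPoint z).2 - z.2)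

theorem arcMap_eq (z : ℝ × ℝ) : arcMap z =
    ((2 / (z.1 ^ 2 + z.2 ^ 2) - 1) * z.1 +
        2 * Real.sqrt (z.1 ^ 2 + z.2 ^ 2 - 1) / (z.1 ^ 2 + z.2 ^ 2) * z.2,
      (2 / (z.1 ^ 2 + z.2 ^ 2) - 1) * z.2 -
        2 * Real.sqrt (z.1 ^ 2 + z.2 ^ 2 - 1) / (z.1 ^ 2 + z.2 ^ 2) * z.1) := by
  unfold arcMap tangencyPoint
  ext <;> simp only <;> ring

/-- The arc map has the form a(s) z + b(s) J z with s = |z|² and J a quarter turn. Its Jacobian is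
a² + b² + 2 s (a a' + b b'); it equals 1 because (a, b) moves on the unit circle. -/
theorem hasDerivAt_arc_coeff {s : ℝ} (hs : 1 < s) : ∃ a' b' : ℝ,
    HasDerivAt (fun s : ℝ => 2 / s - 1) a' s ∧
    HasDerivAt (fun s : ℝ => 2 * Real.sqrt (s - 1) / s) b' s ∧
    (2 / s - 1) * a' + (2 * Real.sqrt (s - 1) / s) * b' = 0 ∧
    (2 / s - 1) ^ 2 + (2 * Real.sqrt (s - 1) / s) ^ 2 = 1 := by
  have hl : 0 < Real.sqrt (s - 1) := Real.sqrt_pos.2 (by linarith)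
  have hl2 := Real.sq_sqrt (show 0 ≤ s - 1 by linarith)
  have hs0 : s ≠ 0 := by linarith
  have h1 : HasDerivAt (fun s : ℝ => 2 / s - 1) ((0 * s - 2 * 1) / s ^ 2) s :=
    ((hasDerivAt_const s (2 : ℝ)).div (hasDerivAt_id s) hs0).sub_const 1
  have h2 : HasDerivAt (fun s : ℝ => Real.sqrt (s - 1)) (1 / (2 * Real.sqrt (s - 1))) s :=
    ((hasDerivAt_id s).sub_const 1).sqrt (by simp only [id]; linarith)
  have h3 := (h2.const_mul 2).div (hasDerivAt_id s) hs0
  refine ⟨_, _, h1, h3, ?_, ?_⟩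
  · simp only [id]
    generalize Real.sqrt (s - 1) = l at *
    obtain rfl : s = l ^ 2 + 1 := by linarith
    field_simp
    ring
  · generalize Real.sqrt (s - 1) = l at *
    obtain rfl : s = l ^ 2 + 1 := by linarith
    field_simp
    ring

theorem hasFDerivAt_arcMap {z : ℝ × ℝ} (hz : 1 < z.1 ^ 2 + z.2 ^ 2) :
    ∃ L : ℝ × ℝ →L[ℝ] ℝ × ℝ, HasFDerivAt arcMap L z ∧ L.det = 1 := by
  obtain ⟨a', b', ha, hb, h0, h1⟩ := hasDerivAt_arc_coeff hz
  have hsq : HasFDerivAt (fun z : ℝ × ℝ => z.1 ^ 2 + z.2 ^ 2)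
      ((2 * z.1) • ContinuousLinearMap.fst ℝ ℝ ℝ + (2 * z.2) • ContinuousLinearMap.snd ℝ ℝ ℝ) z := by
    have e1 := (hasFDerivAt_fst (𝕜 := ℝ) (p := z)).pow 2
    have e2 := (hasFDerivAt_snd (𝕜 := ℝ) (p := z)).pow 2
    refine (e1.add e2).congr_fderiv ?_
    simp
  have hA := ha.comp_hasFDerivAt z hsq
  have hB := hb.comp_hasFDerivAt z hsq
  set a := 2 / (z.1 ^ 2 + z.2 ^ 2) - 1
  set b := 2 * Real.sqrt (z.1 ^ 2 + z.2 ^ 2 - 1) / (z.1 ^ 2 + z.2 ^ 2)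
  set P := 2 * (a' * z.1 + b' * z.2)
  set Q := 2 * (a' * z.2 - b' * z.1)
  refine ⟨(Matrix.toLin (.finTwoProd ℝ) (.finTwoProd ℝ)
    !![a + z.1 * P, b + z.2 * P; -b + z.1 * Q, a + z.2 * Q]).toContinuousLinearMap, ?_, ?_⟩
  · rw [Matrix.toLin_finTwoProd_toContinuousLinearMap]
    rw [show arcMap = _ from funext arcMap_eq]
    have h1 := ((hA.mul (hasFDerivAt_fst (𝕜 := ℝ) (p := z))).add
      (hB.mul (hasFDerivAt_snd (𝕜 := ℝ) (p := z)))).prodMk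
      ((hA.mul (hasFDerivAt_snd (𝕜 := ℝ) (p := z))).sub
      (hB.mul (hasFDerivAt_fst (𝕜 := ℝ) (p := z))))
    refine h1.congr_fderiv ?_
    refine ContinuousLinearMap.ext fun w => ?_
    ext
    · simp [P, Q, a, b]
      ring
    · simp [P, Q, a, b]
      ring
  · simp only [LinearMap.det_toContinuousLinearMap, LinearMap.det_toLin, Matrix.det_fin_two_of]
    simp only [P, Q]
    linear_combination h1 + 2 * (z.1 ^ 2 + z.2 ^ 2) * h0

theorem measurable_arcMap : Measurable arcMap := by
  rw [show arcMap = _ from funext arcMap_eq]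
  fun_prop

theorem measure_image_arcMap {A : Set (ℝ × ℝ)} (hA : ∀ z ∈ A, 1 < z.1 ^ 2 + z.2 ^ 2)
    (hinj : Set.InjOn arcMap A) (hm : MeasurableSet A) :
    MeasurableSet (arcMap '' A) ∧ volume (arcMap '' A) = volume A := by
  classical
  choose L hL hdet using fun z : A => hasFDerivAt_arcMap (hA z z.2)
  set L' : ℝ × ℝ → (ℝ × ℝ →L[ℝ] ℝ × ℝ) := fun z => if h : z ∈ A then L ⟨z, h⟩ else 0
  have hL' : ∀ z ∈ A, HasFDerivWithinAt arcMap (L' z) A z := by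
    intro z hz
    simp only [L', hz, dif_pos]
    exact (hL ⟨z, hz⟩).hasFDerivWithinAt
  refine ⟨measurable_image_of_fderivWithin hm hL' hinj, ?_⟩
  rw [← lintegral_abs_det_fderiv_eq_addHaar_image volume hm hL' hinj]
  rw [setLIntegral_congr_fun (g := fun _ => 1) hm]
  · simp
  · intro z hz
    simp only [L', hz, dif_pos, hdet]
    simp

end ArcMap

/-! ### The billiard map as an injective, measurable, area preserving map. -/

section Map

variable {β : ℝ}

theorem measure_image_reflection (c : ℝ × ℝ) {A : Set (ℝ × ℝ)} (hm : MeasurableSet A) :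
    MeasurableSet ((fun z => c - z) '' A) ∧ volume ((fun z => c - z) '' A) = volume A := by
  have : (fun z => c - z) '' A = (fun z => c - z) ⁻¹' A :=
    congrFun (Set.image_eq_preimage_of_inverse (fun z => sub_sub_cancel c z)
      (fun z => sub_sub_cancel c z)) A
  have hp : MeasurePreserving (fun z => c - z) (volume : Measure (ℝ × ℝ)) volume :=
    Measure.measurePreserving_sub_left volume c
  rw [this]
  exact ⟨hp.measurable hm, hp.measure_preimage hm.nullMeasurableSet⟩

theorem measure_image_union {α : Type*} [MeasurableSpace α] {μ : Measure α} {f : α → α}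
    {D₁ D₂ : Set α} (hD₁ : MeasurableSet D₁) (hinj : Set.InjOn f (D₁ ∪ D₂))
    (h₁ : ∀ A ⊆ D₁, MeasurableSet A → MeasurableSet (f '' A) ∧ μ (f '' A) = μ A)
    (h₂ : ∀ A ⊆ D₂, MeasurableSet A → MeasurableSet (f '' A) ∧ μ (f '' A) = μ A) :
    ∀ A ⊆ D₁ ∪ D₂, MeasurableSet A → MeasurableSet (f '' A) ∧ μ (f '' A) = μ A := by
  intro A hA hm
  have e : A = (A ∩ D₁) ∪ (A \ D₁) := (Set.inter_union_sdiff A D₁).symm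
  have i₁ := h₁ (A ∩ D₁) Set.inter_subset_right (hm.inter hD₁)
  have i₂ := h₂ (A \ D₁) (fun x hx => (hA hx.1).resolve_left hx.2) (hm.diff hD₁)
  have hd : Disjoint (f '' (A ∩ D₁)) (f '' (A \ D₁)) := by
    rw [Set.disjoint_left]
    rintro _ ⟨x, hx, rfl⟩ ⟨y, hy, hxy⟩
    exact hy.2 (hinj (hA hy.1) (hA hx.1) hxy ▸ hx.2)
  have e2 : f '' A = f '' (A ∩ D₁) ∪ f '' (A \ D₁) := by rw [← Set.image_union, ← e]
  refine ⟨e2 ▸ i₁.1.union i₂.1, ?_⟩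
  rw [e2, measure_union hd i₂.1, i₁.2, i₂.2, measure_inter_add_sdiff A hD₁]

theorem OuterBilliardStep.injective {z z' w : ℝ × ℝ}
    (h : OuterBilliardStep (circularSector β) z w) (h' : OuterBilliardStep (circularSector β) z' w) :
    z = z' := by
  have := (h.mirror_symm mirror_mem_circularSector).unique
    (h'.mirror_symm mirror_mem_circularSector)
  rw [← mirror_mirror z, this, mirror_mirror]

/-- Points whose supporting line touches the sector in the end point of the chord with abscissa
`x`. -/
def cornerDomain (β x : ℝ) : Set (ℝ × ℝ) :=
  {z | Contact (circularSector β) z (x, -Real.cos β)}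

/-- Points whose supporting line is tangent to the circle. -/
def arcDomain (β : ℝ) : Set (ℝ × ℝ) :=
  {z | 1 < z.1 ^ 2 + z.2 ^ 2 ∧ Contact (circularSector β) z (tangencyPoint z)}

theorem measurableSet_cornerDomain (β x : ℝ) : MeasurableSet (cornerDomain β x) := by
  have h : Measurable fun z : ℝ × ℝ => (z, ((x, -Real.cos β) : ℝ × ℝ)) := by fun_prop
  exact h (measurableSet_contact (isCompact_circularSector β))

theorem measurableSet_arcDomain (β : ℝ) : MeasurableSet (arcDomain β) := by
  have h : Measurable fun z : ℝ × ℝ => (z, tangencyPoint z) := by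
    unfold tangencyPoint
    fun_prop
  have h1 : MeasurableSet {z : ℝ × ℝ | 1 < z.1 ^ 2 + z.2 ^ 2} :=
    measurableSet_lt (by fun_prop) (by fun_prop)
  exact h1.inter
    (h (measurableSet_contact (isCompact_circularSector β)))

open Classical in
/-- A total measurable extension of the outer billiard map around the circular sector. -/
noncomputable def billiardMap (β : ℝ) (z : ℝ × ℝ) : ℝ × ℝ :=
  if z ∈ cornerDomain β (Real.sin β) then (2 * Real.sin β, -2 * Real.cos β) - z
  else if z ∈ cornerDomain β (-Real.sin β) then (-2 * Real.sin β, -2 * Real.cos β) - z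
  else arcMap z

/-- The domain of the outer billiard map. -/
def billiardDomain (β : ℝ) : Set (ℝ × ℝ) :=
  cornerDomain β (Real.sin β) ∪ (cornerDomain β (-Real.sin β) ∪ arcDomain β)

theorem measurable_billiardMap (β : ℝ) : Measurable (billiardMap β) :=
  Measurable.ite (measurableSet_cornerDomain _ _) (by fun_prop)
    (Measurable.ite (measurableSet_cornerDomain _ _) (by fun_prop) measurable_arcMap)

theorem measurableSet_billiardDomain (β : ℝ) : MeasurableSet (billiardDomain β) :=
  (measurableSet_cornerDomain _ _).union
    ((measurableSet_cornerDomain _ _).union (measurableSet_arcDomain _))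

theorem billiardMap_step {z : ℝ × ℝ} (hz : z ∈ billiardDomain β) :
    OuterBilliardStep (circularSector β) z (billiardMap β z) := by
  unfold billiardMap
  split_ifs with h1 h2
  · convert Contact.step h1 using 1
    ext <;> simp
  · convert Contact.step h2 using 1
    ext <;> simp
  · exact Contact.step ((hz.resolve_left h1).resolve_left h2).2

theorem OuterBilliardStep.mem_billiardDomain {z w : ℝ × ℝ}
    (h : OuterBilliardStep (circularSector β) z w) : z ∈ billiardDomain β := by
  rw [outerBilliardStep_iff_contact] at h
  obtain ⟨h1, h2⟩ := h.classify
  set c : ℝ × ℝ := ((z.1 + w.1) / 2, (z.2 + w.2) / 2)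
  rcases h2 with h2 | ⟨h2, h3⟩
  · have h4 : c.1 ^ 2 = Real.sin β ^ 2 := by
      rw [Real.sin_sq, ← h1, h2]; ring
    rcases sq_eq_sq_iff_eq_or_eq_neg.1 h4 with h5 | h5
    · refine Or.inl ?_
      have : c = (Real.sin β, -Real.cos β) := by ext <;> assumption
      rw [this] at h
      exact h
    · refine Or.inr (Or.inl ?_)
      have : c = (-Real.sin β, -Real.cos β) := by ext <;> assumption
      rw [this] at h
      exact h
  · exact Or.inr (Or.inr ⟨h2, h3 ▸ h⟩)

theorem OuterBilliardStep.eq_billiardMap {z w : ℝ × ℝ}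
    (h : OuterBilliardStep (circularSector β) z w) : w = billiardMap β z :=
  h.unique (billiardMap_step h.mem_billiardDomain)

theorem injOn_billiardMap (β : ℝ) : Set.InjOn (billiardMap β) (billiardDomain β) := by
  intro z hz z' hz' h
  exact (billiardMap_step hz).injective (h ▸ billiardMap_step hz')

/-- The domain splits into two corner pieces, where the map is a point reflection, and an arc piece,
where it is the disc map. Injectivity keeps the images of the pieces disjoint. -/
theorem measure_image_billiardMap (β : ℝ) : ∀ A ⊆ billiardDomain β, MeasurableSet A →
    MeasurableSet (billiardMap β '' A) ∧ volume (billiardMap β '' A) = volume A := by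
  have hR : ∀ z ∈ cornerDomain β (Real.sin β),
      billiardMap β z = (2 * Real.sin β, -2 * Real.cos β) - z := fun z hz => by
    simp [billiardMap, hz]
  have hL : ∀ z ∈ cornerDomain β (-Real.sin β),
      billiardMap β z = (-2 * Real.sin β, -2 * Real.cos β) - z := fun z hz =>
    (billiardMap_step (Or.inr (Or.inl hz))).unique (by
      convert Contact.step hz using 1
      ext <;> simp)
  have hA : ∀ z ∈ arcDomain β, billiardMap β z = arcMap z := fun z hz =>
    (billiardMap_step (Or.inr (Or.inr hz))).unique (Contact.step hz.2)
  have hinj := injOn_billiardMap β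
  refine measure_image_union (measurableSet_cornerDomain _ _) hinj ?_
    (measure_image_union (measurableSet_cornerDomain _ _)
      (hinj.mono Set.subset_union_right) ?_ ?_)
  · intro A hAs hm
    rw [Set.image_congr fun z hz => hR z (hAs hz)]
    exact measure_image_reflection _ hm
  · intro A hAs hm
    rw [Set.image_congr fun z hz => hL z (hAs hz)]
    exact measure_image_reflection _ hm
  · intro A hAs hm
    have hi : Set.InjOn (billiardMap β) A := hinj.mono fun z hz => Or.inr (Or.inr (hAs hz))
    rw [Set.image_congr fun z hz => hA z (hAs hz)]
    exact measure_image_arcMap (fun z hz => (hAs hz).1)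
      (hi.congr fun z hz => hA z (hAs hz)) hm

/-- If every escaping orbit passes through sets whose areas tend to zero, then almost no orbit
escapes. -/
theorem volume_escapingSet_eq_zero {X : ℕ → Set (ℝ × ℝ)} (hX : ∀ N, MeasurableSet (X N))
    (hX0 : Tendsto (fun N => volume (X N)) atTop (𝓝 0))
    (h : ∀ u : ℕ → ℝ × ℝ, (∀ n, OuterBilliardStep (circularSector β) (u n) (u (n + 1))) →
      Tendsto u atTop (cocompact (ℝ × ℝ)) → ∀ᶠ N in atTop, ∃ n, u n ∈ X N) :
    volume (escapingSet (circularSector β)) = 0 := by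
  have horb : ∀ u : ℕ → ℝ × ℝ, (∀ n, OuterBilliardStep (circularSector β) (u n) (u (n + 1))) →
      ∀ n, (billiardMap β)^[n] (u 0) = u n := by
    intro u hu n
    induction n with
    | zero => rfl
    | succ n ih => rw [Function.iterate_succ_apply', ih, ← (hu n).eq_billiardMap]
  refine measure_eq_zero_of_flux (measurable_billiardMap β) (measurableSet_billiardDomain β)
    (injOn_billiardMap β) (measure_image_billiardMap β)
    (B := fun M => Metric.closedBall 0 M) (fun M => measurableSet_closedBall) ?_ hX hX0 ?_ ?_ ?_ ?_
  · refine Set.eq_univ_of_forall fun z => Set.mem_iUnion.2 ?_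
    obtain ⟨M, hM⟩ := exists_nat_ge (dist z 0)
    exact ⟨M, hM⟩
  · rintro z ⟨u, rfl, hu, -⟩
    exact (hu 0).mem_billiardDomain
  · rintro z ⟨u, rfl, hu, ht⟩
    exact ⟨fun n => u (n + 1), (hu 0).eq_billiardMap, fun n => hu (n + 1),
      ht.comp (tendsto_add_atTop_nat 1)⟩
  · rintro z ⟨u, rfl, hu, ht⟩ M
    simp only [horb u hu]
    exact ht (isCompact_closedBall 0 (M : ℝ)).compl_mem_cocompact
  · rintro z ⟨u, rfl, hu, ht⟩
    simp only [horb u hu]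
    exact h u hu ht

end Map

/-! ### Contact regions and the double step in the right wedge. -/

section Wedge

/-- First coordinate of `z - v` in the orthonormal frame `(v, τ)`, where `v = (sin β, -cos β)` is
the right end point of the chord and `τ = (cos β, sin β)`. -/
noncomputable def radialCoord (β : ℝ) (z : ℝ × ℝ) : ℝ := z.1 * Real.sin β - z.2 * Real.cos β - 1

/-- Second coordinate of `z - v` in the orthonormal frame `(v, τ)`, where `v = (sin β, -cos β)` is
the right end point of the chord and `τ = (cos β, sin β)`. -/
noncomputable def tangentCoord (β : ℝ) (z : ℝ × ℝ) : ℝ := z.1 * Real.cos β + z.2 * Real.sin β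

variable {β : ℝ}

theorem frame_sq (β : ℝ) (z : ℝ × ℝ) :
    (1 + radialCoord β z) ^ 2 + tangentCoord β z ^ 2 = z.1 ^ 2 + z.2 ^ 2 := by
  have := Real.sin_sq_add_cos_sq β
  unfold radialCoord tangentCoord
  linear_combination (z.1 ^ 2 + z.2 ^ 2) * this

theorem fst_eq_frame (β : ℝ) (z : ℝ × ℝ) :
    z.1 = (1 + radialCoord β z) * Real.sin β + tangentCoord β z * Real.cos β := by
  have := Real.sin_sq_add_cos_sq β
  unfold radialCoord tangentCoord
  linear_combination -z.1 * this

theorem snd_eq_frame (β : ℝ) (z : ℝ × ℝ) :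
    z.2 = tangentCoord β z * Real.sin β - (1 + radialCoord β z) * Real.cos β := by
  have := Real.sin_sq_add_cos_sq β
  unfold radialCoord tangentCoord
  linear_combination -z.2 * this

/-- The sector lies in the half planes bounded by the chord and by the tangent at v = (sin β, -cos
β), while z lies above the chord line and on or beyond that tangent. The cross product with v as
contact point is a combination of the two inequalities, strict away from v. -/
theorem contact_corner (hs : 0 < Real.sin β) {z : ℝ × ℝ} (hy : -Real.cos β < z.2)
    (hu : 0 ≤ radialCoord β z) :
    Contact (circularSector β) z (Real.sin β, -Real.cos β) := by
  have h1 := Real.sin_sq_add_cos_sq β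
  have key : ∀ q ∈ circularSector β, q ≠ (Real.sin β, -Real.cos β) →
      q.1 * Real.sin β - q.2 * Real.cos β < 1 := by
    intro q hq hne
    by_contra hge
    have hq1 := hq.1
    have : (q.1 - Real.sin β) ^ 2 + (q.2 + Real.cos β) ^ 2 ≤ 0 := by nlinarith
    have e1 : q.1 - Real.sin β = 0 := by
      nlinarith [sq_nonneg (q.1 - Real.sin β), sq_nonneg (q.2 + Real.cos β)]
    have e2 : q.2 + Real.cos β = 0 := by
      nlinarith [sq_nonneg (q.1 - Real.sin β), sq_nonneg (q.2 + Real.cos β)]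
    exact hne (by ext <;> simp only <;> linarith)
  refine ⟨fun hz => ?_, ⟨by simp only [neg_sq, h1, le_refl], le_rfl⟩, fun q hq hne => ?_⟩
  · have := key z hz (by rintro rfl; simp at hy)
    unfold radialCoord at hu
    linarith
  · have h2 := key q hq hne
    have hq2 := hq.2
    have e : Real.sin β * ((Real.sin β - z.1) * (q.2 - -Real.cos β) -
        (-Real.cos β - z.2) * (q.1 - Real.sin β)) =
        (z.2 + Real.cos β) * (q.1 * Real.sin β - q.2 * Real.cos β - 1) -
          radialCoord β z * (q.2 + Real.cos β) := by
      unfold radialCoord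
      linear_combination (q.2 - z.2) * h1
    have h3 : (z.2 + Real.cos β) * (q.1 * Real.sin β - q.2 * Real.cos β - 1) < 0 :=
      mul_neg_of_pos_of_neg (by linarith) (by linarith)
    have h4 : 0 ≤ radialCoord β z * (q.2 + Real.cos β) := mul_nonneg hu (by linarith)
    simp only
    by_contra hge
    have := mul_nonneg hs.le (not_lt.1 hge)
    linarith

/-- The tangency point p must be above the chord. For z.1 ≤ 0 this is read off its explicit
ordinate. For z.1 > 0 one has t ≥ 0, and with u < 0 this forces ⟨p, τ⟩ ≥ 0; then p.2 = ⟨p, τ⟩ sin β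
- ⟨p, v⟩ cos β ≥ -cos β. -/
theorem contact_arc_of_radialCoord_neg (hs : 0 < Real.sin β) (hc : 0 < Real.cos β) {z : ℝ × ℝ}
    (hy : -Real.cos β < z.2) (hu : radialCoord β z < 0) (hz : 1 < z.1 ^ 2 + z.2 ^ 2) :
    Contact (circularSector β) z (tangencyPoint z) := by
  have h1 := Real.sin_sq_add_cos_sq β
  refine contact_tangencyPoint hz ?_
  obtain ⟨hp, hz1, hz2⟩ := tangencyPoint_spec hz
  have hl := Real.sqrt_pos.2 (show 0 < z.1 ^ 2 + z.2 ^ 2 - 1 by linarith)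
  have hl2 := Real.sq_sqrt (show 0 ≤ z.1 ^ 2 + z.2 ^ 2 - 1 by linarith)
  rcases le_or_gt z.1 0 with hx | hx
  · have h2 : 0 ≤ Real.sqrt (z.1 ^ 2 + z.2 ^ 2 - 1) * -z.1 := mul_nonneg hl.le (by linarith)
    simp only [tangencyPoint]
    rw [le_div_iff₀ (by linarith)]
    nlinarith
  · have ht : 0 ≤ tangentCoord β z := by
      by_contra ht
      unfold tangentCoord at ht
      have hy0 : z.2 < 0 := by nlinarith [mul_pos hx hc]
      have hx1 : z.1 < Real.sin β := by nlinarith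
      nlinarith
    have hsq := frame_sq β z
    set l := Real.sqrt (z.1 ^ 2 + z.2 ^ 2 - 1)
    set u := radialCoord β z
    set t := tangentCoord β z
    set p := tangencyPoint z
    set Pv := p.1 * Real.sin β - p.2 * Real.cos β
    set Pt := p.1 * Real.cos β + p.2 * Real.sin β
    have hP : Pv ^ 2 + Pt ^ 2 = 1 := by
      simp only [Pv, Pt]; linear_combination (p.1 ^ 2 + p.2 ^ 2) * h1 + hp
    have hu' : 1 + u = Pv - l * Pt := by
      simp only [u, radialCoord, Pv, Pt]
      linear_combination Real.sin β * hz1 - Real.cos β * hz2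
    have ht' : t = Pt + l * Pv := by
      simp only [t, tangentCoord, Pv, Pt]
      linear_combination Real.cos β * hz1 + Real.sin β * hz2
    have hp2 : p.2 = Pt * Real.sin β - Pv * Real.cos β := by
      simp only [Pv, Pt]; linear_combination -p.2 * h1
    clear_value u t Pv Pt l
    have hPt : 0 ≤ Pt := by
      by_contra hneg
      have h5 : t - l * (1 + u) = Pt * (l ^ 2 + 1) := by rw [hu', ht']; ring
      rw [not_le] at hneg
      have hPv : 0 < Pv := pos_of_mul_pos_right (by linarith : 0 < l * Pv) hl.le
      have h6 : 0 < 1 + u := by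
        rw [hu']; linarith [mul_neg_of_pos_of_neg hl hneg]
      have h7 : t < l * (1 + u) := by
        have := mul_neg_of_neg_of_pos hneg (by positivity : 0 < l ^ 2 + 1)
        linarith
      have h8 : t ^ 2 < (l * (1 + u)) ^ 2 := pow_lt_pow_left₀ h7 ht two_ne_zero
      have h10 : (1 + u) ^ 2 ≤ 1 := pow_le_one₀ h6.le (by linarith)
      have h9 : l ^ 2 * (1 + u) ^ 2 ≤ l ^ 2 * 1 := by gcongr
      rw [mul_pow] at h8
      linarith
    have hPv : Pv ≤ 1 := by
      have h := sq_nonneg Pt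
      exact (abs_le_one_iff_mul_self_le_one.2 (by linarith [sq Pv])) |> le_of_abs_le
    rw [hp2]
    nlinarith [mul_nonneg hPt hs.le]

/-- Needed for points that may lie below the chord line, such as the image of a corner step: on the
left the tangency point has ordinate at least z.2 / |z|², which is small far from the origin. -/
theorem contact_arc_of_fst_nonpos {z : ℝ × ℝ} (hx : z.1 ≤ 0)
    (hz : 2 ≤ Real.cos β * (z.1 ^ 2 + z.2 ^ 2)) (hz1 : 1 < Real.cos β ^ 2 * (z.1 ^ 2 + z.2 ^ 2)) :
    Contact (circularSector β) z (tangencyPoint z) := by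
  have hcos : Real.cos β ≤ 1 := Real.cos_le_one β
  have hS : 1 < z.1 ^ 2 + z.2 ^ 2 := by nlinarith
  refine contact_tangencyPoint hS ?_
  have hl := Real.sqrt_nonneg (z.1 ^ 2 + z.2 ^ 2 - 1)
  have h2 : 0 ≤ Real.sqrt (z.1 ^ 2 + z.2 ^ 2 - 1) * -z.1 := mul_nonneg hl (by linarith)
  simp only [tangencyPoint]
  rw [le_div_iff₀ (by linarith)]
  have h3 : -z.2 ≤ Real.cos β * (z.1 ^ 2 + z.2 ^ 2) := by
    have h4 : z.2 ^ 2 ≤ (Real.cos β * (z.1 ^ 2 + z.2 ^ 2)) ^ 2 := by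
      have : (Real.cos β * (z.1 ^ 2 + z.2 ^ 2)) ^ 2 =
        (Real.cos β ^ 2 * (z.1 ^ 2 + z.2 ^ 2)) * (z.1 ^ 2 + z.2 ^ 2) := by ring
      rw [this]
      nlinarith
    have := abs_le.1 (abs_le_of_sq_le_sq h4 (by linarith))
    linarith [this.1]
  linarith

theorem Contact.step_eq {z c w : ℝ × ℝ} (h : Contact (circularSector β) z c)
    (hw : OuterBilliardStep (circularSector β) z w) : w = (2 * c.1 - z.1, 2 * c.2 - z.2) :=
  hw.unique h.step

/-- Two steps of the outer billiard around the circular sector. -/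
def DoubleStep (β : ℝ) (z z' : ℝ × ℝ) : Prop :=
  ∃ w, OuterBilliardStep (circularSector β) z w ∧ OuterBilliardStep (circularSector β) w z'

theorem DoubleStep.mirror_symm {z z' : ℝ × ℝ} (h : DoubleStep β z z') :
    DoubleStep β (mirror z') (mirror z) := by
  obtain ⟨w, h1, h2⟩ := h
  exact ⟨mirror w, h2.mirror_symm mirror_mem_circularSector,
    h1.mirror_symm mirror_mem_circularSector⟩

/-- The image lies within distance `2` of the antipode. -/
theorem OuterBilliardStep.add_sq_le {z w : ℝ × ℝ}
    (h : OuterBilliardStep (circularSector β) z w) :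
    (z.1 + w.1) ^ 2 + (z.2 + w.2) ^ 2 ≤ 4 ∧ -(2 * Real.cos β) ≤ z.2 + w.2 := by
  rw [outerBilliardStep_iff_contact] at h
  have h1 := h.2.1.1
  have h2 := h.2.1.2
  simp only at h1 h2
  constructor <;> nlinarith

/-- A double step moves a point by at most `4`. -/
theorem DoubleStep.sub_sq_le {z z' : ℝ × ℝ} (h : DoubleStep β z z') :
    (z'.1 - z.1) ^ 2 + (z'.2 - z.2) ^ 2 ≤ 16 := by
  obtain ⟨w, h1, h2⟩ := h
  have e1 := h1.add_sq_le.1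
  have e2 := h2.add_sq_le.1
  nlinarith [sq_nonneg (z.1 + w.1 + (w.1 + z'.1)), sq_nonneg (z.2 + w.2 + (w.2 + z'.2))]

/-- The size beyond which the asymptotic description of the dynamics is used. -/
def Far (β L : ℝ) : Prop := 10 ≤ L * (Real.sin β * Real.cos β) ∧ 100 ≤ L

theorem far_bounds (hs : 0 < Real.sin β) (hc : 0 < Real.cos β) {L : ℝ} (hL : Far β L) :
    10 ≤ L * Real.sin β ∧ 10 ≤ L * Real.cos β := by
  have h1 := Real.sin_le_one β
  have h2 := Real.cos_le_one β
  have h0 : 0 < L := by linarith [hL.2]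
  have := hL.1
  constructor
  · nlinarith [mul_pos h0 hs]
  · nlinarith [mul_pos h0 hc]

/-- Lower bounds in the right wedge. -/
theorem wedge_bounds (hs : 0 < Real.sin β) (hc : 0 < Real.cos β) {L : ℝ} (hL : Far β L)
    {z : ℝ × ℝ} (hz : L ^ 2 ≤ z.1 ^ 2 + z.2 ^ 2) (hy : -Real.cos β < z.2)
    (hu : -5 ≤ radialCoord β z) : 2 ≤ z.1 ∧ 2 ≤ tangentCoord β z := by
  obtain ⟨h1, h2⟩ := far_bounds hs hc hL
  have hL1 := hL.1
  have hL2 := hL.2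
  have hs1 := Real.sin_le_one β
  have hc1 := Real.cos_le_one β
  have hx : 2 ≤ z.1 := by
    by_contra hx
    unfold radialCoord at hu
    have hyc : z.2 * Real.cos β < 6 := by nlinarith
    have hy1 : z.2 < L * (6 / 10) := by
      by_contra hge
      nlinarith
    have hx1 : -5 ≤ z.1 * Real.sin β := by nlinarith
    have hx2 : -(L * (5 / 10)) ≤ z.1 := by
      by_contra hge
      nlinarith
    nlinarith
  refine ⟨hx, ?_⟩
  unfold tangentCoord
  rcases le_or_gt 0 z.2 with h0 | h0
  · have : L ≤ z.1 + z.2 := by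
      by_contra hlt
      nlinarith [mul_nonneg (by linarith : (0 : ℝ) ≤ z.1) h0]
    have e1 : z.1 * (Real.sin β * Real.cos β) ≤ z.1 * Real.cos β := by
      have : Real.sin β * Real.cos β ≤ Real.cos β := by nlinarith
      gcongr
    have e2 : z.2 * (Real.sin β * Real.cos β) ≤ z.2 * Real.sin β := by
      have : Real.sin β * Real.cos β ≤ Real.sin β := by nlinarith
      gcongr
    nlinarith [mul_pos hs hc]
  · have : L - 1 ≤ z.1 := by
      by_contra hlt
      nlinarith
    have e1 : (L - 1) * Real.cos β ≤ z.1 * Real.cos β := by gcongr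
    nlinarith

/-- Parametrisation of a double step that starts in the right wedge: it is a step of the implicit
midpoint rule. -/
theorem DoubleStep.wedge_param (hs : 0 < Real.sin β) (hc : 0 < Real.cos β) {L : ℝ} (hL : Far β L)
    {z z' : ℝ × ℝ} (h : DoubleStep β z z') (hz : L ^ 2 ≤ z.1 ^ 2 + z.2 ^ 2)
    (hy : -Real.cos β < z.2) (hu : 0 ≤ radialCoord β z) :
    ∃ l a b : ℝ, L / 2 ≤ l ∧ 0 ≤ a ∧ a ^ 2 + b ^ 2 = 1 ∧
      radialCoord β z = 1 + a + l * b ∧ tangentCoord β z = -b + l * a ∧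
      radialCoord β z' = -1 - a + l * b ∧ tangentCoord β z' = b + l * a ∧
      z.2 ≤ z'.2 := by
  obtain ⟨hx2, ht2⟩ := wedge_bounds hs hc hL hz hy (by linarith)
  have h1 := Real.sin_sq_add_cos_sq β
  have hs1 := Real.sin_le_one β
  have hc1 := Real.cos_le_one β
  have hL2 := hL.2
  obtain ⟨w, hw, hw'⟩ := h
  have ew := (contact_corner hs hy hu).step_eq hw
  simp only at ew
  have hfr := frame_sq β z
  set u := radialCoord β z with hud
  set t := tangentCoord β z with htd
  have hw1 : w.1 = 2 * Real.sin β - z.1 := by rw [ew]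
  have hw2 : w.2 = -2 * Real.cos β - z.2 := by rw [ew]; ring
  have hsw : w.1 ^ 2 + w.2 ^ 2 = z.1 ^ 2 + z.2 ^ 2 - 4 * u := by
    rw [hw1, hw2, hud, radialCoord]; linear_combination 4 * h1
  have hlow : (z.1 ^ 2 + z.2 ^ 2) / 2 - 4 ≤ w.1 ^ 2 + w.2 ^ 2 := by
    rw [hsw]
    linarith [sq_nonneg (u + 1 - 4), sq_nonneg t]
  have hbig : (100 : ℝ) ^ 2 ≤ L ^ 2 := by gcongr
  have hcL := (far_bounds hs hc hL).2
  have hc2L : 100 ≤ Real.cos β ^ 2 * L ^ 2 := by nlinarith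
  have hcL' : 1000 ≤ Real.cos β * L ^ 2 := by nlinarith
  have hcon : Contact (circularSector β) w (tangencyPoint w) := by
    refine contact_arc_of_fst_nonpos (by rw [hw1]; linarith) ?_ ?_
    · nlinarith
    · nlinarith
  have ew' := hcon.step_eq hw'
  have hS1 : 1 < w.1 ^ 2 + w.2 ^ 2 := by linarith
  obtain ⟨hp, hq1, hq2⟩ := tangencyPoint_spec hS1
  have hpy := hcon.2.1.2
  have hl2 := Real.sq_sqrt (show 0 ≤ w.1 ^ 2 + w.2 ^ 2 - 1 by linarith)
  have hl0 := Real.sqrt_nonneg (w.1 ^ 2 + w.2 ^ 2 - 1)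
  set l := Real.sqrt (w.1 ^ 2 + w.2 ^ 2 - 1)
  set p := tangencyPoint w
  have hz1 : z'.1 = 2 * p.1 - w.1 := by rw [ew']
  have hz2 : z'.2 = 2 * p.2 - w.2 := by rw [ew']
  have hlL : L / 2 ≤ l := by
    refine le_of_sq_le_sq ?_ hl0
    rw [hl2, div_pow]
    linarith
  have hab : (p.1 * Real.sin β - p.2 * Real.cos β) ^ 2 +
      (p.1 * Real.cos β + p.2 * Real.sin β) ^ 2 = 1 := by
    linear_combination (p.1 ^ 2 + p.2 ^ 2) * h1 + hp
  have hb2 : (p.1 * Real.cos β + p.2 * Real.sin β) ^ 2 ≤ 1 := by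
    linarith [sq_nonneg (p.1 * Real.sin β - p.2 * Real.cos β)]
  have htl : t = -(p.1 * Real.cos β + p.2 * Real.sin β) +
      l * -(p.1 * Real.sin β - p.2 * Real.cos β) := by
    rw [htd, tangentCoord]
    linear_combination -Real.cos β * hq1 - Real.sin β * hq2 + Real.cos β * hw1 + Real.sin β * hw2
  -- With l the tangent length from w and p its tangency point, a = -⟨p, v⟩ and b = ⟨p, τ⟩. Since z'
  -- - z = 2 (p - v), the displacement is (-2 (1 + a), 2 b) in the frame, and the midpoint is l (b,
  -- a).
  refine ⟨l, -(p.1 * Real.sin β - p.2 * Real.cos β), p.1 * Real.cos β + p.2 * Real.sin β, hlL, ?_,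
    ?_, ?_, htl, ?_, ?_, ?_⟩
  · by_contra hneg
    have : l * -(p.1 * Real.sin β - p.2 * Real.cos β) ≤ 0 :=
      mul_nonpos_of_nonneg_of_nonpos hl0 (not_le.1 hneg).le
    linarith [(abs_le.1 ((sq_le_one_iff_abs_le_one _).1 hb2)).1]
  · linear_combination hab
  · rw [hud, radialCoord]
    linear_combination Real.sin β * hw1 - Real.cos β * hw2 - Real.sin β * hq1 + Real.cos β * hq2
      + 2 * h1
  · rw [radialCoord, hz1, hz2]
    linear_combination -Real.sin β * hq1 + Real.cos β * hq2
  · rw [tangentCoord, hz1, hz2]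
    linear_combination -Real.cos β * hq1 - Real.sin β * hq2
  · rw [hz2, hw2]
    linarith

end Wedge

/-! ### The midpoint rule for the parabolic flow and its matching with the rotation. -/

section Estimates

/-- The size of `M ± e` to second order, for the implicit midpoint rule. -/
theorem sqrt_midpoint_bounds {l a b q : ℝ} (hl : 5 ≤ l) (ha : 0 ≤ a) (hab : a ^ 2 + b ^ 2 = 1)
    (hq : 0 ≤ q) (hq2 : q ^ 2 = l ^ 2 + 2 * l * b + 2 + 2 * a) :
    l + b ≤ q ∧ q ≤ l + b + 4 / l ∧ l - 1 ≤ q := by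
  have hb : -1 ≤ b ∧ b ≤ 1 := abs_le.1 ((sq_le_one_iff_abs_le_one _).1 (by nlinarith))
  have ha1 : a ≤ 1 := by nlinarith
  have h1 : q ^ 2 - (l + b) ^ 2 = 2 + 2 * a - b ^ 2 := by linear_combination hq2
  have hb2 : b ^ 2 ≤ 1 := by nlinarith
  have h2 : l + b ≤ q := by
    by_contra h
    nlinarith
  refine ⟨h2, ?_, by linarith⟩
  have h3 : (q - (l + b)) * l ≤ 4 := by
    have h4 : (q - (l + b)) * l ≤ (q - (l + b)) * (q + (l + b)) :=
      mul_le_mul_of_nonneg_left (by linarith) (by linarith)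
    nlinarith
  have : q - (l + b) ≤ 4 / l := by rw [le_div_iff₀ (by linarith)]; exact h3
  linarith

/-- The number of double steps needed to leave the wedge is, up to a constant, this function of
the invariant and of the distance to the boundary ray. -/
noncomputable def exitTime (u I : ℝ) : ℝ := (u + u ^ 3 / (3 * I ^ 2)) / 4

/-- The midpoint rule discretises du = -2 (1 + t/q), dt = 2 u/q with q = √(u² + t²), a Hamiltonian
flow preserving I = q + t. On a level set du = -4 I² / (I² + u²), so the elapsed time is the
integral of (1 + u²/I²)/4, which is `exitTime`. The discrete error is of order l⁻². -/
theorem exitTime_step {l a b I I' : ℝ} (hl : 5 ≤ l) (ha : 0 ≤ a) (hab : a ^ 2 + b ^ 2 = 1)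
    (hI : l * (1 + a) ≤ I) (hI2 : I ≤ l * (1 + a) + 4 / l) (hI' : l * (1 + a) ≤ I')
    (hII : |I' - I| ≤ 16 / l ^ 2) :
    |exitTime (-1 - a + l * b) I' - exitTime (1 + a + l * b) I + 1| ≤ 46 / l ^ 2 := by
  have hl0 : 0 < l := by linarith
  have hb : -1 ≤ b ∧ b ≤ 1 := abs_le.1 ((sq_le_one_iff_abs_le_one _).1 (by nlinarith))
  have hb2 : b ^ 2 ≤ 1 := by nlinarith
  have ha1 : a ≤ 1 := by nlinarith
  set K := l * (1 + a) with hK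
  have hKl : l ≤ K := by nlinarith
  have hIl : l ≤ I := by linarith
  have hIl' : l ≤ I' := by linarith
  have hI0 : 0 < I := by linarith
  have hI0' : 0 < I' := by linarith
  have hK0 : 0 < K := by linarith
  set u := 1 + a + l * b with hu
  set u' := -1 - a + l * b with hu'
  have hlb : |l * b| ≤ l := by
    rw [abs_le]; constructor <;> nlinarith
  have hu'b : |u'| ≤ 2 * l := by
    have := abs_le.1 hlb
    rw [abs_le]; constructor <;> linarith [this.1, this.2]
  have r1 : |1 / I' ^ 2 - 1 / I ^ 2| ≤ 32 / l ^ 5 := by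
    have e : 1 / I' ^ 2 - 1 / I ^ 2 = -(I' - I) * (1 / (I' ^ 2 * I) + 1 / (I' * I ^ 2)) := by
      field_simp; ring
    have e1 : 1 / (I' ^ 2 * I) ≤ 1 / (l ^ 2 * l) := by gcongr
    have e2 : 1 / (I' * I ^ 2) ≤ 1 / (l * l ^ 2) := by gcongr
    have e3 : 0 ≤ 1 / (I' ^ 2 * I) + 1 / (I' * I ^ 2) := by positivity
    rw [e, abs_mul, abs_neg, abs_of_nonneg e3]
    calc _ ≤ 16 / l ^ 2 * (1 / (l ^ 2 * l) + 1 / (l * l ^ 2)) := by gcongr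
      _ = 32 / l ^ 5 := by field_simp; norm_num
  have r2 : |1 / I ^ 2 - 1 / K ^ 2| ≤ 8 / l ^ 4 := by
    have e : 1 / I ^ 2 - 1 / K ^ 2 = -((I - K) * (1 / (I ^ 2 * K) + 1 / (I * K ^ 2))) := by
      field_simp; ring
    have e1 : 1 / (I ^ 2 * K) ≤ 1 / (l ^ 2 * l) := by gcongr
    have e2 : 1 / (I * K ^ 2) ≤ 1 / (l * l ^ 2) := by gcongr
    have e3 : 0 ≤ 1 / (I ^ 2 * K) + 1 / (I * K ^ 2) := by positivity
    have e4 : 0 ≤ I - K := by linarith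
    have e5 : I - K ≤ 4 / l := by linarith
    rw [e, abs_neg, abs_of_nonneg (by positivity)]
    calc _ ≤ 4 / l * (1 / (l ^ 2 * l) + 1 / (l * l ^ 2)) := by gcongr
      _ = 8 / l ^ 4 := by field_simp; norm_num
  have c1 : |u' ^ 3| ≤ 8 * l ^ 3 := by
    rw [abs_pow]
    calc |u'| ^ 3 ≤ (2 * l) ^ 3 := by gcongr
      _ = 8 * l ^ 3 := by ring
  have c2 : |u' ^ 3 - u ^ 3| ≤ 28 * l ^ 2 := by
    have e : u' ^ 3 - u ^ 3 = -(6 * (l ^ 2 * b ^ 2) * (1 + a) + 2 * (1 + a) ^ 3) := by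
      rw [hu, hu']; ring
    have e1 : (1 + a) ^ 3 ≤ 2 ^ 3 := by gcongr; linarith
    have e2 : (l ^ 2 * b ^ 2) * (1 + a) ≤ (l ^ 2 * 1) * 2 := by gcongr; linarith
    rw [e, abs_neg, abs_of_nonneg (by positivity)]
    nlinarith
  have c3 : (1 + a) ^ 3 / K ^ 2 ≤ 2 / l ^ 2 := by
    have e : (1 + a) ^ 3 / K ^ 2 = (1 + a) / l ^ 2 := by
      rw [hK]
      have : 1 + a ≠ 0 := by positivity
      field_simp
    rw [e]
    gcongr
    linarith
  have c30 : 0 ≤ (1 + a) ^ 3 / K ^ 2 := by positivity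
  -- K = l (1 + a) is the value of the invariant at the midpoint. With K in place of I and I' the
  -- drop is -1 up to (1 + a)³ / (6 K²), because b² / (1 + a) = 1 - a; the other two terms are the
  -- cost of the replacement.
  have main : exitTime u' I' - exitTime u I + 1 =
      (u' ^ 3 * (1 / I' ^ 2 - 1 / I ^ 2)) / 12 + ((u' ^ 3 - u ^ 3) * (1 / I ^ 2 - 1 / K ^ 2)) / 12
        - ((1 + a) ^ 3 / K ^ 2) / 6 := by
    have e0 : (u' ^ 3 - u ^ 3) * (1 / K ^ 2) =
        -(6 * b ^ 2 / (1 + a)) - 2 * ((1 + a) ^ 3 / K ^ 2) := by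
      rw [hu, hu', hK]
      have : 1 + a ≠ 0 := by positivity
      field_simp
      ring
    have e1 : 6 * b ^ 2 / (1 + a) = 6 * (1 - a) := by
      have : 1 + a ≠ 0 := by positivity
      field_simp
      linear_combination hab
    have e2 : u' - u = -2 * (1 + a) := by rw [hu, hu']; ring
    unfold exitTime
    have e3 : u' ^ 3 / (3 * I' ^ 2) = u' ^ 3 * (1 / I' ^ 2) / 3 := by field_simp
    have e4 : u ^ 3 / (3 * I ^ 2) = u ^ 3 * (1 / I ^ 2) / 3 := by field_simp
    rw [e3, e4]
    linear_combination (1 / 4) * e2 + (1 / 12) * e0 - (1 / 12) * e1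
  rw [main]
  have b1 : |(u' ^ 3 * (1 / I' ^ 2 - 1 / I ^ 2)) / 12| ≤ 8 * l ^ 3 * (32 / l ^ 5) / 12 := by
    rw [abs_div, abs_mul, abs_of_pos (by norm_num : (0 : ℝ) < 12)]
    gcongr
  have b2 : |((u' ^ 3 - u ^ 3) * (1 / I ^ 2 - 1 / K ^ 2)) / 12| ≤
      28 * l ^ 2 * (8 / l ^ 4) / 12 := by
    rw [abs_div, abs_mul, abs_of_pos (by norm_num : (0 : ℝ) < 12)]
    gcongr
  have s1 : 8 * l ^ 3 * (32 / l ^ 5) / 12 = (256 / 12) * (1 / l ^ 2) := by field_simp; norm_num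
  have s2 : 28 * l ^ 2 * (8 / l ^ 4) / 12 = (224 / 12) * (1 / l ^ 2) := by field_simp; norm_num
  have s3 : 46 / l ^ 2 = 46 * (1 / l ^ 2) := by ring
  have s4 : 2 / l ^ 2 = 2 * (1 / l ^ 2) := by ring
  have hp : 0 < 1 / l ^ 2 := by positivity
  rw [s1] at b1
  rw [s2] at b2
  rw [s4] at c3
  rw [s3]
  have b1' := abs_le.1 b1
  have b2' := abs_le.1 b2
  rw [abs_le]
  constructor <;> linarith [b1'.1, b1'.2, b2'.1, b2'.2]

/-- The almost invariant and the time function along one double step in the wedge. -/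
theorem wedge_step_estimate {l a b c : ℝ} (hl : 5 ≤ l) (ha : 0 ≤ a) (hab : a ^ 2 + b ^ 2 = 1)
    (hc : |c| ≤ 1 / 4) {u t u' t' I I' : ℝ} (hu : u = 1 + a + l * b) (ht : t = -b + l * a)
    (hu' : u' = -1 - a + l * b) (ht' : t' = b + l * a)
    (hI : I = Real.sqrt (u ^ 2 + t ^ 2) + t) (hI' : I' = Real.sqrt (u' ^ 2 + t' ^ 2) + t') :
    |I' - I| ≤ 16 / l ^ 2 ∧
      |(c * I' + exitTime u' I') - (c * I + exitTime u I) + 1| ≤ 50 / l ^ 2 := by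
  have hl0 : 0 < l := by linarith
  have hq2 := Real.sq_sqrt (show 0 ≤ u ^ 2 + t ^ 2 by positivity)
  have hq0 := Real.sqrt_nonneg (u ^ 2 + t ^ 2)
  have hq2' := Real.sq_sqrt (show 0 ≤ u' ^ 2 + t' ^ 2 by positivity)
  have hq0' := Real.sqrt_nonneg (u' ^ 2 + t' ^ 2)
  set q := Real.sqrt (u ^ 2 + t ^ 2)
  set q' := Real.sqrt (u' ^ 2 + t' ^ 2)
  have hb : -1 ≤ b ∧ b ≤ 1 := abs_le.1 ((sq_le_one_iff_abs_le_one _).1 (by nlinarith))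
  have e1 : q ^ 2 = l ^ 2 + 2 * l * b + 2 + 2 * a := by
    rw [hq2, hu, ht]; linear_combination (l ^ 2 + 1) * hab
  have e2 : q' ^ 2 = l ^ 2 + 2 * l * -b + 2 + 2 * a := by
    rw [hq2', hu', ht']; linear_combination (l ^ 2 + 1) * hab
  obtain ⟨p1, p2, p3⟩ := sqrt_midpoint_bounds hl ha hab hq0 e1
  obtain ⟨p1', p2', p3'⟩ := sqrt_midpoint_bounds hl ha (by rw [neg_sq]; exact hab) hq0' e2
  have hII : |I' - I| ≤ 16 / l ^ 2 := by
    have hs : l ≤ q + q' := by linarith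
    -- Since q'² - q² = -4 l b and t' - t = 2 b, the leading terms cancel, and only the deviation of
    -- q + q' from 2 l remains.
    have e : I' - I = 2 * b * ((q + q' - 2 * l) / (q + q')) := by
      have : q + q' ≠ 0 := by linarith
      rw [hI, hI', ht, ht']
      field_simp
      linear_combination e2 - e1
    have h1 : 0 ≤ q + q' - 2 * l := by linarith
    have h2 : q + q' - 2 * l ≤ 8 / l := by
      have : 8 / l = 4 / l + 4 / l := by ring
      linarith
    have h3 : 0 < q + q' := by linarith
    rw [e, abs_mul, abs_of_nonneg (by positivity : 0 ≤ (q + q' - 2 * l) / (q + q'))]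
    have hb' : |2 * b| ≤ 2 := by rw [abs_le]; constructor <;> linarith
    calc _ ≤ 2 * ((8 / l) / l) := by gcongr
      _ = 16 / l ^ 2 := by field_simp; norm_num
  have hn := exitTime_step hl ha hab (I := I) (I' := I') (by rw [hI, ht]; linarith)
    (by rw [hI, ht]; linarith) (by rw [hI', ht']; linarith) hII
  refine ⟨hII, ?_⟩
  have e : (c * I' + exitTime u' I') - (c * I + exitTime u I) + 1 =
      c * (I' - I) + (exitTime u' I' - exitTime u I + 1) := by ring
  rw [e, hu, hu']
  calc _ ≤ |c * (I' - I)| + |exitTime (-1 - a + l * b) I' - exitTime (1 + a + l * b) I + 1| :=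
        abs_add_le _ _
    _ ≤ 1 / 4 * (16 / l ^ 2) + 46 / l ^ 2 := by
        rw [abs_mul]; gcongr
    _ = 50 / l ^ 2 := by ring

theorem abs_arctan_sub_le (w : ℝ) : |Real.arctan w - w| ≤ w ^ 2 := by
  have key : ∀ w : ℝ, 0 ≤ w → |Real.arctan w - w| ≤ w ^ 2 := by
    intro w hw
    have h0 : 0 ≤ Real.arctan w := Real.arctan_nonneg.2 hw
    have h1 : Real.arctan w ≤ w := by
      have := Real.le_tan h0 (Real.arctan_lt_pi_div_two w)
      rwa [Real.tan_arctan] at this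
    have h2 : w / Real.sqrt (1 + w ^ 2) ≤ Real.arctan w := by
      rw [← Real.sin_arctan]
      exact Real.sin_le h0
    have h3 : Real.sqrt (1 + w ^ 2) ≤ 1 + w := by
      rw [Real.sqrt_le_left (by linarith)]
      nlinarith
    have h4 : 0 < Real.sqrt (1 + w ^ 2) := Real.sqrt_pos.2 (by positivity)
    have h5 : w - w ^ 2 ≤ w / Real.sqrt (1 + w ^ 2) := by
      rw [le_div_iff₀ h4]
      rcases le_or_gt w 1 with h | h
      · calc (w - w ^ 2) * Real.sqrt (1 + w ^ 2) ≤ (w - w ^ 2) * (1 + w) :=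
            mul_le_mul_of_nonneg_left h3 (by nlinarith)
          _ ≤ w := by nlinarith [pow_nonneg hw 3]
      · have : (w - w ^ 2) * Real.sqrt (1 + w ^ 2) ≤ 0 :=
          mul_nonpos_of_nonpos_of_nonneg (by nlinarith) h4.le
        linarith
    rw [abs_le]
    constructor <;> nlinarith
  rcases le_total 0 w with h | h
  · exact key w h
  · have := key (-w) (by linarith)
    rw [Real.arctan_neg, neg_sq, ← abs_neg] at this
    convert this using 2
    ring

theorem arcsin_bounds {x : ℝ} (hx : 0 < x) (hx1 : x ≤ 1 / 2) :
    x ≤ Real.arcsin x ∧ Real.arcsin x ≤ x + x ^ 3 := by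
  have hs : Real.sin (Real.arcsin x) = x := Real.sin_arcsin (by linarith) (by linarith)
  have hy : 0 < Real.arcsin x := Real.arcsin_pos.2 hx
  have h1 : x ≤ Real.arcsin x := by
    have := Real.sin_le hy.le
    rwa [hs] at this
  have h2 : Real.arcsin x ≤ 1 := by
    have h3 : Real.arcsin x ≤ Real.pi / 6 := by
      rw [Real.arcsin_le_iff_le_sin' ⟨by linarith [Real.pi_pos], by linarith [Real.pi_pos]⟩,
        Real.sin_pi_div_six]
      exact hx1
    linarith [Real.pi_le_four]
  have h4 := Real.sin_gt_sub_cube hy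
  rw [hs] at h4
  set y := Real.arcsin x
  have h5 : y ^ 3 ≤ y := by nlinarith [mul_pos hy hy]
  have h6 : y ≤ 4 / 3 * x := by linarith
  have h7 : y ^ 3 ≤ (4 / 3 * x) ^ 3 := by gcongr
  refine ⟨h1, ?_⟩
  nlinarith [pow_pos hx 3]

theorem inv_arcsin_bounds {r : ℝ} (hr : 2 ≤ r) :
    r - 1 / r ≤ 1 / Real.arcsin (1 / r) ∧ 1 / Real.arcsin (1 / r) ≤ r := by
  have hr0 : 0 < r := by linarith
  obtain ⟨h1, h2⟩ := arcsin_bounds (x := 1 / r) (by positivity)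
    (by rw [div_le_div_iff₀ hr0 two_pos]; linarith)
  have h0 : 0 < 1 / r := by positivity
  have hp : 0 < Real.arcsin (1 / r) := by linarith
  constructor
  · rw [le_div_iff₀ hp]
    calc (r - 1 / r) * Real.arcsin (1 / r) ≤ (r - 1 / r) * (1 / r + (1 / r) ^ 3) := by
          refine mul_le_mul_of_nonneg_left h2 ?_
          have : 1 / r ≤ 1 := by rw [div_le_one hr0]; linarith
          linarith
      _ = 1 - (1 / r) ^ 4 := by field_simp; ring
      _ ≤ 1 := by linarith [pow_pos h0 4]
  · rw [div_le_iff₀ hp]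
    calc (1 : ℝ) = r * (1 / r) := by field_simp
      _ ≤ r * Real.arcsin (1 / r) := by gcongr

/-- Matching of the wedge functions and of the arc functions near the boundary ray. -/
theorem transition_estimate {θ u t q r : ℝ} (hθ : 0 ≤ θ) (hθ2 : θ ≤ Real.pi / 2) (ht : 50 ≤ t)
    (hu : |u| ≤ 5) (hq : 0 ≤ q) (hq2 : q ^ 2 = u ^ 2 + t ^ 2) (hr : 0 ≤ r)
    (hr2 : r ^ 2 = (1 + u) ^ 2 + t ^ 2) :
    |(q + t) - 2 * r| ≤ 50 / t ∧
    |(θ / 8 * (q + t) + 1 / 4 + exitTime u (q + t)) -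
      (θ + Real.arctan ((1 + u) / t)) / (4 * Real.arcsin (1 / r))| ≤ 50 / t := by
  have ht0 : 0 < t := by linarith
  have hu' := abs_le.1 hu
  have hπ := Real.pi_le_four
  have q1 : t ≤ q := by
    by_contra h
    nlinarith [sq_nonneg u]
  have r1 : t ≤ r := by
    by_contra h
    nlinarith [sq_nonneg (1 + u)]
  have q2 : (q - t) * t ≤ 25 / 2 := by nlinarith
  have r2 : (r - t) * t ≤ 18 := by nlinarith
  have q3 : q - t ≤ (25 / 2) / t := by rw [le_div_iff₀ ht0]; exact q2
  have r3 : r - t ≤ 18 / t := by rw [le_div_iff₀ ht0]; exact r2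
  have hp : 0 < 1 / t := by positivity
  have ht1 : 1 / t ≤ 1 / 50 := by gcongr
  rw [div_eq_mul_one_div] at q3 r3
  rw [div_eq_mul_one_div 50 t]
  have A : |(q + t) - 2 * r| ≤ 40 * (1 / t) := by
    rw [abs_le]; constructor <;> linarith
  refine ⟨by linarith, ?_⟩
  set w := (1 + u) / t with hw
  have hwt : w * t = 1 + u := by rw [hw]; field_simp
  have hw6 : |w| ≤ 6 * (1 / t) := by
    rw [hw, abs_div, abs_of_pos ht0, div_eq_mul_one_div]
    gcongr
    rw [abs_le]; constructor <;> linarith [hu'.1, hu'.2]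
  have hat := abs_arctan_sub_le w
  obtain ⟨s1, s2⟩ := inv_arcsin_bounds (r := r) (by linarith)
  have e0 : (θ + Real.arctan w) / (4 * Real.arcsin (1 / r)) =
      (θ + Real.arctan w) / 4 * (1 / Real.arcsin (1 / r)) := by
    rw [div_mul_div_comm, mul_one]
  rw [e0]
  set g := 1 / Real.arcsin (1 / r)
  have hrinv : 1 / r ≤ 1 / t := by gcongr
  have B1 : |u ^ 3 / (3 * (q + t) ^ 2)| ≤ 1 / t := by
    rw [abs_div, abs_of_pos (by positivity : 0 < 3 * (q + t) ^ 2), abs_pow,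
      div_le_div_iff₀ (by positivity) ht0]
    have : |u| ^ 3 ≤ 5 ^ 3 := by gcongr
    nlinarith
  have B2 : |w * (r - t)| ≤ 3 * (1 / t) := by
    rw [abs_mul, abs_of_nonneg (by linarith : 0 ≤ r - t)]
    calc _ ≤ 6 * (1 / t) * (18 * (1 / t)) := by gcongr
      _ = 108 * (1 / t) * (1 / t) := by ring
      _ ≤ 108 * (1 / t) * (1 / 50) := by gcongr
      _ ≤ _ := by linarith
  have hr2t : r ≤ 2 * t := by nlinarith
  have B3 : |(Real.arctan w - w) * r| ≤ 72 * (1 / t) := by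
    rw [abs_mul, abs_of_nonneg hr]
    calc _ ≤ w ^ 2 * (2 * t) := by gcongr
      _ = |w| ^ 2 * (2 * t) := by rw [sq_abs]
      _ ≤ (6 * (1 / t)) ^ 2 * (2 * t) := by gcongr
      _ = 72 * (1 / t) := by field_simp; norm_num
  have B4 : |(θ + Real.arctan w) * (r - g)| ≤ 4 * (1 / t) := by
    rw [abs_mul, abs_of_nonneg (by linarith : 0 ≤ r - g)]
    have h1 : |θ + Real.arctan w| ≤ 4 := by
      rw [abs_le]
      constructor <;> linarith [Real.arctan_lt_pi_div_two w, Real.neg_pi_div_two_lt_arctan w]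
    gcongr
    linarith
  have B5 : |θ / 8 * ((q + t) - 2 * r)| ≤ 10 * (1 / t) := by
    rw [abs_mul, abs_of_nonneg (by positivity : 0 ≤ θ / 8)]
    calc _ ≤ (1 / 4) * (40 * (1 / t)) :=
          mul_le_mul (by linarith) A (abs_nonneg _) (by norm_num)
      _ = _ := by ring
  -- Both times are (θ r + 1 + u)/4 to leading order, since q + t ≈ 2 r, arctan w ≈ w, w r ≈ 1 + u
  -- and 1/arcsin(1/r) ≈ r. The summand 1/4 in `wedgeTime` arises because u is measured from the
  -- corner and not from the origin.
  have e : (θ / 8 * (q + t) + 1 / 4 + exitTime u (q + t)) - (θ + Real.arctan w) / 4 * g =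
      θ / 8 * ((q + t) - 2 * r) + u ^ 3 / (3 * (q + t) ^ 2) / 4 - (w * (r - t)) / 4
        - ((Real.arctan w - w) * r) / 4 + ((θ + Real.arctan w) * (r - g)) / 4 := by
    unfold exitTime
    linear_combination -(1 / 4) * hwt
  rw [e, abs_le]
  have B1' := abs_le.1 B1
  have B2' := abs_le.1 B2
  have B3' := abs_le.1 B3
  have B4' := abs_le.1 B4
  have B5' := abs_le.1 B5
  constructor <;> linarith [B1'.1, B1'.2, B2'.1, B2'.2, B3'.1, B3'.2, B4'.1, B4'.2, B5'.1, B5'.2]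

end Estimates

/-! ### Almost invariant and time function in the whole upper region. -/

section Invariants

variable {β : ℝ}

/-- The Euclidean norm. -/
noncomputable def radius (z : ℝ × ℝ) : ℝ := Real.sqrt (z.1 ^ 2 + z.2 ^ 2)

/-- The almost invariant in the right wedge; its level sets are parabolas. -/
noncomputable def wedgeInvariant (β : ℝ) (z : ℝ × ℝ) : ℝ :=
  Real.sqrt (radialCoord β z ^ 2 + tangentCoord β z ^ 2) + tangentCoord β z

/-- The number of double steps needed to go from the right wedge to the vertical axis. -/
noncomputable def wedgeTime (β : ℝ) (z : ℝ × ℝ) : ℝ :=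
  (Real.pi / 2 - β) / 8 * wedgeInvariant β z + 1 / 4 +
    exitTime (radialCoord β z) (wedgeInvariant β z)

/-- The number of double steps needed to go to the vertical axis, for the rotation. -/
noncomputable def arcTime (z : ℝ × ℝ) : ℝ :=
  Real.arctan (z.1 / z.2) / (4 * Real.arcsin (1 / radius z))

open Classical in
/-- The almost invariant of the double step in the upper region. -/
noncomputable def upperInvariant (β : ℝ) (z : ℝ × ℝ) : ℝ :=
  if 0 ≤ radialCoord β z then wedgeInvariant β z
  else if 0 ≤ radialCoord β (mirror z) then wedgeInvariant β (mirror z) else 2 * radius z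

open Classical in
/-- The time function of the double step in the upper region. -/
noncomputable def upperTime (β : ℝ) (z : ℝ × ℝ) : ℝ :=
  if 0 ≤ radialCoord β z then wedgeTime β z
  else if 0 ≤ radialCoord β (mirror z) then -wedgeTime β (mirror z) else arcTime z

open Classical in
/-- `1` in the right wedge, `-1` in the left wedge, and `0` in between. -/
noncomputable def upperSide (β : ℝ) (z : ℝ × ℝ) : ℝ :=
  if 0 ≤ radialCoord β z then 1 else if 0 ≤ radialCoord β (mirror z) then -1 else 0

theorem radialCoord_mirror_neg (hs : 0 < Real.sin β) (hc : 0 < Real.cos β) {L : ℝ}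
    (hL : Far β L) {z : ℝ × ℝ} (hz : L ^ 2 ≤ z.1 ^ 2 + z.2 ^ 2) (hy : -Real.cos β < z.2)
    (hu : -5 ≤ radialCoord β z) : radialCoord β (mirror z) < 0 := by
  by_contra h
  have h1 := (wedge_bounds hs hc hL hz hy hu).1
  have h2 := (wedge_bounds (z := mirror z) hs hc hL (by simpa using hz) hy (by linarith)).1
  simp only [mirror_fst] at h2
  linarith

theorem radius_mirror (z : ℝ × ℝ) : radius (mirror z) = radius z := by simp [radius]

theorem arcTime_mirror (z : ℝ × ℝ) : arcTime (mirror z) = -arcTime z := by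
  simp only [arcTime, radius_mirror, mirror_fst, mirror_snd, neg_div, Real.arctan_neg]

theorem upper_mirror (hs : 0 < Real.sin β) (hc : 0 < Real.cos β) {L : ℝ}
    (hL : Far β L) {z : ℝ × ℝ} (hz : L ^ 2 ≤ z.1 ^ 2 + z.2 ^ 2) (hy : -Real.cos β < z.2) :
    upperInvariant β (mirror z) = upperInvariant β z ∧
      upperTime β (mirror z) = -upperTime β z ∧ upperSide β (mirror z) = -upperSide β z := by
  unfold upperInvariant upperTime upperSide
  simp only [mirror_mirror]
  by_cases h1 : 0 ≤ radialCoord β z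
  · have h2 := radialCoord_mirror_neg hs hc hL hz hy (by linarith)
    simp [h1, not_le.2 h2]
  · by_cases h3 : 0 ≤ radialCoord β (mirror z)
    · simp [h1, h3]
    · simp [h1, h3, radius_mirror, arcTime_mirror]

/-- Two arc steps rotate about the origin. -/
theorem DoubleStep.rotation {z z' : ℝ × ℝ} (h : DoubleStep β z z') (hs : 0 < Real.sin β)
    (hc : 0 < Real.cos β) (hz : 1 < z.1 ^ 2 + z.2 ^ 2) (hz' : 1 < z'.1 ^ 2 + z'.2 ^ 2)
    (hy : -Real.cos β < z.2) (hy' : -Real.cos β < z'.2) (hu : radialCoord β z < 0)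
    (hu' : radialCoord β (mirror z') < 0) :
    arcMap z = mirror (arcMap (mirror z')) ∧ z'.1 ^ 2 + z'.2 ^ 2 = z.1 ^ 2 + z.2 ^ 2 := by
  obtain ⟨w, h1, h2⟩ := h
  have e1 : w = arcMap z := (contact_arc_of_radialCoord_neg hs hc hy hu hz).step_eq h1
  have h2' := h2.mirror_symm mirror_mem_circularSector
  have e2 : mirror w = arcMap (mirror z') :=
    (contact_arc_of_radialCoord_neg hs hc (z := mirror z') hy' hu' (by simpa using hz')).step_eq h2'
  have nrm : ∀ z : ℝ × ℝ, 1 < z.1 ^ 2 + z.2 ^ 2 →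
      (arcMap z).1 ^ 2 + (arcMap z).2 ^ 2 = z.1 ^ 2 + z.2 ^ 2 := by
    intro z hz
    obtain ⟨-, a2, a3⟩ := tangencyPoint_spec hz
    unfold arcMap
    simp only
    set l := Real.sqrt (z.1 ^ 2 + z.2 ^ 2 - 1)
    linear_combination -4 * (tangencyPoint z).1 * a2 - 4 * (tangencyPoint z).2 * a3
  refine ⟨by rw [← e2, mirror_mirror, e1], ?_⟩
  have n1 := nrm z hz
  have n2 := nrm (mirror z') (by simpa using hz')
  rw [← e1] at n1
  rw [← e2] at n2
  simp only [mirror_fst, mirror_snd, neg_sq] at n2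
  linarith

/-- Coefficients of the rotation by two arc steps. -/
theorem DoubleStep.rotation_coords {z z' : ℝ × ℝ} (hz : 10000 ≤ z.1 ^ 2 + z.2 ^ 2)
    (h1 : arcMap z = mirror (arcMap (mirror z'))) (h2 : z'.1 ^ 2 + z'.2 ^ 2 = z.1 ^ 2 + z.2 ^ 2) :
    ∃ C S : ℝ, 1 / 2 ≤ C ∧ C ≤ 1 ∧ 0 ≤ S ∧ S ≤ 1 ∧
      z'.1 = C * z.1 - S * z.2 ∧ z'.2 = C * z.2 + S * z.1 := by
  obtain ⟨_, _, _, _, _, hab⟩ := hasDerivAt_arc_coeff (s := z.1 ^ 2 + z.2 ^ 2) (by linarith)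
  rw [arcMap_eq, arcMap_eq] at h1
  simp only [neg_sq, h2, mirror, Prod.mk.injEq] at h1
  have hs0 : 0 < z.1 ^ 2 + z.2 ^ 2 := by linarith
  have ha : 2 / (z.1 ^ 2 + z.2 ^ 2) - 1 ≤ -9 / 10 := by
    have : 2 / (z.1 ^ 2 + z.2 ^ 2) ≤ 2 / 10000 := by gcongr
    linarith
  have hb : 0 ≤ 2 * Real.sqrt (z.1 ^ 2 + z.2 ^ 2 - 1) / (z.1 ^ 2 + z.2 ^ 2) := by positivity
  set a := 2 / (z.1 ^ 2 + z.2 ^ 2) - 1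
  set b := 2 * Real.sqrt (z.1 ^ 2 + z.2 ^ 2 - 1) / (z.1 ^ 2 + z.2 ^ 2)
  obtain ⟨e1, e2⟩ := h1
  refine ⟨a ^ 2 - b ^ 2, -(2 * a * b), by nlinarith, by nlinarith [sq_nonneg b], by nlinarith,
    by nlinarith [sq_nonneg (a + b)], ?_, ?_⟩
  · linear_combination -a * e1 - b * e2 - z'.1 * hab
  · linear_combination b * e1 - a * e2 - z'.2 * hab

/-- The side function does not increase from non-positive values. -/
theorem DoubleStep.radialCoord_neg (hs : 0 < Real.sin β) (hc : 0 < Real.cos β) {L : ℝ}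
    (hL : Far β L) {z z' : ℝ × ℝ} (h : DoubleStep β z z') (hz : L ^ 2 ≤ z.1 ^ 2 + z.2 ^ 2)
    (hz' : L ^ 2 ≤ z'.1 ^ 2 + z'.2 ^ 2) (hy : -Real.cos β < z.2) (hy' : -Real.cos β < z'.2)
    (hu : radialCoord β z < 0) : radialCoord β z' < 0 := by
  by_contra hu'
  rw [not_lt] at hu'
  have hL2 := hL.2
  have hbig : (100 : ℝ) ^ 2 ≤ L ^ 2 := by gcongr
  have hm := radialCoord_mirror_neg hs hc hL hz' hy' (by linarith)
  obtain ⟨e1, e2⟩ := h.rotation hs hc (by linarith) (by linarith) hy hy' hu hm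
  obtain ⟨C, S, hC, hC1, hS, hS1, f1, f2⟩ := DoubleStep.rotation_coords (by linarith) e1 e2
  have ht' := (wedge_bounds hs hc hL hz' hy' (by linarith)).2
  have hd := h.sub_sq_le
  have hsc := Real.sin_sq_add_cos_sq β
  have hfr := frame_sq β z
  -- Entering the right wedge would mean turning from u < 0 to u' ≥ 0 by a rotation with sine S ≥ 0.
  -- For t ≥ 0 the rotation cannot push 1 + u' up to 1. For t < 0, the bounds t' ≥ 2 and t' - t ≤ 4
  -- keep t above -2, so 1 + u is very negative and stays so.
  have g1 : 1 + radialCoord β z' = C * (1 + radialCoord β z) - S * tangentCoord β z := by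
    unfold radialCoord tangentCoord
    rw [f1, f2]; ring
  have hdt : (tangentCoord β z' - tangentCoord β z) ^ 2 ≤ 16 := by
    have e : (tangentCoord β z' - tangentCoord β z) ^ 2 +
        (radialCoord β z' - radialCoord β z) ^ 2 = (z'.1 - z.1) ^ 2 + (z'.2 - z.2) ^ 2 := by
      unfold radialCoord tangentCoord
      linear_combination ((z'.1 - z.1) ^ 2 + (z'.2 - z.2) ^ 2) * hsc
    linarith [sq_nonneg (radialCoord β z' - radialCoord β z)]
  have hdt' : tangentCoord β z' - tangentCoord β z ≤ 4 :=
    (abs_le.1 (abs_le_of_sq_le_sq (by linarith : _ ≤ (4 : ℝ) ^ 2) (by norm_num))).2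
  set u := radialCoord β z
  set t := tangentCoord β z
  clear_value u t
  rcases le_or_gt 0 t with ht | ht
  · have hSt := mul_nonneg hS ht
    rcases le_or_gt (1 + u) 0 with h0 | h0
    · nlinarith
    · nlinarith
  · have h1 : 1 + u ≤ -10 := by
      by_contra hh
      nlinarith
    nlinarith

/-- The polar form of an arc step. -/
theorem arcMap_polar {r φ : ℝ} (hr : 1 < r) :
    arcMap (r * Real.sin φ, r * Real.cos φ) =
      (-(r * Real.sin (φ - 2 * Real.arcsin (1 / r))),
        -(r * Real.cos (φ - 2 * Real.arcsin (1 / r)))) := by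
  have hr0 : 0 < r := by linarith
  have h1 : 1 / r ≤ 1 := by rw [div_le_one hr0]; linarith
  have h0 : 0 < 1 / r := by positivity
  have hsin : Real.sin (Real.arcsin (1 / r)) = 1 / r := Real.sin_arcsin (by linarith) h1
  have hcos : Real.cos (Real.arcsin (1 / r)) = Real.sqrt (r ^ 2 - 1) / r := by
    rw [Real.cos_arcsin, eq_div_iff hr0.ne', mul_comm]
    rw [← Real.sqrt_sq hr0.le, ← Real.sqrt_mul (by positivity), Real.sqrt_sq hr0.le]
    congr 1
    field_simp
  have hsq : (r * Real.sin φ) ^ 2 + (r * Real.cos φ) ^ 2 = r ^ 2 := by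
    linear_combination r ^ 2 * Real.sin_sq_add_cos_sq φ
  have hl2 := Real.sq_sqrt (show 0 ≤ r ^ 2 - 1 by nlinarith)
  rw [arcMap_eq]
  simp only [hsq, Real.sin_sub, Real.cos_sub, Real.sin_two_mul, Real.cos_two_mul, hsin, hcos]
  set l := Real.sqrt (r ^ 2 - 1)
  have e : (l / r) ^ 2 = 1 - 1 / r ^ 2 := by
    rw [div_pow, hl2]; field_simp
  ext
  · simp only [e]
    field_simp
    ring
  · simp only [e]
    field_simp
    ring

theorem polar_eq {z : ℝ × ℝ} (hy : 0 < z.2) :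
    z = (radius z * Real.sin (Real.arctan (z.1 / z.2)),
      radius z * Real.cos (Real.arctan (z.1 / z.2))) := by
  have e : Real.sqrt (1 + (z.1 / z.2) ^ 2) = radius z / z.2 := by
    unfold radius
    rw [eq_div_iff hy.ne', ← Real.sqrt_sq hy.le, ← Real.sqrt_mul (by positivity),
      Real.sqrt_sq hy.le]
    congr 1
    field_simp
    ring
  have hr : 0 < radius z := Real.sqrt_pos.2 (by positivity)
  rw [Real.sin_arctan, Real.cos_arctan, e]
  ext <;> simp only <;> field_simp

/-- The time function decreases by exactly one along two arc steps. -/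
theorem arcTime_step {z z' : ℝ × ℝ} (hz : 10000 ≤ z.1 ^ 2 + z.2 ^ 2) (hy : 0 < z.2)
    (hy' : 0 < z'.2) (h1 : arcMap z = mirror (arcMap (mirror z')))
    (h2 : z'.1 ^ 2 + z'.2 ^ 2 = z.1 ^ 2 + z.2 ^ 2) : arcTime z' = arcTime z - 1 := by
  have hr2 : radius z ^ 2 = z.1 ^ 2 + z.2 ^ 2 := Real.sq_sqrt (by linarith)
  have hr0 : 0 ≤ radius z := Real.sqrt_nonneg _
  have hr : 100 ≤ radius z := by nlinarith
  have hrr : radius (mirror z') = radius z := by rw [radius_mirror, radius, h2, radius]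
  have p1 := polar_eq hy
  have p2 := polar_eq (z := mirror z') (by simpa using hy')
  have key : -arcTime (mirror z') = arcTime z - 1 := by
    have hat := Real.arctan_lt_pi_div_two (z.1 / z.2)
    have hat1 := Real.neg_pi_div_two_lt_arctan (z.1 / z.2)
    have hat' := Real.arctan_lt_pi_div_two ((mirror z').1 / (mirror z').2)
    have hat1' := Real.neg_pi_div_two_lt_arctan ((mirror z').1 / (mirror z').2)
    unfold arcTime
    rw [hrr] at p2 ⊢
    set φ := Real.arctan (z.1 / z.2)
    set φ' := Real.arctan ((mirror z').1 / (mirror z').2)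
    rw [p1, p2, arcMap_polar (by linarith), arcMap_polar (by linarith)] at h1
    set r := radius z
    obtain ⟨d1, d2⟩ := arcsin_bounds (x := 1 / r) (by positivity) (by
      rw [div_le_div_iff₀ (by linarith) two_pos]; linarith)
    have hx : 1 / r ≤ 1 / 100 := by gcongr
    have hx0 : 0 < 1 / r := by positivity
    have hx3 : (1 / r) ^ 3 ≤ 1 / r := by
      have : (1 / r) ^ 3 ≤ (1 / r) ^ 1 := pow_le_pow_of_le_one hx0.le (by linarith) (by norm_num)
      simpa using this
    set d := Real.arcsin (1 / r)
    simp only [mirror, Prod.mk.injEq] at h1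
    obtain ⟨e1, e2⟩ := h1
    have hrne : r ≠ 0 := by linarith
    have s1 : Real.sin (φ' - 2 * d) = -Real.sin (φ - 2 * d) := by
      apply mul_left_cancel₀ hrne; linarith
    have s2 : Real.cos (φ' - 2 * d) = Real.cos (φ - 2 * d) := by
      apply mul_left_cancel₀ hrne; linarith
    have hc1 : Real.cos ((φ' - 2 * d) + (φ - 2 * d)) = 1 := by
      rw [Real.cos_add, s1, s2]
      linear_combination Real.sin_sq_add_cos_sq (φ - 2 * d)
    have hz0 : (φ' - 2 * d) + (φ - 2 * d) = 0 := by
      refine (Real.cos_eq_one_iff_of_lt_of_lt ?_ ?_).1 hc1 <;> linarith [Real.pi_gt_three]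
    have hd : d ≠ 0 := by linarith
    field_simp
    linarith
  rw [arcTime_mirror] at key
  linarith

/-- The direction τ makes the angle π/2 - β with the vertical axis, and the second summand is the
angle of z relative to τ. -/
theorem arctan_frame (hs : 0 < Real.sin β) (hβ0 : 0 < β) (hβ : β < Real.pi / 2) {z : ℝ × ℝ}
    (hy : 0 < z.2) (ht : 0 < tangentCoord β z) :
    Real.arctan (z.1 / z.2) =
      (Real.pi / 2 - β) + Real.arctan ((1 + radialCoord β z) / tangentCoord β z) := by
  have hc : 0 < Real.cos β := Real.cos_pos_of_mem_Ioo ⟨by linarith, hβ⟩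
  have h1 : Real.pi / 2 - β = Real.arctan (Real.cos β / Real.sin β) := by
    have e : Real.cos β / Real.sin β = (Real.tan β)⁻¹ := by
      rw [Real.tan_eq_sin_div_cos, inv_div]
    rw [e, Real.arctan_inv_of_pos (Real.tan_pos_of_pos_of_lt_pi_div_two hβ0 hβ),
      Real.arctan_tan (by linarith) hβ]
  have e1 := fst_eq_frame β z
  have e2 := snd_eq_frame β z
  have hlt : Real.cos β / Real.sin β * ((1 + radialCoord β z) / tangentCoord β z) < 1 := by
    rw [div_mul_div_comm, div_lt_one (by positivity)]
    linarith
  rw [h1, Real.arctan_add hlt]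
  congr 1
  have hne : 1 - Real.cos β / Real.sin β * ((1 + radialCoord β z) / tangentCoord β z) ≠ 0 := by
    linarith
  rw [div_eq_div_iff hy.ne' hne, e1, e2]
  set u := radialCoord β z
  set t := tangentCoord β z
  field_simp
  ring

theorem snd_pos_of_radialCoord_neg (hs : 0 < Real.sin β) (hc : 0 < Real.cos β) {L : ℝ}
    (hL : Far β L) {z : ℝ × ℝ} (hz : L ^ 2 ≤ z.1 ^ 2 + z.2 ^ 2) (hy : -Real.cos β < z.2)
    (h1 : radialCoord β z < 0) (h2 : radialCoord β (mirror z) < 0) : 0 < z.2 := by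
  by_contra hneg
  rw [not_lt] at hneg
  obtain ⟨hL1, -⟩ := far_bounds hs hc hL
  have hL2 := hL.2
  have hc1 := Real.cos_le_one β
  unfold radialCoord at h1 h2
  simp only [mirror_fst, mirror_snd] at h2
  have hyc : z.2 * Real.cos β ≤ 0 := mul_nonpos_of_nonpos_of_nonneg hneg hc.le
  have hx : |z.1| * Real.sin β < 1 := by
    rcases abs_cases z.1 with h | h <;> rw [h.1] <;> linarith
  have hx' : |z.1| < L / 10 := by
    by_contra hge
    nlinarith
  have hx2 : z.1 ^ 2 ≤ (L / 10) ^ 2 := by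
    rw [← sq_abs]
    gcongr
  have hy2 : z.2 ^ 2 ≤ 1 := by nlinarith
  nlinarith

/-- A double step that leaves the right wedge ends in the thin zone -4 ≤ u < 0. There u is bounded
and t is comparable to the radius, so `transition_estimate` applies. -/
theorem wedge_arc_matching (hβ0 : 0 < β) (hβ : β < Real.pi / 2) {L : ℝ} (hL : Far β L)
    {z : ℝ × ℝ} (hz : L ^ 2 ≤ z.1 ^ 2 + z.2 ^ 2) (hy : -Real.cos β < z.2)
    (hu5 : -4 ≤ radialCoord β z) (hu : radialCoord β z < 0) :
    |wedgeInvariant β z - 2 * radius z| ≤ 100 / L ∧ |wedgeTime β z - arcTime z| ≤ 100 / L := by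
  have hs : 0 < Real.sin β := Real.sin_pos_of_pos_of_lt_pi hβ0 (by linarith)
  have hc : 0 < Real.cos β := Real.cos_pos_of_mem_Ioo ⟨by linarith, hβ⟩
  have hL2 := hL.2
  have hL0 : 0 < L := by linarith
  have h10 := (far_bounds hs hc hL).1
  have hc1 := Real.cos_le_one β
  have ht2 := (wedge_bounds hs hc hL hz hy (by linarith)).2
  have hfr := frame_sq β z
  have hsnd := snd_eq_frame β z
  have hfr' : radius z ^ 2 = (1 + radialCoord β z) ^ 2 + tangentCoord β z ^ 2 := by
    rw [hfr, radius, Real.sq_sqrt (by positivity)]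
  have hpos : 0 < z.2 → 0 < tangentCoord β z → Real.arctan (z.1 / z.2) =
    (Real.pi / 2 - β) + Real.arctan ((1 + radialCoord β z) / tangentCoord β z) :=
    arctan_frame hs hβ0 hβ
  have htr := fun h1 h2 h3 h4 => transition_estimate (θ := Real.pi / 2 - β)
    (u := radialCoord β z) (t := tangentCoord β z) h1 h2 h3 h4 (Real.sqrt_nonneg _)
    (Real.sq_sqrt (by positivity)) (Real.sqrt_nonneg _) hfr'
  unfold wedgeTime arcTime wedgeInvariant
  generalize radialCoord β z = u at *
  generalize tangentCoord β z = t at *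
  have htL : L / 2 ≤ t := by
    refine le_of_sq_le_sq ?_ (by linarith)
    have : (1 + u) ^ 2 ≤ 9 := by nlinarith
    rw [div_pow]
    nlinarith
  have hy0 : 0 < z.2 := by
    rw [hsnd]
    have g1 : L / 2 * Real.sin β ≤ t * Real.sin β := by gcongr
    have g2 : (1 + u) * Real.cos β ≤ 1 := by nlinarith
    linarith
  obtain ⟨t1, t2⟩ := htr (by linarith) (by linarith) (by linarith)
    (by rw [abs_le]; constructor <;> linarith)
  have h50 : 50 / t ≤ 100 / L := by
    rw [div_le_div_iff₀ (by linarith) hL0]; linarith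
  rw [hpos hy0 (by linarith)]
  exact ⟨t1.trans h50, t2.trans h50⟩

/-- Conclusion of the one step estimate. -/
def StepEstimate (β L : ℝ) (z z' : ℝ × ℝ) : Prop :=
  |upperInvariant β z' - upperInvariant β z| ≤
      200 / L ^ 2 + 100 / L * (upperSide β z - upperSide β z') ∧
    |upperTime β z' - upperTime β z + 1| ≤
      200 / L ^ 2 + 100 / L * (upperSide β z - upperSide β z') ∧
    upperSide β z' ≤ upperSide β z

/-- Within the wedge this is the estimate for the midpoint rule. If the step leaves the wedge, I and
T switch formula at a cost of 100 / L; this is charged to the decrease of `upperSide`, so it can be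
incurred only a bounded number of times along a passage. -/
theorem stepEstimate_wedge (hβ0 : 0 < β) (hβ : β < Real.pi / 2) {L : ℝ} (hL : Far β L)
    {z z' : ℝ × ℝ} (h : DoubleStep β z z') (hz : L ^ 2 ≤ z.1 ^ 2 + z.2 ^ 2)
    (hz' : L ^ 2 ≤ z'.1 ^ 2 + z'.2 ^ 2) (hy : -Real.cos β < z.2) (hy' : -Real.cos β < z'.2)
    (hu : 0 ≤ radialCoord β z) : StepEstimate β L z z' := by
  have hs : 0 < Real.sin β := Real.sin_pos_of_pos_of_lt_pi hβ0 (by linarith)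
  have hc : 0 < Real.cos β := Real.cos_pos_of_mem_Ioo ⟨by linarith, hβ⟩
  have hL2 := hL.2
  have hL0 : 0 < L := by linarith
  obtain ⟨l, a, b, hlL, ha, hab, e1, e2, e3, e4, -⟩ := h.wedge_param hs hc hL hz hy hu
  have hl0 : 0 < l := by linarith
  have hb : |(Real.pi / 2 - β) / 8| ≤ 1 / 4 := by
    rw [abs_le]; constructor <;> linarith [Real.pi_le_four]
  obtain ⟨w1, w2⟩ := wedge_step_estimate (by linarith) ha hab hb e1 e2 e3 e4
    (I := wedgeInvariant β z) (I' := wedgeInvariant β z') rfl rfl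
  have hll : ∀ k : ℝ, 0 ≤ k → k / l ^ 2 ≤ 4 * k / L ^ 2 := by
    intro k hk
    rw [div_le_div_iff₀ (by positivity) (by positivity)]
    have : L ^ 2 ≤ 4 * l ^ 2 := by nlinarith
    nlinarith
  have w1' : |wedgeInvariant β z' - wedgeInvariant β z| ≤ 200 / L ^ 2 := by
    refine w1.trans ((hll 16 (by norm_num)).trans ?_)
    gcongr; norm_num
  have w2' : |wedgeTime β z' - wedgeTime β z + 1| ≤ 200 / L ^ 2 := by
    have e : wedgeTime β z' - wedgeTime β z + 1 = ((Real.pi / 2 - β) / 8 * wedgeInvariant β z' +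
        exitTime (radialCoord β z') (wedgeInvariant β z')) -
        ((Real.pi / 2 - β) / 8 * wedgeInvariant β z +
        exitTime (radialCoord β z) (wedgeInvariant β z)) + 1 := by
      unfold wedgeTime
      ring
    rw [e]
    refine w2.trans ((hll 50 (by norm_num)).trans ?_)
    norm_num
  unfold StepEstimate
  by_cases hu' : 0 ≤ radialCoord β z'
  · simp only [upperInvariant, upperTime, upperSide, hu, hu', if_true, sub_self, mul_zero,
      add_zero, le_refl, and_true]
    exact ⟨w1', w2'⟩
  · have ha1 : a ≤ 1 := by nlinarith [sq_nonneg b]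
    -- u' = u - 2 (1 + a) with u ≥ 0 and a ≤ 1.
    have hu5 : -4 ≤ radialCoord β z' := by linarith
    have hum := radialCoord_mirror_neg hs hc hL hz' hy' (by linarith)
    simp only [upperInvariant, upperTime, upperSide, hu, hu', if_true, if_false, not_le.2 hum]
    rw [not_le] at hu'
    obtain ⟨t1', t2'⟩ := wedge_arc_matching hβ0 hβ hL hz' hy' hu5 hu'
    rw [sub_zero, mul_one]
    refine ⟨?_, ?_, zero_le_one⟩
    · have := abs_le.1 t1'
      have h' := abs_le.1 w1'
      rw [abs_le]; constructor <;> linarith [this.1, this.2, h'.1, h'.2]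
    · have := abs_le.1 t2'
      have h' := abs_le.1 w2'
      rw [abs_le]; constructor <;> linarith [this.1, this.2, h'.1, h'.2]

/-- Along a double step in the upper region, far from the origin, the invariant is almost
preserved and the time function decreases by almost one. -/
theorem stepEstimate (hβ0 : 0 < β) (hβ : β < Real.pi / 2) {L : ℝ} (hL : Far β L)
    {z z' : ℝ × ℝ} (h : DoubleStep β z z') (hz : L ^ 2 ≤ z.1 ^ 2 + z.2 ^ 2)
    (hz' : L ^ 2 ≤ z'.1 ^ 2 + z'.2 ^ 2) (hy : -Real.cos β < z.2) (hy' : -Real.cos β < z'.2) :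
    StepEstimate β L z z' := by
  have hs : 0 < Real.sin β := Real.sin_pos_of_pos_of_lt_pi hβ0 (by linarith)
  have hc : 0 < Real.cos β := Real.cos_pos_of_mem_Ioo ⟨by linarith, hβ⟩
  have hL2 := hL.2
  have hL0 : 0 < L := by linarith
  have hbig : (100 : ℝ) ^ 2 ≤ L ^ 2 := by gcongr
  rcases le_or_gt 0 (radialCoord β z) with hu | hu
  · exact stepEstimate_wedge hβ0 hβ hL h hz hz' hy hy' hu
  rcases le_or_gt 0 (radialCoord β (mirror z')) with hm | hm
  · have key := stepEstimate_wedge hβ0 hβ hL h.mirror_symm (by simpa using hz') (by simpa using hz)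
      (by simpa using hy') (by simpa using hy) hm
    obtain ⟨a1, a2, a3⟩ := upper_mirror hs hc hL hz hy
    obtain ⟨b1, b2, b3⟩ := upper_mirror hs hc hL hz' hy'
    unfold StepEstimate at key ⊢
    rw [a1, a2, a3, b1, b2, b3] at key
    obtain ⟨k1, k2, k3⟩ := key
    refine ⟨?_, ?_, by linarith⟩
    · rw [abs_sub_comm]
      convert k1 using 3
      ring
    · convert k2 using 2 <;> ring
  · have hu' := h.radialCoord_neg hs hc hL hz hz' hy hy' hu
    have hm' := h.mirror_symm.radialCoord_neg hs hc hL (by simpa using hz') (by simpa using hz)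
      (by simpa using hy') (by simpa using hy) hm
    have y0 := snd_pos_of_radialCoord_neg hs hc hL hz hy hu hm'
    have y0' := snd_pos_of_radialCoord_neg hs hc hL hz' hy' hu' hm
    obtain ⟨e1, e2⟩ := h.rotation hs hc (by linarith) (by linarith) hy hy' hu hm
    have hT := arcTime_step (by linarith) y0 y0' e1 e2
    have hR : radius z' = radius z := by rw [radius, e2, radius]
    unfold StepEstimate
    simp only [upperInvariant, upperTime, upperSide, not_le.2 hu, not_le.2 hu', not_le.2 hm,
      not_le.2 hm', if_false, hR, hT]
    have : 0 ≤ 200 / L ^ 2 := by positivity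
    simp [this]

end Invariants

/-! ### One passage through the upper region. -/

section Pass

variable {β : ℝ}

theorem radius_sq (z : ℝ × ℝ) : radius z ^ 2 = z.1 ^ 2 + z.2 ^ 2 := Real.sq_sqrt (by positivity)

theorem radius_nonneg (z : ℝ × ℝ) : 0 ≤ radius z := Real.sqrt_nonneg _

theorem abs_upperSide_le (z : ℝ × ℝ) : |upperSide β z| ≤ 1 := by
  unfold upperSide
  split_ifs <;> simp

theorem abs_exitTime_le {u q I : ℝ} (hu : |u| ≤ q) (hq : 0 < q) (hI : q ≤ I) :
    |exitTime u I| ≤ q / 3 := by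
  have hI0 : 0 < I := by linarith
  unfold exitTime
  have h1 : |u ^ 3 / (3 * I ^ 2)| ≤ q / 3 := by
    rw [abs_div, abs_pow, abs_of_pos (by positivity : 0 < 3 * I ^ 2),
      div_le_div_iff₀ (by positivity) (by norm_num)]
    calc |u| ^ 3 * 3 ≤ q ^ 3 * 3 := by gcongr
      _ = q * (3 * q ^ 2) := by ring
      _ ≤ q * (3 * I ^ 2) := by gcongr
  have h2 := abs_le.1 h1
  have h3 := abs_le.1 hu
  rw [abs_le]
  constructor <;> linarith [h2.1, h2.2, h3.1, h3.2]

/-- Size of the invariant and of the time function in the right wedge. -/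
theorem wedge_size (hβ0 : 0 < β) (hβ : β < Real.pi / 2) {L : ℝ} (hL : Far β L) {z : ℝ × ℝ}
    (hz : L ^ 2 ≤ z.1 ^ 2 + z.2 ^ 2) (hy : -Real.cos β < z.2) (hu : 0 ≤ radialCoord β z) :
    radius z / 2 ≤ wedgeInvariant β z ∧ wedgeInvariant β z ≤ 3 * radius z ∧
      |wedgeTime β z| ≤ 4 * wedgeInvariant β z := by
  have hs : 0 < Real.sin β := Real.sin_pos_of_pos_of_lt_pi hβ0 (by linarith)
  have hc : 0 < Real.cos β := Real.cos_pos_of_mem_Ioo ⟨by linarith, hβ⟩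
  have hL2 := hL.2
  have ht2 := (wedge_bounds hs hc hL hz hy (by linarith)).2
  have hfr := frame_sq β z
  have hr2 := radius_sq z
  have hr0 := radius_nonneg z
  have hrL : L ≤ radius z := le_of_sq_le_sq (by linarith) hr0
  unfold wedgeTime wedgeInvariant
  rw [← hr2] at hfr
  generalize radialCoord β z = u at *
  generalize tangentCoord β z = t at *
  have hq2 := Real.sq_sqrt (show 0 ≤ u ^ 2 + t ^ 2 by positivity)
  have hq0 := Real.sqrt_nonneg (u ^ 2 + t ^ 2)
  generalize Real.sqrt (u ^ 2 + t ^ 2) = q at *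
  generalize radius z = r at *
  have h1 : t ≤ q := le_of_sq_le_sq (by nlinarith) hq0
  have h1' : u ≤ q := le_of_sq_le_sq (by nlinarith) hq0
  have h2 : q ≤ r := le_of_sq_le_sq (by nlinarith) hr0
  have h3 : r ≤ q + 1 := le_of_sq_le_sq (by nlinarith) (by linarith)
  have h4 := abs_le.1 (abs_exitTime_le (u := u) (q := q) (I := q + t)
    (by rw [abs_of_nonneg hu]; exact h1') (by linarith) (by linarith))
  have h5 : 0 ≤ (Real.pi / 2 - β) / 8 * (q + t) :=
    mul_nonneg (by linarith) (by linarith)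
  have h6 : (Real.pi / 2 - β) / 8 * (q + t) ≤ 1 * (q + t) := by
    gcongr
    linarith [Real.pi_le_four]
  refine ⟨by linarith, by linarith, ?_⟩
  rw [abs_le]
  constructor <;> linarith [h4.1, h4.2]

/-- Size of the invariant and of the time function in the upper region. -/
theorem upper_size (hβ0 : 0 < β) (hβ : β < Real.pi / 2) {L : ℝ} (hL : Far β L) {z : ℝ × ℝ}
    (hz : L ^ 2 ≤ z.1 ^ 2 + z.2 ^ 2) (hy : -Real.cos β < z.2) :
    radius z / 2 ≤ upperInvariant β z ∧ upperInvariant β z ≤ 3 * radius z ∧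
      |upperTime β z| ≤ 4 * upperInvariant β z := by
  have hr0 := radius_nonneg z
  have hL2 := hL.2
  have hrL : L ≤ radius z := le_of_sq_le_sq (by rw [radius_sq]; exact hz) hr0
  unfold upperInvariant upperTime
  by_cases h1 : 0 ≤ radialCoord β z
  · simp only [h1, if_true]
    exact wedge_size hβ0 hβ hL hz hy h1
  · by_cases h2 : 0 ≤ radialCoord β (mirror z)
    · simp only [h1, h2, if_true, if_false, abs_neg]
      rw [← radius_mirror z]
      exact wedge_size hβ0 hβ hL (by simpa using hz) (by simpa using hy) h2
    · simp only [h1, h2, if_false]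
      refine ⟨by linarith, by linarith, ?_⟩
      have hr : 0 < radius z := by linarith
      obtain ⟨d1, -⟩ := arcsin_bounds (x := 1 / radius z) (by positivity) (by
        rw [div_le_div_iff₀ (by linarith) two_pos]; linarith)
      have d0 : 0 < 1 / radius z := by positivity
      have hat : |Real.arctan (z.1 / z.2)| ≤ 2 := by
        rw [abs_le]
        constructor <;> linarith [Real.arctan_lt_pi_div_two (z.1 / z.2),
          Real.neg_pi_div_two_lt_arctan (z.1 / z.2), Real.pi_le_four]
      unfold arcTime
      rw [abs_div, abs_of_pos (by linarith : 0 < 4 * Real.arcsin (1 / radius z)),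
        div_le_iff₀ (by linarith)]
      calc _ ≤ (2 : ℝ) := hat
        _ ≤ 4 * (2 * radius z) * (4 * (1 / radius z)) := by
            have : radius z ≠ 0 := by linarith
            field_simp
            norm_num
        _ ≤ _ := by gcongr

theorem DoubleStep.radius_le {z z' : ℝ × ℝ} (h : DoubleStep β z z') :
    radius z ≤ radius z' + 4 := by
  have hd := h.sub_sq_le
  have h1 := radius_sq z
  have h2 := radius_sq z'
  have h0 := radius_nonneg z'
  refine le_of_sq_le_sq ?_ (by linarith)
  have hcs : (z'.1 * (z.1 - z'.1) + z'.2 * (z.2 - z'.2)) ^ 2 ≤ (4 * radius z') ^ 2 := by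
    have : (z'.1 * (z.1 - z'.1) + z'.2 * (z.2 - z'.2)) ^ 2 ≤
        (z'.1 ^ 2 + z'.2 ^ 2) * ((z'.1 - z.1) ^ 2 + (z'.2 - z.2) ^ 2) := by
      nlinarith [sq_nonneg (z'.1 * (z.2 - z'.2) - z'.2 * (z.1 - z'.1))]
    rw [mul_pow, h2]
    nlinarith [sq_nonneg z'.1, sq_nonneg z'.2]
  have h3 := le_of_sq_le_sq hcs (by linarith)
  nlinarith

/-- Accumulated drift along double steps in the upper region. -/
theorem pass_drift (hβ0 : 0 < β) (hβ : β < Real.pi / 2) {z : ℕ → ℝ × ℝ}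
    (hz : ∀ k, DoubleStep β (z k) (z (k + 1))) {I₀ : ℝ} (hI : upperInvariant β (z 0) = I₀)
    (hI₀ : 4000 ≤ I₀) (hL : Far β (I₀ / 8)) (h0 : (I₀ / 8) ^ 2 ≤ (z 0).1 ^ 2 + (z 0).2 ^ 2)
    (k : ℕ) (hup : ∀ j ≤ k, -Real.cos β < (z j).2) (hk : (k : ℝ) ≤ 20 * I₀) :
    (I₀ / 8) ^ 2 ≤ (z k).1 ^ 2 + (z k).2 ^ 2 ∧
      |upperInvariant β (z k) - I₀| ≤ 300000 / I₀ ∧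
      |upperTime β (z k) - upperTime β (z 0) + k| ≤ 300000 / I₀ := by
  have hI0 : 0 < I₀ := by linarith
  have hside : ∀ k, upperSide β (z 0) - upperSide β (z k) ≤ 2 := fun k => by
    linarith [(abs_le.1 (abs_upperSide_le (β := β) (z 0))).2,
      (abs_le.1 (abs_upperSide_le (β := β) (z k))).1]
  -- With L = I₀ / 8 there are at most 20 I₀ errors of size 200 / L², while the switching cost
  -- telescopes to at most 2 · 100 / L.
  have hbound : ∀ k : ℕ, (k : ℝ) ≤ 20 * I₀ → (k : ℝ) * (200 / (I₀ / 8) ^ 2) +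
      100 / (I₀ / 8) * (upperSide β (z 0) - upperSide β (z k)) ≤ 300000 / I₀ := by
    intro k hk
    calc _ ≤ (20 * I₀) * (200 / (I₀ / 8) ^ 2) + 100 / (I₀ / 8) * 2 := by
          gcongr
          exact hside k
      _ = 257600 / I₀ := by field_simp; norm_num
      _ ≤ _ := by gcongr; norm_num
  have main : ∀ k : ℕ, (∀ j ≤ k, -Real.cos β < (z j).2) → (k : ℝ) ≤ 20 * I₀ →
      (I₀ / 8) ^ 2 ≤ (z k).1 ^ 2 + (z k).2 ^ 2 ∧
      |upperInvariant β (z k) - I₀| ≤ (k : ℝ) * (200 / (I₀ / 8) ^ 2) +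
        100 / (I₀ / 8) * (upperSide β (z 0) - upperSide β (z k)) ∧
      |upperTime β (z k) - upperTime β (z 0) + k| ≤ (k : ℝ) * (200 / (I₀ / 8) ^ 2) +
        100 / (I₀ / 8) * (upperSide β (z 0) - upperSide β (z k)) := by
    intro k
    induction k with
    | zero => intro _ _; simp [hI, h0]
    | succ k ih =>
      intro hup hk
      push_cast at hk
      obtain ⟨i1, i2, i3⟩ := ih (fun j hj => hup j (by omega)) (by linarith)
      have hI3 := abs_le.1 (i2.trans (hbound k (by linarith)))
      have hsm : 300000 / I₀ ≤ I₀ / 4 := by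
        rw [div_le_iff₀ hI0]; nlinarith
      have hsz := (upper_size hβ0 hβ hL i1 (hup k (by omega))).2.1
      have hr := (hz k).radius_le
      -- The invariant is still at least 3 I₀ / 4, so the radius is at least I₀ / 4, and a double
      -- step reduces it by at most 4.
      have hr' : I₀ / 8 ≤ radius (z (k + 1)) := by linarith [hI3.1]
      have hr2 : (I₀ / 8) ^ 2 ≤ (z (k + 1)).1 ^ 2 + (z (k + 1)).2 ^ 2 := by
        rw [← radius_sq]; gcongr
      obtain ⟨s1, s2, -⟩ := stepEstimate hβ0 hβ hL (hz k) i1 hr2 (hup k (by omega))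
        (hup (k + 1) le_rfl)
      refine ⟨hr2, ?_, ?_⟩
      · push_cast
        have a1 := abs_le.1 s1
        have a2 := abs_le.1 i2
        rw [abs_le]
        constructor <;> linarith [a1.1, a1.2, a2.1, a2.2]
      · push_cast
        have a1 := abs_le.1 s2
        have a2 := abs_le.1 i3
        rw [abs_le]
        constructor <;> linarith [a1.1, a1.2, a2.1, a2.2]
  obtain ⟨m1, m2, m3⟩ := main k hup hk
  exact ⟨m1, m2.trans (hbound k hk), m3.trans (hbound k hk)⟩

/-- An orbit that enters the upper region leaves it after finitely many double steps. -/
theorem pass_exit (hβ0 : 0 < β) (hβ : β < Real.pi / 2) {z : ℕ → ℝ × ℝ}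
    (hz : ∀ k, DoubleStep β (z k) (z (k + 1))) {I₀ : ℝ} (hI : upperInvariant β (z 0) = I₀)
    (hI₀ : 4000 ≤ I₀) (hL : Far β (I₀ / 8)) (h0 : (I₀ / 8) ^ 2 ≤ (z 0).1 ^ 2 + (z 0).2 ^ 2)
    (hup : -Real.cos β < (z 0).2) :
    ∃ k : ℕ, (k : ℝ) ≤ 20 * I₀ ∧ (∀ j ≤ k, -Real.cos β < (z j).2) ∧
      (z (k + 1)).2 ≤ -Real.cos β := by
  classical
  have hex : ∃ k : ℕ, (k : ℝ) ≤ 20 * I₀ ∧ (z (k + 1)).2 ≤ -Real.cos β := by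
    by_contra hne
    push Not at hne
    have hup' : ∀ j : ℕ, (j : ℝ) ≤ 20 * I₀ → -Real.cos β < (z j).2 := by
      intro j hj
      cases j with
      | zero => exact hup
      | succ j => exact hne j (by push_cast at hj; linarith)
    have hK := Nat.floor_le (show 0 ≤ 20 * I₀ by linarith)
    have hK' := Nat.lt_floor_add_one (20 * I₀)
    set K := ⌊20 * I₀⌋₊
    have hupK : ∀ j ≤ K, -Real.cos β < (z j).2 := fun j hj => hup' j (by
      have : (j : ℝ) ≤ K := by exact_mod_cast hj
      linarith)
    -- T starts at most at 4 I₀ and, as |T| ≤ 4 I, cannot fall below -5 I₀; losing about one per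
    -- double step for 20 I₀ steps is impossible.
    obtain ⟨m1, m2, m3⟩ := pass_drift hβ0 hβ hz hI hI₀ hL h0 K hupK hK
    have hsm : 300000 / I₀ ≤ I₀ / 4 := by
      rw [div_le_iff₀ (by linarith)]; nlinarith
    have v0 := (abs_le.1 (upper_size hβ0 hβ hL h0 hup).2.2).2
    have vK := (abs_le.1 (upper_size hβ0 hβ hL m1 (hupK K le_rfl)).2.2).1
    rw [hI] at v0
    have a2 := (abs_le.1 (m2.trans hsm)).2
    have a3 := (abs_le.1 (m3.trans hsm)).2
    linarith
  refine ⟨Nat.find hex, (Nat.find_spec hex).1, fun j hj => ?_, (Nat.find_spec hex).2⟩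
  cases j with
  | zero => exact hup
  | succ j =>
    have h1 := Nat.find_min hex (show j < Nat.find hex by omega)
    rw [not_and, not_le] at h1
    refine h1 (le_trans ?_ (Nat.find_spec hex).1)
    exact_mod_cast (by omega : j ≤ Nat.find hex)

/-- The upper region is left near the negative horizontal axis. -/
theorem exit_position (hβ0 : 0 < β) (hβ : β < Real.pi / 2) {L : ℝ} (hL : Far β L)
    {z z' : ℝ × ℝ} (h : DoubleStep β z z') (hz : L ^ 2 ≤ z.1 ^ 2 + z.2 ^ 2)
    (hy : -Real.cos β < z.2) (hy' : z'.2 ≤ -Real.cos β) : z.1 ≤ -(L / 2) ∧ z.2 ≤ 4 := by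
  have hs : 0 < Real.sin β := Real.sin_pos_of_pos_of_lt_pi hβ0 (by linarith)
  have hc : 0 < Real.cos β := Real.cos_pos_of_mem_Ioo ⟨by linarith, hβ⟩
  have hc1 := Real.cos_le_one β
  have hL2 := hL.2
  have h10 := (far_bounds hs hc hL).1
  have hd := h.sub_sq_le
  have hy4 : z.2 ≤ 4 := by
    have : (z.2 - z'.2) ^ 2 ≤ 4 ^ 2 := by nlinarith [sq_nonneg (z'.1 - z.1)]
    have := le_of_sq_le_sq this (by norm_num)
    linarith
  refine ⟨?_, hy4⟩
  -- In the right wedge a double step does not lower the ordinate, so the exit cannot happen there.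
  have hu : radialCoord β z < 0 := by
    by_contra hu
    obtain ⟨_, _, _, _, _, _, _, _, _, _, h9⟩ := h.wedge_param hs hc hL hz hy (not_lt.1 hu)
    linarith
  unfold radialCoord at hu
  have h5 : z.1 * Real.sin β < 5 := by nlinarith
  have h6 : z.1 < L / 2 := by
    by_contra hge
    nlinarith
  by_contra hneg
  rw [not_le] at hneg
  have h7 : z.1 ^ 2 ≤ (L / 2) ^ 2 := sq_le_sq.2 (by
    rw [abs_of_pos (by linarith : 0 < L / 2), abs_le]
    constructor <;> linarith)
  nlinarith

/-- The contact point has ordinate at least -cos β, so both points would lie on the chord line; that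
line meets the sector in the whole chord, not in one point. -/
theorem OuterBilliardStep.chord_exclusion (hs : 0 < Real.sin β) {z w : ℝ × ℝ}
    (h : OuterBilliardStep (circularSector β) z w) (hz : z.2 ≤ -Real.cos β)
    (hw : w.2 ≤ -Real.cos β) : False := by
  have h1 := h.add_sq_le.2
  rw [outerBilliardStep_iff_contact] at h
  have hz' : z.2 = -Real.cos β := by linarith
  have hw' : w.2 = -Real.cos β := by linarith
  obtain ⟨-, -, h3⟩ := h
  have hsc := Real.sin_sq_add_cos_sq β
  have hv : ∀ x : ℝ, x ^ 2 = Real.sin β ^ 2 → (x, -Real.cos β) ∈ circularSector β := fun x hx =>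
    ⟨by simp only [hx, neg_sq, hsc, le_refl], le_rfl⟩
  have key : ∀ x : ℝ, x ^ 2 = Real.sin β ^ 2 → x = (z.1 + w.1) / 2 := by
    intro x hx
    by_contra hne
    have := h3 _ (hv x hx) fun he => hne (congrArg Prod.fst he)
    simp only [hz', hw'] at this
    ring_nf at this
    linarith
  have k1 := key (Real.sin β) rfl
  have k2 := key (-Real.sin β) (by ring)
  linarith

/-- The arc step from the left end of the upper region to the strip at the positive axis. -/
theorem arcMap_left {x y : ℝ} (hx : 100 ≤ x) (hy : |y| ≤ 4) :
    |(arcMap (-x, y)).1 - x| ≤ 10 / x ∧ |(arcMap (-x, y)).2 - (2 - y)| ≤ 40 / x := by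
  have hx0 : 0 < x := by linarith
  have hy2 : y ^ 2 ≤ 16 := by
    have : y ^ 2 ≤ 4 ^ 2 := sq_le_sq.2 (by rwa [abs_of_pos (by norm_num : (0 : ℝ) < 4)])
    linarith
  rw [arcMap_eq]
  simp only [neg_sq]
  have hs : x ^ 2 ≤ x ^ 2 + y ^ 2 := by nlinarith
  have hl2 := Real.sq_sqrt (show 0 ≤ x ^ 2 + y ^ 2 - 1 by nlinarith)
  have hl0 := Real.sqrt_nonneg (x ^ 2 + y ^ 2 - 1)
  set s := x ^ 2 + y ^ 2 with hsd
  set l := Real.sqrt (s - 1)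
  have hs0 : 0 < s := by nlinarith
  have hls : l * x ≤ s := by nlinarith [sq_nonneg (l - x)]
  have hls2 : s - 16 ≤ l * x := by
    rcases le_total l x with h | h <;> nlinarith
  have hl1 : l ≤ 2 * x := by
    refine le_of_sq_le_sq ?_ (by linarith)
    nlinarith
  have hy' := abs_le.1 hy
  have hlx : l / s * x ≤ 2 := by
    rw [div_mul_eq_mul_div, div_le_iff₀ hs0]; linarith
  have i1 : x / s ≤ 1 / x := by rw [div_le_div_iff₀ hs0 hx0]; nlinarith
  have i2 : l / s * 4 ≤ 8 / x := by
    rw [div_mul_eq_mul_div, div_le_div_iff₀ hs0 hx0]; nlinarith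
  have i2' : l / s ≤ 1 / x := by
    rw [div_le_div_iff₀ hs0 hx0]; linarith
  have hls0 : 0 ≤ l / s := by positivity
  constructor
  · have e : (2 / s - 1) * -x + 2 * l / s * y - x = -2 * (x / s) + 2 * (l / s * y) := by ring
    rw [e]
    have h1 : |l / s * y| ≤ 4 / x := by
      rw [abs_mul, abs_of_nonneg hls0]
      calc _ ≤ 1 / x * 4 := by gcongr
        _ = 4 / x := by ring
    have h1' := abs_le.1 h1
    have h0 : 0 ≤ x / s := by positivity
    have : 10 / x = 2 * (1 / x) + 2 * (4 / x) := by ring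
    rw [abs_le]
    constructor <;> linarith [h1'.1, h1'.2]
  · have e : (2 / s - 1) * y - 2 * l / s * -x - (2 - y) = 2 * (y / s) - 2 * ((s - l * x) / s) := by
      field_simp
      ring
    rw [e]
    have i3 : 1 / s ≤ 1 / (100 * x) := by gcongr; nlinarith
    have h1 : |y / s| ≤ 4 / (100 * x) := by
      rw [abs_div, abs_of_pos hs0]
      calc |y| / s ≤ 4 / s := by gcongr
        _ = 4 * (1 / s) := by ring
        _ ≤ 4 * (1 / (100 * x)) := by gcongr
        _ = _ := by ring
    have h2 : (s - l * x) / s ≤ 16 / (100 * x) := by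
      calc (s - l * x) / s ≤ 16 / s := by gcongr; linarith
        _ = 16 * (1 / s) := by ring
        _ ≤ 16 * (1 / (100 * x)) := by gcongr
        _ = _ := by ring
    have h3 : 0 ≤ (s - l * x) / s := div_nonneg (by linarith) hs0.le
    have h1' := abs_le.1 h1
    have e4 : 4 / (100 * x) = (4 / 100) * (1 / x) := by field_simp
    have e5 : 16 / (100 * x) = (16 / 100) * (1 / x) := by field_simp
    have e6 : 40 / x = 40 * (1 / x) := by ring
    have hp : 0 < 1 / x := by positivity
    rw [e4] at h1'
    rw [e5] at h2
    rw [e6, abs_le]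
    constructor <;> linarith [h1'.1, h1'.2]

/-- Passage of an orbit through the upper region: from `z = u n` it reaches, after `2 k` steps, a
point near the negative axis whose mirror image `a` has almost the same invariant as `z`, and next a
point `w` near the positive axis. -/
theorem exists_pass (hβ0 : 0 < β) (hβ : β < Real.pi / 2) :
    ∃ ρ : ℝ, 1 ≤ ρ ∧ ∀ u : ℕ → ℝ × ℝ,
      (∀ n, OuterBilliardStep (circularSector β) (u n) (u (n + 1))) → ∀ n,
      -Real.cos β < (u n).2 → ρ ≤ radius (u n) →
      ∃ (k : ℕ) (a : ℝ × ℝ), radius (u n) / 32 ≤ a.1 ∧ -Real.cos β < a.2 ∧ a.2 ≤ 4 ∧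
        |upperInvariant β a - upperInvariant β (u n)| ≤ 600000 / radius (u n) ∧
        |upperTime β (u n) + upperTime β a - k| ≤ 600000 / radius (u n) ∧
        -Real.cos β < (u (n + 2 * k + 1)).2 ∧
        |(u (n + 2 * k + 1)).1 - a.1| ≤ 10 / a.1 ∧
        |(u (n + 2 * k + 1)).2 - (2 - a.2)| ≤ 40 / a.1 := by
  have hs : 0 < Real.sin β := Real.sin_pos_of_pos_of_lt_pi hβ0 (by linarith)
  have hc : 0 < Real.cos β := Real.cos_pos_of_mem_Ioo ⟨by linarith, hβ⟩
  have hsc : 0 < Real.sin β * Real.cos β := by positivity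
  -- As I₀ ≥ r / 2, the first term gives I₀ ≥ 4000, and the second makes I₀ / 8 ≥ r / 16 large
  -- enough for `Far`.
  refine ⟨8000 + 160 / (Real.sin β * Real.cos β), by
    have : 0 < 160 / (Real.sin β * Real.cos β) := by positivity
    linarith, fun u hu n hy hr => ?_⟩
  have hfar : ∀ L, 10 / (Real.sin β * Real.cos β) ≤ L → 100 ≤ L → Far β L := fun L h1 h2 =>
    ⟨by rwa [div_le_iff₀ hsc] at h1, h2⟩
  have hq : 160 / (Real.sin β * Real.cos β) = 16 * (10 / (Real.sin β * Real.cos β)) := by ring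
  have hq0 : 0 < 10 / (Real.sin β * Real.cos β) := by positivity
  set r := radius (u n) with hrd
  have hr2 := radius_sq (u n)
  have hr0 : 0 < r := by linarith
  obtain ⟨s1, s2, -⟩ := upper_size hβ0 hβ (hfar r (by linarith) (by linarith)) hr2.le hy
  set I₀ := upperInvariant β (u n) with hI0d
  have hI : 4000 ≤ I₀ := by linarith
  have hL : Far β (I₀ / 8) := hfar _ (by linarith) (by linarith)
  have hstart : (I₀ / 8) ^ 2 ≤ (u n).1 ^ 2 + (u n).2 ^ 2 := by
    rw [← hr2]
    have : I₀ / 8 ≤ r := by linarith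
    gcongr
  set z : ℕ → ℝ × ℝ := fun k => u (n + 2 * k)
  have hz : ∀ k, DoubleStep β (z k) (z (k + 1)) := fun k => ⟨u (n + 2 * k + 1), hu _, hu _⟩
  obtain ⟨k, hk, hup, hexit⟩ := pass_exit hβ0 hβ hz (hI0d.symm) hI hL hstart hy
  obtain ⟨m1, m2, m3⟩ := pass_drift hβ0 hβ hz (hI0d.symm) hI hL hstart k hup hk
  obtain ⟨x1, x2⟩ := exit_position hβ0 hβ hL (hz k) m1 (hup k le_rfl) hexit
  obtain ⟨c1, c2, -⟩ := upper_mirror hs hc hL m1 (hup k le_rfl)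
  have hbd : 300000 / I₀ ≤ 600000 / r := by
    rw [div_le_div_iff₀ (by linarith) hr0]; linarith
  have hstep : OuterBilliardStep (circularSector β) (z k) (u (n + 2 * k + 1)) := hu _
  have hstep' : OuterBilliardStep (circularSector β) (u (n + 2 * k + 1)) (z (k + 1)) := hu _
  have hcos1 := Real.cos_le_one β
  have hycos := hup k le_rfl
  have hw : u (n + 2 * k + 1) = arcMap (-(mirror (z k)).1, (mirror (z k)).2) := by
    have hcL := (far_bounds hs hc hL).2
    have hsz : (I₀ / 8) ^ 2 ≤ (z k).1 ^ 2 + (z k).2 ^ 2 := m1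
    have hcon : Contact (circularSector β) (z k) (tangencyPoint (z k)) := by
      refine contact_arc_of_fst_nonpos (by linarith) ?_ ?_
      · have : Real.cos β * (I₀ / 8) ^ 2 ≤ Real.cos β * ((z k).1 ^ 2 + (z k).2 ^ 2) := by gcongr
        nlinarith
      · have : Real.cos β ^ 2 * (I₀ / 8) ^ 2 ≤ Real.cos β ^ 2 * ((z k).1 ^ 2 + (z k).2 ^ 2) := by
          gcongr
        nlinarith
    rw [hcon.step_eq hstep, mirror_fst, mirror_snd, neg_neg]
    rfl
  have hl := arcMap_left (x := (mirror (z k)).1) (y := (mirror (z k)).2)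
    (by rw [mirror_fst]; linarith) (by
      rw [mirror_snd, abs_le]; constructor <;> linarith)
  refine ⟨k, mirror (z k), by rw [mirror_fst]; linarith, hup k le_rfl, x2, ?_, ?_, ?_, ?_, ?_⟩
  · rw [c1]
    exact m2.trans hbd
  · rw [c2, ← abs_neg]
    refine le_trans (le_of_eq ?_) (m3.trans hbd)
    congr 1
    simp only [z]
    ring_nf
  · by_contra hneg
    exact hstep'.chord_exclusion hs (not_lt.1 hneg) hexit
  · rw [hw]; exact hl.1
  · rw [hw]; exact hl.2

end Pass

/-! ### Action and phase on the strip, and the passage map in these coordinates. -/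

section ReturnMap

variable {β : ℝ}

theorem exitTime_remainder {T I e x : ℝ} (hT0 : 0 ≤ T) (hT1 : T ≤ 1) (hx : 1000 ≤ x)
    (hIx : x / 2 ≤ I) (he6 : |e| ≤ 6) :
    |T * e ^ 2 / I| ≤ 72 / x ∧ |e ^ 3 / (3 * I ^ 2)| ≤ 72 / x := by
  have hx0 : 0 < x := by linarith
  have hI0 : 0 < I := by linarith
  constructor
  · rw [abs_of_nonneg (by positivity), div_le_div_iff₀ hI0 hx0]
    have h1 : e ^ 2 ≤ 6 ^ 2 := by rw [← sq_abs]; gcongr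
    calc T * e ^ 2 * x ≤ 1 * 6 ^ 2 * x := by gcongr
      _ ≤ 72 * I := by linarith
  · rw [abs_div, abs_pow, abs_of_pos (by positivity : 0 < 3 * I ^ 2),
      div_le_div_iff₀ (by positivity) hx0]
    have h1 : |e| ^ 3 ≤ 6 ^ 3 := by gcongr
    have h2 : (x / 2) ^ 2 ≤ I ^ 2 := by gcongr
    have h3 : 1000 * x ≤ x * x := by gcongr
    calc |e| ^ 3 * x ≤ 6 ^ 3 * x := by gcongr
      _ ≤ 72 * (3 * I ^ 2) := by linarith [div_pow x 2 2, sq x]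

/-- Here q is the distance from (x, y) to the corner (s, -c), so q ≈ x - s and q + t ≈ (1 + c) x.
Thus u = T (q + t) + e with e bounded and e ≈ -(y + c). Expanding the cubic `exitTime` about T (q +
t) leaves the linear term (1 + T²) e / 4, where 1 + T² = 2 / (1 + c), and a remainder of order 1/x.
-/
theorem strip_estimate {s c T x y u t q : ℝ} (hs : 0 < s) (hc : 0 < c) (hsc : s ^ 2 + c ^ 2 = 1)
    (hT : T * (1 + c) = s) (hx : 1000 ≤ x) (hy1 : -1 ≤ y) (hy2 : y ≤ 4)
    (hu : u = x * s - y * c - 1) (ht : t = x * c + y * s) (hq0 : 0 ≤ q)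
    (hq : q ^ 2 = u ^ 2 + t ^ 2) :
    |(q + t) - ((1 + c) * x + s * y - s)| ≤ 25 / x ∧
    |exitTime u (q + t) - ((T + T ^ 3 / 3) / 4 * (q + t) - (y + c) / (2 * (1 + c)))| ≤ 100 / x := by
  have hs1 : s ≤ 1 := by nlinarith
  have hc1 : c ≤ 1 := by nlinarith
  have hx0 : 0 < x := by linarith
  have hT0 : 0 < T := by
    by_contra h
    nlinarith
  have hT1 : T ≤ 1 := by
    by_contra h
    nlinarith
  have hTs : T * s = 1 - c := by
    have : (T * s - (1 - c)) * (1 + c) = 0 := by linear_combination s * hT + hsc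
    have := (mul_eq_zero.1 this).resolve_right (by linarith)
    linarith
  have hT2 : (1 + T ^ 2) * (1 + c) = 2 := by linear_combination T * hT + hTs
  have hq' : q ^ 2 = (x - s) ^ 2 + (y + c) ^ 2 := by
    rw [hq, hu, ht]; linear_combination (x ^ 2 + y ^ 2 - 1) * hsc
  have hyc0 : 0 ≤ (y + c) ^ 2 := sq_nonneg _
  have hyc : (y + c) ^ 2 ≤ 25 := by nlinarith
  have hq1 : x - s ≤ q := le_of_sq_le_sq (by linarith) hq0
  set η := q - (x - s) with hη
  have hη0 : 0 ≤ η := by linarith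
  have hηx : η ≤ 25 / x := by
    rw [le_div_iff₀ hx0]
    have h1 : η * (q + (x - s)) = (y + c) ^ 2 := by rw [hη]; linear_combination hq'
    have h2 : η * x ≤ η * (q + (x - s)) := by gcongr; linarith
    linarith
  have hη1 : η ≤ 1 := by
    refine hηx.trans ?_
    rw [div_le_one hx0]; linarith
  set I := q + t with hI
  have hIe : I = (1 + c) * x + s * y - s + η := by rw [hI, hη, ht]; ring
  refine ⟨by rw [hIe, add_sub_cancel_left, abs_of_nonneg hη0]; exact hηx, ?_⟩
  have hIx : x / 2 ≤ I := by rw [hIe]; nlinarith [mul_pos hc hx0]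
  have hI0 : 0 < I := by linarith
  set e := u - T * I with he
  have hee : e = -(y + c) - T * η := by
    rw [he, hu, hIe]; linear_combination -x * hT + (1 - y) * hTs
  have he6 : |e| ≤ 6 := by
    have : T * η ≤ 1 := by nlinarith
    have : 0 ≤ T * η := by positivity
    rw [hee, abs_le]; constructor <;> linarith
  have hue : u = T * I + e := by rw [he]; ring
  have hquart : (1 + T ^ 2) / 4 = 1 / (2 * (1 + c)) := by
    rw [div_eq_div_iff (by norm_num) (by linarith)]
    linear_combination 2 * hT2
  have main : exitTime u I - ((T + T ^ 3 / 3) / 4 * I - (y + c) / (2 * (1 + c))) =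
      -((1 + T ^ 2) / 4 * (T * η)) + (T * e ^ 2 / I) / 4 + (e ^ 3 / (3 * I ^ 2)) / 4 := by
    have h1 : (y + c) / (2 * (1 + c)) = (1 + T ^ 2) / 4 * (y + c) := by rw [hquart]; ring
    have h2 : u ^ 3 / (3 * I ^ 2) = T ^ 3 * I / 3 + T ^ 2 * e + T * e ^ 2 / I +
        e ^ 3 / (3 * I ^ 2) := by
      rw [hue]; field_simp; ring
    unfold exitTime
    rw [h1, h2]
    linear_combination (1 / 4) * hue + (1 + T ^ 2) / 4 * hee
  rw [main]
  have b1 : |(1 + T ^ 2) / 4 * (T * η)| ≤ 25 / x := by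
    rw [abs_of_nonneg (by positivity)]
    have : (1 + T ^ 2) / 4 ≤ 1 := by nlinarith
    calc _ ≤ 1 * (1 * (25 / x)) := by gcongr
      _ = _ := by ring
  obtain ⟨b2, b3⟩ := exitTime_remainder hT0.le hT1 hx hIx he6
  clear_value e I η
  have p1 := abs_le.1 b1
  have p2 := abs_le.1 b2
  have p3 := abs_le.1 b3
  have e1 : 25 / x = 25 * (1 / x) := by ring
  have e2 : 72 / x = 72 * (1 / x) := by ring
  have e3 : 100 / x = 100 * (1 / x) := by ring
  have hp : 0 < 1 / x := by positivity
  rw [e1] at p1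
  rw [e2] at p2 p3
  rw [e3, abs_le]
  constructor <;> linarith [p1.1, p1.2, p2.1, p2.2, p3.1, p3.2]

/-- The half strip along the positive axis in which the return map is considered. -/
def strip (β : ℝ) : Set (ℝ × ℝ) := {z | 0 < z.1 ∧ -Real.cos β < z.2 ∧ z.2 ≤ 4}

/-- The second factor of `shearConstant β`. -/
noncomputable def shearFactor (β : ℝ) : ℝ :=
  (Real.pi - 2 * β) / 4 + Real.tan (β / 2) ^ 3 / 3 + Real.tan (β / 2)

/-- The leading part of the almost invariant in the strip. -/
noncomputable def linearInvariant (β : ℝ) (z : ℝ × ℝ) : ℝ :=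
  (1 + Real.cos β) * z.1 + Real.sin β * z.2 - Real.sin β

/-- The action coordinate in the strip. -/
noncomputable def action (β : ℝ) (z : ℝ × ℝ) : ℝ :=
  shearFactor β / 2 * linearInvariant β z - 1 / 2

/-- The phase coordinate in the strip. -/
noncomputable def phase (β : ℝ) (z : ℝ × ℝ) : ℝ := (z.2 - 1) / (2 * (1 + Real.cos β))

theorem tan_half_mul (hβ0 : 0 < β) (hβ : β < Real.pi / 2) :
    Real.tan (β / 2) * (1 + Real.cos β) = Real.sin β := by
  have hc : 0 < Real.cos (β / 2) := Real.cos_pos_of_mem_Ioo ⟨by linarith, by linarith⟩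
  have h1 : Real.sin β = 2 * Real.sin (β / 2) * Real.cos (β / 2) := by
    rw [← Real.sin_two_mul]; ring_nf
  have h2 : Real.cos β = 2 * Real.cos (β / 2) ^ 2 - 1 := by
    rw [← Real.cos_two_mul]; ring_nf
  rw [h1, h2, Real.tan_eq_sin_div_cos]
  field_simp
  ring

theorem shearFactor_bounds (hβ0 : 0 < β) (hβ : β < Real.pi / 2) :
    0 < shearFactor β ∧ shearFactor β ≤ 4 := by
  have hc : 0 < Real.cos β := Real.cos_pos_of_mem_Ioo ⟨by linarith, hβ⟩
  have hs : 0 < Real.sin β := Real.sin_pos_of_pos_of_lt_pi hβ0 (by linarith)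
  have hs1 := Real.sin_le_one β
  have hT := tan_half_mul hβ0 hβ
  unfold shearFactor
  set T := Real.tan (β / 2)
  have hT0 : 0 < T := by
    by_contra h
    nlinarith
  have hT1 : T ≤ 1 := by
    by_contra h
    nlinarith
  have hT3 : T ^ 3 ≤ 1 := pow_le_one₀ hT0.le hT1
  have hT3' : 0 < T ^ 3 := by positivity
  have := Real.pi_le_four
  constructor <;> linarith

/-- The time is affine in invariant and ordinate, with slope in I equal to a quarter of
`shearFactor`: (π - 2β)/4 comes from the rotation sector and tan³(β/2)/3 + tan(β/2) from the wedge.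
-/
theorem strip_asymptotics (hβ0 : 0 < β) (hβ : β < Real.pi / 2) {z : ℝ × ℝ}
    (hx : 1000 ≤ z.1) (hx' : 10 ≤ z.1 * Real.sin β) (hy : -Real.cos β < z.2) (hy4 : z.2 ≤ 4) :
    |upperInvariant β z - linearInvariant β z| ≤ 100 / z.1 ∧
      |upperTime β z - (shearFactor β / 4 * upperInvariant β z - phase β z - 1 / 4)| ≤
        100 / z.1 := by
  have hs : 0 < Real.sin β := Real.sin_pos_of_pos_of_lt_pi hβ0 (by linarith)
  have hc : 0 < Real.cos β := Real.cos_pos_of_mem_Ioo ⟨by linarith, hβ⟩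
  have hc1 := Real.cos_le_one β
  have hu : 0 ≤ radialCoord β z := by
    unfold radialCoord; nlinarith
  have h := strip_estimate hs hc (Real.sin_sq_add_cos_sq β) (tan_half_mul hβ0 hβ) hx
    (by linarith) hy4 (u := radialCoord β z) rfl (t := tangentCoord β z) rfl
    (Real.sqrt_nonneg (radialCoord β z ^ 2 + tangentCoord β z ^ 2)) (Real.sq_sqrt (by positivity))
  have e1 : upperInvariant β z = Real.sqrt (radialCoord β z ^ 2 + tangentCoord β z ^ 2) +
      tangentCoord β z := by simp [upperInvariant, hu, wedgeInvariant]
  have e2 : upperTime β z = (Real.pi / 2 - β) / 8 * upperInvariant β z + 1 / 4 +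
      exitTime (radialCoord β z) (upperInvariant β z) := by
    simp [upperTime, upperInvariant, hu, wedgeTime]
  rw [← e1] at h
  obtain ⟨h1, h2⟩ := h
  refine ⟨h1.trans ?_, ?_⟩
  · have : 0 < z.1 := by linarith
    gcongr
    norm_num
  · refine le_trans (le_of_eq ?_) h2
    rw [e2]
    congr 1
    have : (z.2 + Real.cos β) / (2 * (1 + Real.cos β)) = phase β z + 1 / 2 := by
      unfold phase
      have : 1 + Real.cos β ≠ 0 := by linarith
      field_simp
      ring
    rw [this, shearFactor]
    ring

theorem abs_mul_le_of_le {a b A B : ℝ} (h1 : |a| ≤ A) (h2 : |b| ≤ B) : |a * b| ≤ A * B := by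
  rw [abs_mul]
  exact mul_le_mul h1 h2 (abs_nonneg _) ((abs_nonneg _).trans h1)

theorem radius_pos_and_le {w : ℝ × ℝ} {x : ℝ} (hx : 1000 ≤ x) (h1 : |w.1 - x| ≤ 1)
    (h2 : -6 ≤ w.2) (h3 : w.2 ≤ 4) : 0 < radius w ∧ radius w ≤ 2 * x := by
  obtain ⟨h4, h5⟩ := abs_le.1 h1
  have e := radius_sq w
  have b0 := radius_nonneg w
  have b1 : 1 ≤ w.1 ^ 2 := by nlinarith
  have b3 : w.1 ^ 2 ≤ (x + 1) ^ 2 := pow_le_pow_left₀ (by linarith) (by linarith) 2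
  have b4 : w.2 ^ 2 ≤ 36 := by nlinarith
  constructor
  · rcases b0.lt_or_eq with h | h
    · exact h
    · rw [← h] at e
      nlinarith [sq_nonneg w.2]
  · refine abs_le_of_sq_le_sq' ?_ (by linarith) |>.2
    nlinarith

set_option maxHeartbeats 1600000 in
/-- The return map to the strip, in the action and phase coordinates. -/
theorem exists_return (hβ0 : 0 < β) (hβ : β < Real.pi / 2) :
    ∃ ρ B : ℝ, 1 ≤ ρ ∧ 1 ≤ B ∧ ∀ u : ℕ → ℝ × ℝ,
      (∀ n, OuterBilliardStep (circularSector β) (u n) (u (n + 1))) → ∀ n,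
      u n ∈ strip β → ρ ≤ radius (u n) →
      ∃ n' > n, u n' ∈ strip β ∧
        (∃ k : ℤ, |phase β (u n') - (phase β (u n) - action β (u n) + k)| ≤ B / radius (u n)) ∧
        |action β (u n') - action β (u n) - shearConstant β * phase β (u n')| ≤
          B / radius (u n) ∧
        phase β (u n') ≤ 1 / 2 + B / radius (u n') := by
  have hs : 0 < Real.sin β := Real.sin_pos_of_pos_of_lt_pi hβ0 (by linarith)
  have hc : 0 < Real.cos β := Real.cos_pos_of_mem_Ioo ⟨by linarith, hβ⟩
  have hs1 := Real.sin_le_one β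
  have hc1 := Real.cos_le_one β
  obtain ⟨ρ, hρ, hpass⟩ := exists_pass hβ0 hβ
  obtain ⟨hA0, hA4⟩ := shearFactor_bounds hβ0 hβ
  have hq0 : 0 < 320 / Real.sin β := by positivity
  refine ⟨ρ + 40000 + 320 / Real.sin β, 10 ^ 7, by linarith, by norm_num,
    fun u hu n hn hr => ?_⟩
  obtain ⟨hx0, hy0, hy4⟩ := hn
  have hr2 := radius_sq (u n)
  obtain ⟨k, a, ha1, ha2, ha4, hinv, htime, hw2, hd1, hd2⟩ :=
    hpass u hu n hy0 (by linarith)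
  set z := u n
  set w := u (n + 2 * k + 1)
  set r := radius z
  have hr0 : 0 < r := by linarith
  have hp : 0 < 1 / r := by positivity
  have hxr : r / 32 ≤ z.1 := by
    by_contra h
    nlinarith
  have hbig : ∀ x : ℝ, r / 32 ≤ x → 1000 ≤ x ∧ 10 ≤ x * Real.sin β := by
    intro x hx
    have h1 : 320 / Real.sin β ≤ r := by linarith
    rw [div_le_iff₀ hs] at h1
    exact ⟨by linarith, by nlinarith⟩
  have hsm : ∀ x C : ℝ, r / 32 ≤ x → 0 ≤ C → C / x ≤ 32 * C * (1 / r) := by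
    intro x C hx hC
    have : 0 < x := by linarith
    rw [mul_one_div, div_le_div_iff₀ this hr0]
    nlinarith
  obtain ⟨z1, z2⟩ := strip_asymptotics hβ0 hβ (hbig _ hxr).1 (hbig _ hxr).2 hy0 hy4
  obtain ⟨a1, a2⟩ := strip_asymptotics hβ0 hβ (hbig _ ha1).1 (hbig _ ha1).2 ha2 ha4
  have z1' := abs_le.1 (z1.trans (hsm _ 100 hxr (by norm_num)))
  have z2' := abs_le.1 (z2.trans (hsm _ 100 hxr (by norm_num)))
  have a1' := abs_le.1 (a1.trans (hsm _ 100 ha1 (by norm_num)))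
  have a2' := abs_le.1 (a2.trans (hsm _ 100 ha1 (by norm_num)))
  have hd1' := abs_le.1 (hd1.trans (hsm _ 10 ha1 (by norm_num)))
  have hd2' := abs_le.1 (hd2.trans (hsm _ 40 ha1 (by norm_num)))
  rw [div_eq_mul_one_div] at hinv htime
  have hinv' := abs_le.1 hinv
  have htime' := abs_le.1 htime
  have hd1one : 10 / a.1 ≤ 1 := by
    rw [div_le_one (by linarith [(hbig _ ha1).1])]; linarith [(hbig _ ha1).1]
  have hd2one : 40 / a.1 ≤ 1 := by
    rw [div_le_one (by linarith [(hbig _ ha1).1])]; linarith [(hbig _ ha1).1]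
  have hd1'' := abs_le.1 (hd1.trans hd1one)
  have hd2'' := abs_le.1 (hd2.trans hd2one)
  set h := 2 * (1 + Real.cos β) with hh
  have hh2 : 2 ≤ h := by linarith
  have hphw : |phase β w + phase β a| ≤ 1280 * (1 / r) := by
    have e : phase β w + phase β a = (w.2 - (2 - a.2)) / h := by
      unfold phase; rw [← hh]; field_simp; ring
    rw [e, abs_div, abs_of_pos (by linarith : 0 < h), div_le_iff₀ (by linarith)]
    refine (hd2.trans (hsm _ 40 ha1 (by norm_num))).trans ?_
    norm_num only
    exact le_mul_of_one_le_right (by positivity) (by linarith)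
  have hphw' := abs_le.1 hphw
  have hBr : 10 ^ 7 / r = 10 ^ 7 * (1 / r) := by ring
  have hA1 : |shearFactor β / 2| ≤ 2 := by rw [abs_of_pos (by linarith)]; linarith
  refine ⟨n + 2 * k + 1, by omega, ⟨?_, hw2, ?_⟩, ⟨k, ?_⟩, ?_, ?_⟩
  · linarith [hd1''.1, (hbig _ ha1).1]
  · linarith [hd2''.2]
  · rw [hBr]
    -- k counts the double steps, so k ≈ T(z) + T(a) with I(a) ≈ I(z), and the arc step gives phase
    -- w ≈ -phase a. Inserting the asymptotics of T turns this into phase w ≈ phase z - action z +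
    -- k.
    have e : phase β w - (phase β z - action β z + ((k : ℤ) : ℝ)) =
        (phase β w + phase β a) + (upperTime β z + upperTime β a - k)
        - (upperTime β z - (shearFactor β / 4 * upperInvariant β z - phase β z - 1 / 4))
        - (upperTime β a - (shearFactor β / 4 * upperInvariant β a - phase β a - 1 / 4))
        - shearFactor β / 2 * ((upperInvariant β z - linearInvariant β z) +
          (upperInvariant β a - upperInvariant β z) / 2) := by
      unfold action
      push_cast
      ring
    have hm : |(upperInvariant β z - linearInvariant β z) +
        (upperInvariant β a - upperInvariant β z) / 2| ≤ 400000 * (1 / r) := by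
      rw [abs_le]; constructor <;> linarith [z1'.1, z1'.2, hinv'.1, hinv'.2]
    have hm' := abs_le.1 (abs_mul_le_of_le hA1 hm)
    rw [e, abs_le]
    constructor <;> linarith [hm'.1, hm'.2, hphw'.1, hphw'.2, htime'.1, htime'.2, z2'.1, z2'.2,
      a2'.1, a2'.2]
  · rw [hBr]
    -- The invariant of z reappears at a, and w is close to (a.1, 2 - a.2). The resulting change of
    -- `linearInvariant` is about 2 sin β (w.2 - 1), a multiple of the phase of w; this is the
    -- shear.
    have e : action β w - action β z - shearConstant β * phase β w =
        shearFactor β / 2 * ((1 + Real.cos β) * (w.1 - a.1)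
          - Real.sin β * (w.2 - (2 - a.2))
          - (upperInvariant β a - linearInvariant β a) + (upperInvariant β z - linearInvariant β z)
          + (upperInvariant β a - upperInvariant β z)) := by
      have hsh : shearConstant β = 2 * Real.sin β * (1 + Real.cos β) * shearFactor β := by
        unfold shearConstant shearFactor
        rw [Real.sin_two_mul]; ring
      have hph : (1 + Real.cos β) * phase β w = (w.2 - 1) / 2 := by
        unfold phase
        have : 1 + Real.cos β ≠ 0 := by linarith
        field_simp
      have : shearConstant β * phase β w = shearFactor β * Real.sin β * (w.2 - 1) := by
        rw [hsh]; linear_combination 2 * Real.sin β * shearFactor β * hph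
      rw [this]
      unfold action linearInvariant
      ring
    have m1 := abs_le.1 (abs_mul_le_of_le (a := 1 + Real.cos β) (A := 2)
      (by rw [abs_of_pos (by linarith)]; linarith) (hd1.trans (hsm _ 10 ha1 (by norm_num))))
    have m2 := abs_le.1 (abs_mul_le_of_le (a := Real.sin β) (A := 1)
      (by rw [abs_of_pos hs]; exact hs1) (hd2.trans (hsm _ 40 ha1 (by norm_num))))
    rw [e]
    refine (abs_mul_le_of_le hA1 (B := 700000 * (1 / r)) ?_).trans (by linarith)
    rw [abs_le]
    constructor <;> linarith [m1.1, m1.2, m2.1, m2.2, a1'.1, a1'.2, z1'.1, z1'.2, hinv'.1, hinv'.2]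
  · have h1 : phase β a > -1 / 2 := by
      unfold phase
      rw [← hh, gt_iff_lt, lt_div_iff₀ (by linarith)]
      linarith
    have ha0 := (hbig _ ha1).1
    obtain ⟨hw0, hw1⟩ := radius_pos_and_le ha0 (hd1.trans hd1one)
      (by linarith [hd2''.1] : -6 ≤ w.2) (by linarith [hd2''.2])
    have h3 : phase β w + phase β a ≤ 40 / a.1 := by
      have e : phase β w + phase β a = (w.2 - (2 - a.2)) / h := by
        unfold phase; rw [← hh]; field_simp; ring
      rw [e, div_le_iff₀ (by linarith)]
      have : 0 < 40 / a.1 := by positivity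
      have := (le_abs_self _).trans hd2
      nlinarith
    have h4 : 40 / a.1 ≤ 10 ^ 7 / radius w := by
      rw [div_le_div_iff₀ (by linarith) hw0]
      linarith
    linarith

/-- Every escaping orbit enters the strip. -/
theorem exists_mem_strip (hβ0 : 0 < β) (hβ : β < Real.pi / 2) {u : ℕ → ℝ × ℝ}
    (hu : ∀ n, OuterBilliardStep (circularSector β) (u n) (u (n + 1)))
    (hr : Tendsto (fun n => radius (u n)) atTop atTop) (m : ℕ) : ∃ n ≥ m, u n ∈ strip β := by
  have hs : 0 < Real.sin β := Real.sin_pos_of_pos_of_lt_pi hβ0 (by linarith)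
  have hc1 := Real.cos_le_one β
  obtain ⟨ρ, hρ, hpass⟩ := exists_pass hβ0 hβ
  obtain ⟨M, hM⟩ := eventually_atTop.1 (hr.eventually_ge_atTop (ρ + 32000))
  obtain ⟨n, hn, hup⟩ : ∃ n ≥ max M m, -Real.cos β < (u n).2 := by
    by_contra hne
    push Not at hne
    exact (hu (max M m)).chord_exclusion hs (hne _ le_rfl) (hne _ (by omega))
  have hnM := hM n (by omega)
  obtain ⟨k, a, ha1, ha2, ha4, -, -, hw2, hd1, hd2⟩ := hpass u hu n hup (by linarith)
  have ha : 1000 ≤ a.1 := by linarith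
  have hd1one : 10 / a.1 ≤ 1 := by rw [div_le_one (by linarith)]; linarith
  have hd2one : 40 / a.1 ≤ 1 := by rw [div_le_one (by linarith)]; linarith
  have hd1'' := abs_le.1 (hd1.trans hd1one)
  have hd2'' := abs_le.1 (hd2.trans hd2one)
  exact ⟨n + 2 * k + 1, by omega, by linarith [hd1''.1], hw2, by linarith [hd2''.2]⟩

end ReturnMap

/-! ### Polygonal barriers of the piecewise linear map when α = π / m. -/

section Barrier

/-- Coefficient of the phase in the `n`-th iterate of the linear part. -/
noncomputable def phaseCoeff (α : ℝ) (n : ℕ) : ℝ := Real.cos (n * α - α / 2) / Real.cos (α / 2)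

/-- Minus the coefficient of the action in the `n`-th iterate of the linear part. -/
noncomputable def actionCoeff (α : ℝ) (n : ℕ) : ℝ := Real.sin (n * α) / Real.sin α

/-- The phase of the `n`-th iterate under the linear part. -/
noncomputable def linearPhase (α : ℝ) (n : ℕ) (R ψ : ℝ) : ℝ :=
  phaseCoeff α n * ψ - actionCoeff α n * R

variable {α : ℝ}

theorem coeff_recurrence (h1 : 0 < Real.cos (α / 2)) (h2 : 0 < Real.sin (α / 2)) (n : ℕ) :
    phaseCoeff α (n + 1) = phaseCoeff α n - (2 - 2 * Real.cos α) * actionCoeff α n ∧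
      actionCoeff α (n + 1) = phaseCoeff α (n + 1) + actionCoeff α n := by
  have hsc := Real.sin_sq_add_cos_sq (α / 2)
  have e1 : Real.sin α = 2 * Real.sin (α / 2) * Real.cos (α / 2) := by
    rw [← Real.sin_two_mul]; ring_nf
  have e2 : Real.cos α = 2 * Real.cos (α / 2) ^ 2 - 1 := by
    rw [← Real.cos_two_mul]; ring_nf
  have e3 : ((n + 1 : ℕ) : ℝ) * α - α / 2 = n * α + α / 2 := by push_cast; ring
  have e4 : ((n + 1 : ℕ) : ℝ) * α = n * α + α := by push_cast; ring
  unfold phaseCoeff actionCoeff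
  rw [e3, e4, Real.cos_add, Real.cos_sub, Real.sin_add, e1, e2]
  generalize Real.sin (n * α) = sA
  generalize Real.cos (n * α) = cA
  generalize Real.sin (α / 2) = s at *
  generalize Real.cos (α / 2) = c at *
  obtain hs2 : s ^ 2 = 1 - c ^ 2 := by linarith
  constructor
  · field_simp
    linear_combination (-2 * sA) * hsc
  · field_simp
    linear_combination (2 * sA) * hsc

/-- One step of the map shifts the index of the linear forms by one. The integer κ from the
reduction modulo 1 and the errors e₁, e₂ enter additively. -/
theorem linearPhase_step (h1 : 0 < Real.cos (α / 2)) (h2 : 0 < Real.sin (α / 2)) (n : ℕ)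
    (R ψ κ e₁ e₂ : ℝ) :
    linearPhase α n (R + (2 - 2 * Real.cos α) * (ψ - R - κ + e₁) + e₂) (ψ - R - κ + e₁) =
      linearPhase α (n + 1) R ψ - κ * phaseCoeff α (n + 1) + phaseCoeff α (n + 1) * e₁ -
        actionCoeff α n * e₂ := by
  obtain ⟨r1, r2⟩ := coeff_recurrence h1 h2 n
  unfold linearPhase
  linear_combination (-(ψ - R - κ + e₁)) * r1 - (-R) * r2

/-- The forms of index n span a space of dimension two and depend on n through sines and cosines of
n α, so each is a combination of those of index 0 and k. Since (k + 1) α = π, the coefficients are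
sines of angles in [0, π] for 0 ≤ n ≤ k. -/
theorem linearPhase_interpolation (h1 : 0 < Real.cos (α / 2)) (h2 : 0 < Real.sin (α / 2))
    {k n : ℕ} (hk : ((k + 1 : ℕ) : ℝ) * α = Real.pi) (R ψ : ℝ) :
    Real.sin α * linearPhase α n R ψ =
      Real.sin (n * α + α) * ψ + Real.sin (n * α) * linearPhase α k R ψ := by
  have e1 : Real.sin α = 2 * Real.sin (α / 2) * Real.cos (α / 2) := by
    rw [← Real.sin_two_mul]; ring_nf
  have e2 : Real.cos α = 2 * Real.cos (α / 2) ^ 2 - 1 := by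
    rw [← Real.cos_two_mul]; ring_nf
  have hsc := Real.sin_sq_add_cos_sq (α / 2)
  have hkα : (k : ℝ) * α = Real.pi - α := by push_cast at hk; linarith
  have s1 : actionCoeff α k = 1 := by
    unfold actionCoeff
    rw [hkα, Real.sin_pi_sub, div_self]
    rw [e1]; positivity
  have s2 : phaseCoeff α k * Real.cos (α / 2) =
      -(Real.cos α * Real.cos (α / 2) - Real.sin α * Real.sin (α / 2)) := by
    unfold phaseCoeff
    rw [hkα, div_mul_cancel₀ _ h1.ne', show Real.pi - α - α / 2 = Real.pi - (α + α / 2) by ring,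
      Real.cos_pi_sub, Real.cos_add]
  have s3 : Real.sin α * actionCoeff α n = Real.sin (n * α) := by
    unfold actionCoeff
    have : Real.sin α ≠ 0 := by rw [e1]; positivity
    field_simp
  have s4 : phaseCoeff α n * Real.cos (α / 2) =
      Real.cos (n * α) * Real.cos (α / 2) + Real.sin (n * α) * Real.sin (α / 2) := by
    unfold phaseCoeff
    rw [div_mul_cancel₀ _ h1.ne', Real.cos_sub]
  have key : Real.sin α * phaseCoeff α n =
      Real.sin (n * α + α) + Real.sin (n * α) * phaseCoeff α k := by
    apply mul_right_cancel₀ h1.ne'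
    rw [Real.sin_add]
    rw [e1, e2] at *
    generalize Real.sin (n * α) = sA at *
    generalize Real.cos (n * α) = cA at *
    generalize Real.sin (α / 2) = s at *
    generalize Real.cos (α / 2) = c at *
    linear_combination (2 * s * c) * s4 - sA * s2
  unfold linearPhase
  rw [s1]
  linear_combination ψ * key - R * s3

theorem sin_le_sin_of_mem {x y : ℝ} (hx : 0 ≤ x) (h1 : x ≤ y) (h2 : y ≤ Real.pi - x) :
    Real.sin x ≤ Real.sin y := by
  rcases le_total y (Real.pi / 2) with h | h
  · exact Real.sin_le_sin_of_le_of_le_pi_div_two (by linarith [Real.pi_pos]) h h1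
  · rw [← Real.sin_pi_sub y]
    exact Real.sin_le_sin_of_le_of_le_pi_div_two (by linarith [Real.pi_pos]) (by linarith)
      (by linarith)

/-- Angles of the form `π / m` with `m ≥ 3`. -/
structure IsBarrierAngle (α : ℝ) (m : ℕ) : Prop where
  pos : 0 < α
  le : α ≤ Real.pi / 3
  mul_eq : (m : ℝ) * α = Real.pi

theorem isBarrierAngle {m : ℕ} (hm : 3 ≤ m) : IsBarrierAngle (Real.pi / m) m := by
  have h3 : (3 : ℝ) ≤ m := by exact_mod_cast hm
  refine ⟨by positivity, ?_, by field_simp⟩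
  exact div_le_div_of_nonneg_left Real.pi_pos.le (by norm_num) h3

namespace IsBarrierAngle

variable {m : ℕ} (h : IsBarrierAngle α m)
include h

theorem cos_half : 1 / 2 ≤ Real.cos (α / 2) := by
  rw [← Real.cos_pi_div_three]
  have := h.pos
  have := h.le
  exact Real.cos_le_cos_of_nonneg_of_le_pi (by linarith) (by linarith [Real.pi_pos]) (by linarith)

theorem sin_half : 0 < Real.sin (α / 2) :=
  Real.sin_pos_of_pos_of_lt_pi (by linarith [h.pos]) (by linarith [h.le, Real.pi_pos])

theorem sin_pos : 0 < Real.sin α :=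
  Real.sin_pos_of_pos_of_lt_pi h.pos (by linarith [h.le, Real.pi_pos])

theorem half_le_cos : 1 / 2 ≤ Real.cos α := by
  rw [← Real.cos_pi_div_three]
  exact Real.cos_le_cos_of_nonneg_of_le_pi h.pos.le (by linarith [Real.pi_pos]) h.le

theorem abs_phaseCoeff_le (n : ℕ) : |phaseCoeff α n| ≤ 2 := by
  have := h.cos_half
  unfold phaseCoeff
  rw [abs_div, abs_of_pos (by linarith : 0 < Real.cos (α / 2)), div_le_iff₀ (by linarith)]
  linarith [Real.abs_cos_le_one (n * α - α / 2)]

theorem abs_actionCoeff_le (n : ℕ) : |actionCoeff α n| ≤ 1 / Real.sin α := by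
  unfold actionCoeff
  rw [abs_div, abs_of_pos h.sin_pos]
  exact div_le_div_of_nonneg_right (Real.abs_sin_le_one _) h.sin_pos.le

/-- No side of the chain is parallel to the action axis: each form decreases in R at rate at least
one. Hence low points lie inside the barrier, points outside are not much below height N, and the
slabs around the sides are thin. -/
theorem one_le_actionCoeff {n : ℕ} (h1 : 1 ≤ n) (h2 : n < m) : 1 ≤ actionCoeff α n := by
  have hp := h.pos
  have h1' : (1 : ℝ) ≤ n := by exact_mod_cast h1
  have h2' : (n : ℝ) + 1 ≤ m := by exact_mod_cast h2
  unfold actionCoeff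
  rw [le_div_iff₀ h.sin_pos, one_mul]
  have := h.mul_eq
  exact sin_le_sin_of_mem hp.le (by nlinarith) (by nlinarith)

/-- This is where α = π / m enters. The condition of index m, which the last form is mapped to, is
just ψ < 1/2 and holds on the fundamental domain up to its edge. -/
theorem linearPhase_self (R ψ : ℝ) : linearPhase α m R ψ = -ψ := by
  have : Real.cos (α / 2) ≠ 0 := by linarith [h.cos_half]
  unfold linearPhase phaseCoeff actionCoeff
  rw [h.mul_eq, Real.cos_pi_sub, Real.sin_pi]
  field_simp
  ring

theorem linearPhase_one (R ψ : ℝ) : linearPhase α 1 R ψ = ψ - R := by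
  have : Real.cos (α / 2) ≠ 0 := by linarith [h.cos_half]
  have := h.sin_pos.ne'
  unfold linearPhase phaseCoeff actionCoeff
  rw [Nat.cast_one, one_mul, sub_half]
  field_simp

/-- If one step of the return map leaves the polygonal barrier, then one of the two points is
close to its boundary. -/
theorem near_boundary {ρ ψ ψ' ε e₁ e₂ : ℝ} {κ : ℤ} (hm : 3 ≤ m) (he₁ : |e₁| ≤ ε) (he₂ : |e₂| ≤ ε)
    (hψ : ψ ≤ 1 / 2 + ε) (hψ0 : -1 / 2 < ψ') (hψ1 : ψ' ≤ 1 / 2 + ε)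
    (hψ' : ψ' = ψ - ρ - κ + e₁)
    (hD : ∀ n, 1 ≤ n → n < m → -1 / 2 < linearPhase α n ρ ψ)
    {l : ℕ} (hl1 : 1 ≤ l) (hlm : l < m)
    (hl : linearPhase α l (ρ + (2 - 2 * Real.cos α) * ψ' + e₂) ψ' ≤ -1 / 2) :
    (|ψ - 1 / 2| ≤ (2 + 1 / Real.sin α) * ε ∨
      ∃ n, 1 ≤ n ∧ n < m ∧ |linearPhase α n ρ ψ + 1 / 2| ≤ (2 + 1 / Real.sin α) * ε) ∨
    |linearPhase α l (ρ + (2 - 2 * Real.cos α) * ψ' + e₂) ψ' + 1 / 2| ≤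
      3 / Real.sin α * ε := by
  have hc := h.cos_half
  have hs := h.sin_pos
  have hα0 := h.pos
  have hε : 0 ≤ ε := (abs_nonneg _).trans he₁
  have hS : 0 < 1 / Real.sin α := by positivity
  obtain ⟨a1, a2⟩ := abs_le.1 he₁
  obtain ⟨b1, b2⟩ := abs_le.1 he₂
  have hstep : ∀ n : ℕ, linearPhase α n (ρ + (2 - 2 * Real.cos α) * ψ' + e₂) ψ' =
      linearPhase α (n + 1) ρ ψ - κ * phaseCoeff α (n + 1) + phaseCoeff α (n + 1) * e₁ -
        actionCoeff α n * e₂ := by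
    intro n
    rw [hψ']
    exact linearPhase_step (by linarith) h.sin_half n ρ ψ κ e₁ e₂
  rcases lt_trichotomy κ 0 with hκ | hκ | hκ
  -- κ < 0: the phase had to be raised by an integer, so ψ - ρ was already near or below -1/2; this
  -- is the form of index 1.
  · left; right
    have hκ' : (κ : ℝ) ≤ -1 := by exact_mod_cast Int.le_sub_one_of_lt hκ
    refine ⟨1, le_rfl, by omega, ?_⟩
    have := hD 1 le_rfl (by omega)
    rw [h.linearPhase_one] at this ⊢
    have : 0 ≤ 1 / Real.sin α * ε := by positivity
    rw [abs_le]; constructor <;> linarith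
  -- κ = 0: the form of index l at the image is the form of index l + 1 at the original point, which
  -- is above -1/2 if l + 1 < m and equals -ψ if l + 1 = m.
  · left
    have e := hstep l
    have f1 : |phaseCoeff α (l + 1) * e₁| ≤ 2 * ε := by
      rw [abs_mul]
      exact mul_le_mul (h.abs_phaseCoeff_le _) he₁ (abs_nonneg _) (by norm_num)
    have f2 : |actionCoeff α l * e₂| ≤ 1 / Real.sin α * ε := by
      rw [abs_mul]
      exact mul_le_mul (h.abs_actionCoeff_le _) he₂ (abs_nonneg _) hS.le
    have f1' := abs_le.1 f1
    have f2' := abs_le.1 f2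
    rw [hκ, Int.cast_zero, zero_mul, sub_zero] at e
    have : 0 ≤ 1 / Real.sin α * ε := by positivity
    rcases Nat.lt_or_ge (l + 1) m with hlt | hge
    · right
      have := hD (l + 1) (by omega) hlt
      exact ⟨l + 1, by omega, hlt, by rw [abs_le]; constructor <;> linarith⟩
    · left
      have hlm' : l + 1 = m := by omega
      rw [hlm'] at e f1'
      rw [h.linearPhase_self] at e
      rw [abs_le]; constructor <;> linarith
  -- κ > 0: the form of index m - 1 at the image is about κ - ψ ≥ 1/2, and that of index 0 is ψ' >
  -- -1/2. Interpolation with sin((l + 1) α) ≤ sin(l α) + sin α puts all forms above -1/2 up to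
  -- O(ε), so the image is near the boundary.
  · right
    have hκ' : (1 : ℝ) ≤ κ := by exact_mod_cast hκ
    obtain ⟨q, rfl⟩ : ∃ q, m = q + 1 := ⟨m - 1, by omega⟩
    have hw : 1 / 2 - 3 * ε ≤ linearPhase α q (ρ + (2 - 2 * Real.cos α) * ψ' + e₂) ψ' := by
      have c1 : phaseCoeff α (q + 1) = -1 := by
        have : Real.cos (α / 2) ≠ 0 := by linarith
        unfold phaseCoeff
        rw [h.mul_eq, Real.cos_pi_sub]
        field_simp
      have c2 : actionCoeff α q = 1 := by
        have e := h.mul_eq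
        push_cast at e
        unfold actionCoeff
        rw [show (q : ℝ) * α = Real.pi - α by linarith, Real.sin_pi_sub, div_self hs.ne']
      rw [hstep q, h.linearPhase_self, c1, c2]
      linarith
    have hint := linearPhase_interpolation (by linarith) h.sin_half (n := l) h.mul_eq
      (ρ + (2 - 2 * Real.cos α) * ψ' + e₂) ψ'
    generalize linearPhase α q (ρ + (2 - 2 * Real.cos α) * ψ' + e₂) ψ' = v at *
    have hlm' : (l : ℝ) + 1 ≤ (q + 1 : ℕ) := by exact_mod_cast hlm
    have hpi := h.mul_eq
    have hsl0 : 0 ≤ Real.sin (l * α) :=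
      Real.sin_nonneg_of_nonneg_of_le_pi (by positivity) (by nlinarith)
    have hsl1 : 0 ≤ Real.sin (l * α + α) :=
      Real.sin_nonneg_of_nonneg_of_le_pi (by positivity) (by nlinarith)
    have hsl2 : Real.sin (l * α + α) ≤ Real.sin (l * α) + Real.sin α := by
      rw [Real.sin_add]
      nlinarith [Real.cos_le_one α, Real.cos_le_one (l * α)]
    have hsl3 := Real.sin_le_one (l * α)
    generalize linearPhase α l (ρ + (2 - 2 * Real.cos α) * ψ' + e₂) ψ' = y at *
    have hy : -(3 * ε) ≤ Real.sin α * (y + 1 / 2) := by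
      have g1 : -(1 / 2) * Real.sin (l * α + α) ≤ Real.sin (l * α + α) * ψ' := by nlinarith
      have g2 : Real.sin (l * α) * (1 / 2 - 3 * ε) ≤ Real.sin (l * α) * v :=
        mul_le_mul_of_nonneg_left hw hsl0
      have g3 : Real.sin (l * α) * ε ≤ ε := mul_le_of_le_one_left hε hsl3
      linarith
    have hy' : -(3 / Real.sin α * ε) ≤ y + 1 / 2 := by
      rw [show -(3 / Real.sin α * ε) = -(3 * ε) / Real.sin α by ring, div_le_iff₀ hs]
      linarith
    rw [abs_le]
    have : 0 ≤ 3 / Real.sin α * ε := by positivity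
    constructor <;> linarith

omit h in
theorem div_le_two_mul_div {B R N : ℝ} (hB : 0 ≤ B) (hN : 0 < N) (hR : N / 2 ≤ R) :
    B / R ≤ 2 * B / N := by
  rw [div_le_div_iff₀ (by linarith) hN]
  nlinarith

/-- An orbit of a small perturbation of the piecewise linear map that escapes to infinity passes
close to the boundary of the barrier at every large integer height. -/
theorem exists_near_boundary (hm : 3 ≤ m) {B : ℝ} (hB : 1 ≤ B) :
    ∃ K W : ℝ, 0 < K ∧ 0 < W ∧ ∀ R ψ : ℕ → ℝ, Tendsto R atTop atTop → (∀ j, 1 ≤ R j) →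
      (∀ j, -1 / 2 < ψ j) → (∀ j, ψ j ≤ 1 / 2 + B / R j) →
      (∀ j, ∃ k : ℤ, |ψ (j + 1) - (ψ j - R j + k)| ≤ B / R j) →
      (∀ j, |R (j + 1) - R j - (2 - 2 * Real.cos α) * ψ (j + 1)| ≤ B / R j) →
      ∀ᶠ N : ℕ in atTop, ∃ j, |R j - N| ≤ W ∧ (|ψ j - 1 / 2| ≤ K / N ∨
        ∃ n, 1 ≤ n ∧ n < m ∧ |linearPhase α n (R j - N) (ψ j) + 1 / 2| ≤ K / N) := by
  have hs := h.sin_pos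
  have hS : 0 < 1 / Real.sin α := by positivity
  refine ⟨(2 + 3 * (1 / Real.sin α)) * (2 * B), 2 + 4 * B, by positivity, by linarith,
    fun R ψ hR hR1 hψ0 hψ1 hk hstep => ?_⟩
  -- Beyond N₀ the orbit starts inside the barrier, and N exceeds twice the window height, so
  -- actions in the window are at least N / 2.
  obtain ⟨N₀, hN₀⟩ := exists_nat_ge (R 0 + 2 * |ψ 0| + 2 * (2 + 4 * B) + 1)
  filter_upwards [eventually_ge_atTop N₀] with N hN
  have hN' : R 0 + 2 * |ψ 0| + 2 * (2 + 4 * B) + 1 ≤ N := hN₀.trans (by exact_mod_cast hN)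
  have hNpos : (0 : ℝ) < N := by linarith [hR1 0, abs_nonneg (ψ 0)]
  have hBR : ∀ j, B / R j ≤ B := fun j => div_le_self (by linarith) (hR1 j)
  set D : ℕ → Prop := fun j => ∀ n, 1 ≤ n → n < m → -1 / 2 < linearPhase α n (R j - N) (ψ j)
    with hDdef
  have hD0 : D 0 := by
    intro n h1 h2
    have g1 := h.one_le_actionCoeff h1 h2
    have g2 : |phaseCoeff α n * ψ 0| ≤ 2 * |ψ 0| := by
      rw [abs_mul]
      exact mul_le_mul_of_nonneg_right (h.abs_phaseCoeff_le n) (abs_nonneg _)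
    have g2' := abs_le.1 g2
    unfold linearPhase
    nlinarith [abs_nonneg (ψ 0)]
  have hDex : ∃ j, ¬ D j := by
    obtain ⟨j, hj⟩ := (hR.eventually_ge_atTop (N + 1 + B)).exists
    refine ⟨j, fun hD => ?_⟩
    have := hD 1 le_rfl (by omega)
    rw [h.linearPhase_one] at this
    linarith [hψ1 j, hBR j]
  -- The barrier bounds the action from above, so an escaping orbit leaves it; j is the last index
  -- before the first exit.
  obtain ⟨j, hj, hj'⟩ : ∃ j, D j ∧ ¬ D (j + 1) := by
    classical
    have h1 := Nat.find_spec hDex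
    have h2 : Nat.find hDex ≠ 0 := fun e => by rw [e] at h1; exact h1 hD0
    obtain ⟨j, hj⟩ := Nat.exists_eq_succ_of_ne_zero h2
    refine ⟨j, ?_, by rw [hj] at h1; exact h1⟩
    by_contra hne
    have := Nat.find_min' hDex hne
    omega
  obtain ⟨k, hk⟩ := hk j
  obtain ⟨l, hl1, hlm, hl⟩ : ∃ l, 1 ≤ l ∧ l < m ∧
      linearPhase α l (R (j + 1) - N) (ψ (j + 1)) ≤ -1 / 2 := by
    by_contra hne
    push Not at hne
    exact hj' hne
  have hst := hstep j
  have hup : R j - N ≤ 1 + B := by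
    have := hj 1 le_rfl (by omega)
    rw [h.linearPhase_one] at this
    linarith [hψ1 j, hBR j]
  have hψ' := hψ1 (j + 1)
  have hψ'0 := hψ0 (j + 1)
  have hψabs : |ψ (j + 1)| ≤ 1 / 2 + B := by
    rw [abs_le]; constructor <;> linarith [hBR (j + 1)]
  have hlow' : -(1 / 2 + 2 * B) ≤ R (j + 1) - N := by
    have g1 := h.one_le_actionCoeff hl1 hlm
    have g2 : |phaseCoeff α l * ψ (j + 1)| ≤ 2 * (1 / 2 + B) := by
      rw [abs_mul]
      exact mul_le_mul (h.abs_phaseCoeff_le l) hψabs (abs_nonneg _) (by norm_num)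
    have g2' := abs_le.1 g2
    unfold linearPhase at hl
    by_contra hne
    push Not at hne
    nlinarith
  have hCψ : |(2 - 2 * Real.cos α) * ψ (j + 1)| ≤ 1 / 2 + B := by
    have := h.half_le_cos
    have := Real.cos_le_one α
    rw [abs_mul, abs_of_nonneg (by linarith : 0 ≤ 2 - 2 * Real.cos α)]
    have := abs_nonneg (ψ (j + 1))
    nlinarith
  have hCψ' := abs_le.1 hCψ
  have hst' := abs_le.1 (hst.trans (hBR j))
  have hW : |R j - N| ≤ 2 + 4 * B := by rw [abs_le]; constructor <;> linarith
  have hW' : |R (j + 1) - N| ≤ 2 + 4 * B := by rw [abs_le]; constructor <;> linarith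
  have hε : B / R j ≤ 2 * B / N :=
    div_le_two_mul_div (by linarith) hNpos (by linarith [(abs_le.1 hW).1, hR1 0, abs_nonneg (ψ 0)])
  have hε' : B / R (j + 1) ≤ 2 * B / N :=
    div_le_two_mul_div (by linarith) hNpos (by linarith [(abs_le.1 hW').1, hR1 0, abs_nonneg (ψ 0)])
  have hK1 : (2 + 1 / Real.sin α) * (2 * B / N) ≤
      (2 + 3 * (1 / Real.sin α)) * (2 * B) / N := by
    rw [mul_div_assoc (2 + 3 * (1 / Real.sin α)) (2 * B)]
    exact mul_le_mul_of_nonneg_right (by linarith) (by positivity)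
  have hK2 : 3 / Real.sin α * (2 * B / N) ≤ (2 + 3 * (1 / Real.sin α)) * (2 * B) / N := by
    rw [mul_div_assoc (2 + 3 * (1 / Real.sin α)) (2 * B)]
    exact mul_le_mul_of_nonneg_right (by rw [mul_one_div]; linarith) (by positivity)
  -- Because N is an integer, measuring the action from N only changes the integer of the phase
  -- reduction.
  have e1 : ψ (j + 1) = ψ j - (R j - N) - ((N - k : ℤ) : ℝ) + (ψ (j + 1) - (ψ j - R j + k)) := by
    push_cast; ring
  have e2 : R (j + 1) - N = R j - N + (2 - 2 * Real.cos α) * ψ (j + 1) +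
      (R (j + 1) - R j - (2 - 2 * Real.cos α) * ψ (j + 1)) := by ring
  rw [e2] at hl
  rcases h.near_boundary hm (hk.trans hε) (hst.trans hε) ((hψ1 j).trans (by linarith)) hψ'0
    (hψ'.trans (by linarith)) e1 hj hl1 hlm hl with (g | ⟨n, n1, n2, g⟩) | g
  · exact ⟨j, hW, Or.inl (g.trans hK1)⟩
  · exact ⟨j, hW, Or.inr ⟨n, n1, n2, g.trans hK1⟩⟩
  · rw [← e2] at g
    exact ⟨j + 1, hW', Or.inr ⟨l, hl1, hlm, g.trans hK2⟩⟩

end IsBarrierAngle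

end Barrier

/-! ### Area of thin slabs. -/

section Measure

/-- Slabs of horizontal width `2 * δ / a` over a set of heights. -/
theorem volume_slab_le {I : Set ℝ} (hI : MeasurableSet I) {g : ℝ → ℝ} (hg : Measurable g)
    {a δ : ℝ} (ha : 0 < a) :
    volume {z : ℝ × ℝ | z.2 ∈ I ∧ |a * z.1 - g z.2| ≤ δ} ≤
      ENNReal.ofReal (2 * δ / a) * volume I := by
  have hm : MeasurableSet {z : ℝ × ℝ | z.2 ∈ I ∧ |a * z.1 - g z.2| ≤ δ} := by
    have h : Measurable fun z : ℝ × ℝ => |a * z.1 - g z.2| := by fun_prop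
    exact (measurable_snd hI).inter (measurableSet_le h measurable_const)
  rw [Measure.volume_eq_prod, Measure.prod_apply_symm hm]
  calc _ ≤ ∫⁻ y, I.indicator (fun _ => ENNReal.ofReal (2 * δ / a)) y := by
        refine lintegral_mono fun y => ?_
        by_cases hy : y ∈ I
        · rw [Set.indicator_of_mem hy]
          calc _ ≤ volume (Set.Icc ((g y - δ) / a) ((g y + δ) / a)) := by
                refine measure_mono fun x hx => ?_
                obtain ⟨h1, h2⟩ := abs_le.1 hx.2
                simp only at h1 h2
                rw [Set.mem_Icc, div_le_iff₀ ha, le_div_iff₀ ha]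
                constructor <;> linarith
            _ = _ := by
                rw [Real.volume_Icc]
                congr 1
                ring
        · rw [Set.indicator_of_notMem hy]
          refine le_of_eq (measure_mono_null (t := ∅) ?_ measure_empty)
          exact fun x hx => hy hx.1
    _ = _ := by rw [lintegral_indicator_const hI]

theorem tendsto_ofReal_const_div (c : ℝ) :
    Tendsto (fun N : ℕ => ENNReal.ofReal (c / N)) atTop (𝓝 0) := by
  have := ENNReal.tendsto_ofReal (tendsto_const_div_atTop_nhds_zero_nat c)
  rwa [ENNReal.ofReal_zero] at this

end Measure

/-! ### The barrier windows have area tending to zero. -/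

section Window

variable {β α : ℝ} {m : ℕ}

/-- The points of the strip close to the boundary of the barrier at height `N`. -/
def barrierWindow (β α : ℝ) (m : ℕ) (K W : ℝ) (N : ℕ) : Set (ℝ × ℝ) :=
  {z | |z.2| ≤ 4 ∧ |action β z - N| ≤ W ∧ (|phase β z - 1 / 2| ≤ K / N ∨
    ∃ n, 1 ≤ n ∧ n < m ∧ |linearPhase α n (action β z - N) (phase β z) + 1 / 2| ≤ K / N)}

theorem measurable_action (β : ℝ) : Measurable (action β) := by
  unfold action linearInvariant; fun_prop

theorem measurable_phase (β : ℝ) : Measurable (phase β) := by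
  unfold phase; fun_prop

theorem measurableSet_barrierWindow (β α : ℝ) (m : ℕ) (K W : ℝ) (N : ℕ) :
    MeasurableSet (barrierWindow β α m K W N) := by
  have h1 := measurable_action β
  have h2 := measurable_phase β
  have e : barrierWindow β α m K W N = {z | |z.2| ≤ 4} ∩ ({z | |action β z - N| ≤ W} ∩
      ({z | |phase β z - 1 / 2| ≤ K / N} ∪ ⋃ n : ℕ, ⋃ _ : 1 ≤ n, ⋃ _ : n < m,
        {z | |linearPhase α n (action β z - N) (phase β z) + 1 / 2| ≤ K / N})) := by
    ext z
    simp only [barrierWindow, Set.mem_inter_iff, Set.mem_union, Set.mem_iUnion, Set.mem_ofPred_eq,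
      exists_prop]
  rw [e]
  refine (measurableSet_le (by fun_prop) measurable_const).inter
    ((measurableSet_le (by fun_prop) measurable_const).inter
    ((measurableSet_le (by fun_prop) measurable_const).union ?_))
  refine .iUnion fun n => .iUnion fun _ => .iUnion fun _ => ?_
  unfold linearPhase
  exact measurableSet_le (by fun_prop) measurable_const

/-- The window is covered by m slabs: one with bounded width and height O(1/N) for the edge ψ = 1/2,
and m - 1 with bounded height and width O(1/N) for the other sides, whose dependence on z.1 is
nondegenerate. -/
theorem tendsto_volume_barrierWindow (hβ0 : 0 < β) (hβ : β < Real.pi / 2)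
    (h : IsBarrierAngle α m) (K W : ℝ) :
    Tendsto (fun N => volume (barrierWindow β α m K W N)) atTop (𝓝 0) := by
  have hc : 0 < Real.cos β := Real.cos_pos_of_mem_Ioo ⟨by linarith, hβ⟩
  have hA := (shearFactor_bounds hβ0 hβ).1
  set a := shearFactor β / 2 * (1 + Real.cos β) with ha
  have ha0 : 0 < a := by positivity
  set T : ℕ → ℕ → ENNReal := fun n N =>
    ENNReal.ofReal (2 * K / (actionCoeff α n * a) / N) * volume (Set.Icc (-4 : ℝ) 4)
  set U : ℕ → ENNReal := fun N =>
    ENNReal.ofReal (2 * W / a) * ENNReal.ofReal (4 * (1 + Real.cos β) * K / N)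
  have hle : ∀ N, volume (barrierWindow β α m K W N) ≤ U N + ∑ n ∈ Finset.Ico 1 m, T n N := by
    intro N
    have hsub : barrierWindow β α m K W N ⊆
        {z : ℝ × ℝ | z.2 ∈ Set.Icc (2 + Real.cos β - 2 * (1 + Real.cos β) * (K / N))
            (2 + Real.cos β + 2 * (1 + Real.cos β) * (K / N)) ∧ |a * z.1 -
          (N + 1 / 2 - shearFactor β / 2 * (Real.sin β * z.2 - Real.sin β))| ≤ W} ∪
        ⋃ n ∈ Finset.Ico 1 m, {z : ℝ × ℝ | z.2 ∈ Set.Icc (-4 : ℝ) 4 ∧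
          |(actionCoeff α n * a) * z.1 - (phaseCoeff α n * ((z.2 - 1) / (2 * (1 + Real.cos β))) +
            1 / 2 - actionCoeff α n * (shearFactor β / 2 * (Real.sin β * z.2 - Real.sin β)
              - 1 / 2 - N))| ≤ K / N} := by
      rintro z ⟨h1, h2, h3 | ⟨n, hn1, hn2, h3⟩⟩
      · refine Or.inl ⟨?_, ?_⟩
        · have e : phase β z - 1 / 2 = (z.2 - (2 + Real.cos β)) / (2 * (1 + Real.cos β)) := by
            unfold phase; field_simp; ring
          rw [e, abs_div, abs_of_pos (by linarith : 0 < 2 * (1 + Real.cos β)),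
            div_le_iff₀ (by linarith), abs_le] at h3
          constructor <;> linarith
        · refine le_of_eq_of_le ?_ h2
          congr 1
          unfold action linearInvariant
          rw [ha]
          ring
      · refine Or.inr (Set.mem_biUnion (Finset.mem_coe.2 (Finset.mem_Ico.2 ⟨hn1, hn2⟩))
          ⟨abs_le.1 h1, ?_⟩)
        rw [← abs_neg] at h3
        refine le_of_eq_of_le ?_ h3
        congr 1
        unfold linearPhase action phase linearInvariant
        rw [ha]
        ring
    refine (measure_mono hsub).trans ((measure_union_le _ _).trans (add_le_add ?_ ?_))
    · refine (volume_slab_le measurableSet_Icc (g := fun y => N + 1 / 2 -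
        shearFactor β / 2 * (Real.sin β * y - Real.sin β)) (by fun_prop) ha0).trans ?_
      rw [Real.volume_Icc]
      refine le_of_eq ?_
      congr 2
      ring
    · refine (measure_biUnion_finset_le _ _).trans (Finset.sum_le_sum fun n hn => ?_)
      obtain ⟨hn1, hn2⟩ := Finset.mem_Ico.1 hn
      have := h.one_le_actionCoeff hn1 hn2
      refine (volume_slab_le measurableSet_Icc (g := fun y => phaseCoeff α n *
        ((y - 1) / (2 * (1 + Real.cos β))) + 1 / 2 - actionCoeff α n *
          (shearFactor β / 2 * (Real.sin β * y - Real.sin β) - 1 / 2 - N))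
        (by fun_prop) (by positivity)).trans ?_
      refine le_of_eq ?_
      simp only [T]
      congr 2
      ring
  have hU : Tendsto U atTop (𝓝 0) := by
    have := ENNReal.Tendsto.const_mul (a := ENNReal.ofReal (2 * W / a))
      (tendsto_ofReal_const_div (4 * (1 + Real.cos β) * K)) (Or.inr ENNReal.ofReal_ne_top)
    rwa [mul_zero] at this
  have hT : ∀ n ∈ Finset.Ico 1 m, Tendsto (T n) atTop (𝓝 0) := by
    intro n _
    have := ENNReal.Tendsto.mul_const (b := volume (Set.Icc (-4 : ℝ) 4))
      (tendsto_ofReal_const_div (2 * K / (actionCoeff α n * a)))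
      (Or.inr (by rw [Real.volume_Icc]; exact ENNReal.ofReal_ne_top))
    rwa [zero_mul] at this
  have hlim := hU.add (tendsto_finsetSum _ hT)
  rw [Finset.sum_const_zero, add_zero] at hlim
  exact tendsto_of_tendsto_of_tendsto_of_le_of_le tendsto_const_nhds hlim
    (fun _ => zero_le) hle

end Window

/-! ### Escaping orbits meet all sufficiently high windows. -/

section Orbit

variable {β α : ℝ} {m : ℕ}

theorem tendsto_radius {u : ℕ → ℝ × ℝ} (hu : Tendsto u atTop (cocompact (ℝ × ℝ))) :
    Tendsto (fun n => radius (u n)) atTop atTop := by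
  refine tendsto_atTop_mono (fun n => ?_) ((tendsto_norm_cocompact_atTop (E := ℝ × ℝ)).comp hu)
  rw [Function.comp_apply, Prod.norm_def]
  exact max_le (Real.abs_le_sqrt (by nlinarith [sq_nonneg (u n).2]))
    (Real.abs_le_sqrt (by nlinarith [sq_nonneg (u n).1]))

theorem action_bounds (hβ0 : 0 < β) (hβ : β < Real.pi / 2) {z : ℝ × ℝ} (hz : z ∈ strip β) :
    shearFactor β / 2 * (radius z - 7) - 1 / 2 ≤ action β z ∧ action β z ≤ 6 * radius z := by
  obtain ⟨hx, hy1, hy2⟩ := hz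
  obtain ⟨hA0, hA4⟩ := shearFactor_bounds hβ0 hβ
  have hs : 0 < Real.sin β := Real.sin_pos_of_pos_of_lt_pi hβ0 (by linarith)
  have hc : 0 < Real.cos β := Real.cos_pos_of_mem_Ioo ⟨by linarith, hβ⟩
  have hs1 := Real.sin_le_one β
  have hc1 := Real.cos_le_one β
  have hr2 := radius_sq z
  have hr0 := radius_nonneg z
  have hxr : z.1 ≤ radius z := by nlinarith [sq_nonneg z.2]
  have hyr : z.2 ≤ radius z := by nlinarith [sq_nonneg z.1]
  have hrx : radius z ≤ z.1 + 4 := by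
    have : z.2 ^ 2 ≤ 16 := by nlinarith
    refine (abs_le_of_sq_le_sq' ?_ (by linarith)).2
    nlinarith
  have hI1 : radius z - 7 ≤ linearInvariant β z := by
    unfold linearInvariant
    nlinarith
  have hI2 : linearInvariant β z ≤ 3 * radius z := by
    unfold linearInvariant
    nlinarith
  unfold action
  constructor
  · have := mul_le_mul_of_nonneg_left hI1 (by linarith : 0 ≤ shearFactor β / 2)
    linarith
  · nlinarith

theorem neg_half_lt_phase (hβ0 : 0 < β) (hβ : β < Real.pi / 2) {z : ℝ × ℝ} (hz : z ∈ strip β) :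
    -1 / 2 < phase β z := by
  have hc : 0 < Real.cos β := Real.cos_pos_of_mem_Ioo ⟨by linarith, hβ⟩
  unfold phase
  rw [lt_div_iff₀ (by linarith)]
  linarith [hz.2.1]

/-- If the linear part of the return map is a rotation by `π / m`, then every escaping orbit
crosses the windows of all large barriers. -/
theorem eventually_mem_barrierWindow (hβ0 : 0 < β) (hβ : β < Real.pi / 2) (hm : 3 ≤ m)
    (h : IsBarrierAngle α m) (hC : shearConstant β = 2 - 2 * Real.cos α) :
    ∃ K W : ℝ, ∀ u : ℕ → ℝ × ℝ,
      (∀ n, OuterBilliardStep (circularSector β) (u n) (u (n + 1))) →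
      Tendsto u atTop (cocompact (ℝ × ℝ)) →
      ∀ᶠ N in atTop, ∃ n, u n ∈ barrierWindow β α m K W N := by
  obtain ⟨ρ, B, hρ, hB, hret⟩ := exists_return hβ0 hβ
  obtain ⟨K, W, hK, hW, hbar⟩ := h.exists_near_boundary hm (B := 6 * B) (by linarith)
  obtain ⟨hA0, hA4⟩ := shearFactor_bounds hβ0 hβ
  refine ⟨K, W, fun u hu ht => ?_⟩
  have hr := tendsto_radius ht
  obtain ⟨M, hM⟩ := eventually_atTop.1 (hr.eventually_ge_atTop (ρ + 7 + 3 / shearFactor β))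
  have h3A : 0 < 3 / shearFactor β := by positivity
  obtain ⟨n₀, hn₀, hn₀s⟩ := exists_mem_strip hβ0 hβ hu hr M
  let S := {n : ℕ // M ≤ n ∧ u n ∈ strip β}
  have hnext : ∀ s : S, ∃ t : S, s.1 < t.1 ∧
      (∃ k : ℤ, |phase β (u t.1) - (phase β (u s.1) - action β (u s.1) + k)| ≤
        B / radius (u s.1)) ∧
      |action β (u t.1) - action β (u s.1) - shearConstant β * phase β (u t.1)| ≤
        B / radius (u s.1) ∧ phase β (u t.1) ≤ 1 / 2 + B / radius (u t.1) := by
    rintro ⟨s, hs1, hs2⟩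
    obtain ⟨t, ht1, ht2, ht3⟩ := hret u hu s hs2 (by linarith [hM s hs1])
    exact ⟨⟨t, by omega, ht2⟩, ht1, ht3⟩
  choose next hnext using hnext
  let τ : ℕ → S := fun j => next^[j] ⟨n₀, hn₀, hn₀s⟩
  have hτ : ∀ j, τ (j + 1) = next (τ j) := fun j => Function.iterate_succ_apply' _ _ _
  have hmono : StrictMono fun j => (τ j).1 :=
    strictMono_nat_of_lt_succ fun j => by rw [hτ]; exact (hnext (τ j)).1
  have hrpos : ∀ j, 0 < radius (u (τ j).1) := fun j => by linarith [hM _ (τ j).2.1]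
  have hact1 : ∀ j, 1 ≤ action β (u (τ j).1) := by
    intro j
    have h1 := hM _ (τ j).2.1
    have h2 := (action_bounds hβ0 hβ (τ j).2.2).1
    have h3 : shearFactor β / 2 * (3 / shearFactor β) = 3 / 2 := by field_simp
    have h4 : shearFactor β / 2 * (3 / shearFactor β) ≤
        shearFactor β / 2 * (radius (u (τ j).1) - 7) :=
      mul_le_mul_of_nonneg_left (by linarith) (by linarith)
    linarith
  have herr : ∀ j, B / radius (u (τ j).1) ≤ 6 * B / action β (u (τ j).1) := by
    intro j
    rw [div_le_div_iff₀ (hrpos j) (by linarith [hact1 j])]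
    nlinarith [(action_bounds hβ0 hβ (τ j).2.2).2]
  have hact : Tendsto (fun j => action β (u (τ j).1)) atTop atTop := by
    refine tendsto_atTop_mono (fun j => (action_bounds hβ0 hβ (τ j).2.2).1) ?_
    refine tendsto_atTop_add_const_right _ _ (Tendsto.const_mul_atTop (by linarith) ?_)
    exact tendsto_atTop_add_const_right _ _ (hr.comp hmono.tendsto_atTop)
  -- The sequence starts at index 1: the upper bound on the phase is known only for points that
  -- arise from a passage.
  have key := hbar (fun j => action β (u (τ (j + 1)).1)) (fun j => phase β (u (τ (j + 1)).1))
    (hact.comp (tendsto_add_atTop_nat 1)) (fun j => hact1 _)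
    (fun j => neg_half_lt_phase hβ0 hβ (τ (j + 1)).2.2)
    (fun j => by
      have := (hnext (τ j)).2.2.2
      rw [← hτ] at this
      linarith [herr (j + 1)])
    (fun j => by
      obtain ⟨k, hk⟩ := (hnext (τ (j + 1))).2.1
      rw [← hτ] at hk
      exact ⟨k, hk.trans (herr _)⟩)
    (fun j => by
      have := (hnext (τ (j + 1))).2.2.1
      rw [← hτ, hC] at this
      exact this.trans (herr _))
  filter_upwards [key] with N ⟨j, hj1, hj2⟩
  refine ⟨(τ (j + 1)).1, ?_, hj1, hj2⟩
  obtain ⟨-, h1, h2⟩ := (τ (j + 1)).2.2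
  rw [abs_le]
  exact ⟨by linarith [Real.cos_le_one β], h2⟩

theorem volume_escapingSet_circularSector (hβ0 : 0 < β) (hβ : β < Real.pi / 2) (hm : 3 ≤ m)
    (hC : shearConstant β = 2 - 2 * Real.cos (Real.pi / m)) :
    volume (escapingSet (circularSector β)) = 0 := by
  have h := isBarrierAngle hm
  obtain ⟨K, W, hKW⟩ := eventually_mem_barrierWindow hβ0 hβ hm h hC
  exact volume_escapingSet_eq_zero (measurableSet_barrierWindow β _ m K W)
    (tendsto_volume_barrierWindow hβ0 hβ h K W) hKW

end Orbit

/-! ### Choice of the angles. -/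

section Angles

theorem continuousOn_shearConstant : ContinuousOn shearConstant (Set.Icc 0 (Real.pi / 2)) := by
  have h : ContinuousOn (fun β : ℝ => Real.tan (β / 2)) (Set.Icc 0 (Real.pi / 2)) := by
    have : ∀ β ∈ Set.Icc 0 (Real.pi / 2), Real.cos (β / 2) ≠ 0 := fun β hβ =>
      (Real.cos_pos_of_mem_Ioo ⟨by linarith [hβ.1, Real.pi_pos], by
        linarith [hβ.2, Real.pi_pos]⟩).ne'
    simp only [Real.tan_eq_sin_div_cos]
    exact ContinuousOn.div (by fun_prop) (by fun_prop) this
  unfold shearConstant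
  fun_prop

theorem shearConstant_pos {β : ℝ} (hβ0 : 0 < β) (hβ : β < Real.pi / 2) : 0 < shearConstant β := by
  have hs : 0 < Real.sin β := Real.sin_pos_of_pos_of_lt_pi hβ0 (by linarith)
  have hc : 0 < Real.cos β := Real.cos_pos_of_mem_Ioo ⟨by linarith, hβ⟩
  have hA : 0 < (Real.pi - 2 * β) / 4 + Real.tan (β / 2) ^ 3 / 3 + Real.tan (β / 2) :=
    (shearFactor_bounds hβ0 hβ).1
  unfold shearConstant
  rw [Real.sin_two_mul]
  positivity

theorem shearConstant_zero : shearConstant 0 = 0 := by simp [shearConstant]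

theorem shearConstant_pi_div_two : shearConstant (Real.pi / 2) = 8 / 3 := by
  unfold shearConstant
  rw [show Real.pi / 2 / 2 = Real.pi / 4 by ring, show 2 * (Real.pi / 2) = Real.pi by ring,
    Real.tan_pi_div_four, Real.sin_pi, Real.sin_pi_div_two]
  norm_num

/-- The smallest angle at which the shear constant reaches the value `v`. -/
noncomputable def firstAngle (v : ℝ) : ℝ := sInf {β ∈ Set.Icc 0 (Real.pi / 2) | v ≤ shearConstant β}

theorem firstAngle_le {v β : ℝ} (hβ : β ∈ Set.Icc 0 (Real.pi / 2)) (h : v ≤ shearConstant β) :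
    firstAngle v ≤ β :=
  csInf_le ⟨0, fun _ hx => hx.1.1⟩ ⟨hβ, h⟩

/-- At the smallest angle with C ≥ v, the intermediate value theorem forces C = v; as 0 < v < 8/3,
neither end point of the interval is possible. The bound v ≤ 1 is the case m ≥ 3. -/
theorem firstAngle_spec {v : ℝ} (hv0 : 0 < v) (hv1 : v ≤ 1) :
    firstAngle v ∈ Set.Ioo 0 (Real.pi / 2) ∧ shearConstant (firstAngle v) = v := by
  have hpi := Real.pi_pos
  have hcl : IsClosed {β ∈ Set.Icc 0 (Real.pi / 2) | v ≤ shearConstant β} :=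
    continuousOn_shearConstant.preimage_isClosed_of_isClosed isClosed_Icc isClosed_Ici
  obtain ⟨h1, h2⟩ : firstAngle v ∈ {β ∈ Set.Icc 0 (Real.pi / 2) | v ≤ shearConstant β} := by
    refine hcl.csInf_mem ⟨Real.pi / 2, ⟨by linarith, le_rfl⟩, ?_⟩ ⟨0, fun _ hx => hx.1.1⟩
    rw [shearConstant_pi_div_two]
    linarith
  have h3 : shearConstant (firstAngle v) = v := by
    obtain ⟨x, hx, hxv⟩ := intermediate_value_Icc h1.1
      (continuousOn_shearConstant.mono (Set.Icc_subset_Icc_right h1.2))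
      (show v ∈ Set.Icc _ _ from ⟨by rw [shearConstant_zero]; exact hv0.le, h2⟩)
    rw [le_antisymm (firstAngle_le ⟨hx.1, hx.2.trans h1.2⟩ hxv.ge) hx.2, hxv]
  refine ⟨⟨lt_of_le_of_ne h1.1 fun e => ?_, lt_of_le_of_ne h1.2 fun e => ?_⟩, h3⟩
  · rw [← e, shearConstant_zero] at h3
    linarith
  · rw [e, shearConstant_pi_div_two] at h3
    linarith

theorem asymptoticRotationNumber_eq {β α : ℝ} (h0 : 0 ≤ α) (h1 : α ≤ Real.pi)
    (hC : shearConstant β = 2 - 2 * Real.cos α) : asymptoticRotationNumber β = α := by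
  unfold asymptoticRotationNumber linearPart
  rw [Matrix.trace_fin_two_of, hC, ← Real.arccos_cos h0 h1]
  congr 1
  rw [Real.arccos_cos h0 h1]
  ring

theorem two_sub_two_cos_bounds {m : ℕ} (hm : 3 ≤ m) :
    0 < 2 - 2 * Real.cos (Real.pi / m) ∧ 2 - 2 * Real.cos (Real.pi / m) ≤ 1 := by
  have h := isBarrierAngle hm
  have h1 := h.half_le_cos
  have h2 := Real.cos_lt_cos_of_nonneg_of_le_pi le_rfl (by linarith [h.le, Real.pi_pos]) h.pos
  rw [Real.cos_zero] at h2
  constructor <;> linarith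

/-- C is positive at every ε in (0, π/2), so for large m the value 2 - 2 cos(π/m) is at most C(ε)
and is therefore reached at or before ε. -/
theorem tendsto_firstAngle :
    Tendsto (fun m : ℕ => firstAngle (2 - 2 * Real.cos (Real.pi / m))) atTop (𝓝 0) := by
  have hpi := Real.pi_pos
  have hv : Tendsto (fun m : ℕ => 2 - 2 * Real.cos (Real.pi / m)) atTop (𝓝 0) := by
    have h := tendsto_const_div_atTop_nhds_zero_nat Real.pi
    have := ((Real.continuous_cos.tendsto 0).comp h).const_mul 2 |>.const_sub 2
    simpa using this
  refine tendsto_order.2 ⟨fun a ha => ?_, fun a ha => ?_⟩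
  · filter_upwards [eventually_ge_atTop 3] with m hm
    obtain ⟨h1, h2⟩ := two_sub_two_cos_bounds hm
    linarith [(firstAngle_spec h1 h2).1.1]
  · set ε := min (a / 2) (Real.pi / 4)
    have hε : 0 < ε := lt_min (by linarith) (by linarith)
    have hε1 : ε ≤ Real.pi / 4 := min_le_right _ _
    have hε2 : ε ≤ a / 2 := min_le_left _ _
    filter_upwards [hv.eventually_le_const (shearConstant_pos hε (by linarith))] with m hm
    have := firstAngle_le ⟨hε.le, by linarith⟩ hm
    linarith

end Angles

theorem theorem2 :
    ∃ β : ℕ → ℝ,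
      StrictAntiOn β (Set.Ici 3) ∧
      (∀ m, 3 ≤ m → β m ∈ Set.Ioo 0 (Real.pi / 2)) ∧
      Tendsto β atTop (𝓝 0) ∧
      (∀ m, 3 ≤ m → asymptoticRotationNumber (β m) = Real.pi / m) ∧
      (∀ m, 3 ≤ m → volume (escapingSet (circularSector (β m))) = 0) := by
  have hspec : ∀ m : ℕ, 3 ≤ m → _ := fun m hm =>
    firstAngle_spec (two_sub_two_cos_bounds hm).1 (two_sub_two_cos_bounds hm).2
  refine ⟨fun m => firstAngle (2 - 2 * Real.cos (Real.pi / m)), ?_, fun m hm => (hspec m hm).1,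
    tendsto_firstAngle, fun m hm => ?_, fun m hm => ?_⟩
  · intro m (hm : 3 ≤ m) n (hn : 3 ≤ n) hmn
    obtain ⟨hm1, hm2⟩ := hspec m hm
    obtain ⟨hn1, hn2⟩ := hspec n hn
    have hm0 : (0 : ℝ) < m := by positivity
    have hlt : Real.pi / n < Real.pi / m :=
      div_lt_div_of_pos_left Real.pi_pos hm0 (by exact_mod_cast hmn)
    have hcos := Real.cos_lt_cos_of_nonneg_of_le_pi (isBarrierAngle hn).pos.le
      (by linarith [(isBarrierAngle hm).le, Real.pi_pos]) hlt
    -- A smaller value of C is reached no later than a larger one, and the two angles differ because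
    -- C takes different values there.
    refine lt_of_le_of_ne (firstAngle_le (Set.Ioo_subset_Icc_self hm1) (by linarith)) fun e => ?_
    simp only at e
    rw [e] at hn2
    linarith
  · have h := isBarrierAngle hm
    exact asymptoticRotationNumber_eq h.pos.le (by linarith [h.le, Real.pi_pos]) (hspec m hm).2
  · exact volume_escapingSet_circularSector (hspec m hm).1.1 (hspec m hm).1.2 hm (hspec m hm).2
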